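/- **Theorem.** Let $p,d\ge 1$, let $g:\mathbb R^d\times\mathbb R^p\to\mathbb R^p$ be measurable in its first argument, and let $X\sim P_X$, $Y\sim P_Y$ be random vectors in $\mathbb R^d$. Let $\theta_{x_0},\theta_{y_0}\in\mathbb R^p$ be the unique solutions of $E\,g(X,\theta_x)=0$ and $E\,g(Y,\theta_y)=0$, let $\pi=\theta_y-\theta_x$ be the parameter of interest, and assume $H_0:\ \theta_{y_0}-\theta_{x_0}=\pi_0$. Assume: * $\mathrm{Var}[g(X,\theta_{x_0})]$ and $\mathrm{Var}[g(Y,\theta_{y_0})]$ are positive definite. * There is an open neighbourhood $U_x$ of $\theta_{x_0}$ on which, for $P_X$-almost every $x$, $\partial g(x,\theta)/\partial\theta$ and $\partial^2 g(x,\theta)/\partial\theta\partial\theta'$ are continuous in $\theta$ and bounded in norm by a $P_X$-integrable function $H_x(x)$; the same holds for $P_Y$, on an open neighbourhood $U_y$ of $\theta_{y_0}$, with a $P_Y$-integrable bound $H_y(y)$. * $E\|g(X,\theta_{x_0})\|^3<\infty$ and $\limsup_{\|t\|\to\infty}|E\exp\{i\,t'g(X,\theta_{x_0})\}|<1$, and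 likewise for $g(Y,\theta_{y_0})$. * The $p\times p$ matrices $E[\partial g(X,\theta_{x_0})/\partial\theta]$ and $E[\partial g(Y,\theta_{y_0})/\partial\theta]$ have rank $p$. Let $n_1,n_2\to\infty$ with $n_1/n_2\to c\in(0,\infty)$, and let the group size $m\ge1$ vary arbitrarily along the sequence (in particular it may be fixed or tend to infinity). At each stage let $X_{ik}$ ($i\le n_1$, $k\le m$) and $Y_{jt}$ ($j\le n_2$, $t\le m$) be mutually independent with $X_{ik}\sim P_X$, $Y_{jt}\sim P_Y$; put $N_1=mn_1$, $N_2=mn_2$. For sets $\Theta_x,\Theta_y\subseteq\mathbb R^p$ let $$R_G(\pi)=\sup\ \prod_{i=1}^{n_1}(N_1p_i)^m\prod_{j=1}^{n_2}(N_2q_j)^m ,$$ the supremum being over $p_i\ge0$, $q_j\ge0$ with $\sum_ip_i=\sum_jq_j=1/m$ for which there are $\theta_x\in\Theta_x$, $\theta_y\in\Theta_y$ with $$\sum_ip_i\sum_kg(X_{ik},\theta_x)=0,\qquad \sum_jq_j\sum_tg(Y_{jt},\theta_y)=0,\qquad \theta_y-\theta_x=\pi$$ (with $R_G(\pi)=0$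 and $-2\log R_G(\pi)=+\infty$ if there are none). Then $$\frac{-2\log R_G(\pi_0)}{m}\ \xrightarrow{d}\ \chi^2_p$$ in each of the following two cases: 1. $\Theta_x=\Theta_y=\mathbb R^p$, provided that the solutions $\theta_x(p)$, $\theta_y(q)$ are well defined, i.e. that with probability tending to one, for all positive weights $(p_i)$ with $\sum_i p_i=1/m$ the equation $\sum_ip_i\sum_kg(X_{ik},\theta)=0$ has at most one solution $\theta\in\mathbb R^p$, and likewise for the $Y$-sample; 2. without that proviso, $\Theta_x=K_x$ and $\Theta_y=K_y$ for any compact convex neighbourhoods $K_x\subseteq U_x$ of $\theta_{x_0}$ and $K_y\subseteq U_y$ of $\theta_{y_0}$. (Convergence in distribution of the possibly non-measurable statistic $T$ means that the outer probabilities of $\{T\le t\}$ and $\{T>t\}$ converge to $\chi^2_p((-\infty,t])$ and $\chi^2_p((t,\infty))$ for every $t\in\mathbb R$.) -/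

import Mathlib

open MeasureTheory ProbabilityTheory Filter Topology
open scoped ENNReal

noncomputable section

/-- `ℝⁿ` with its Euclidean norm. -/
abbrev Vec (n : ℕ) : Type := EuclideanSpace ℝ (Fin n)

/-! ### Population side: the estimating function and the regularity conditions -/

/-- `θ₀` is the parameter of the law `P`: the unique solution of `E[g(X, θ)] = 0`, `X ∼ P`
(an expectation is only said to vanish where it exists). -/
structure IsParameter {d p : ℕ} (g : Vec d → Vec p → Vec p) (P : Measure (Vec d))
    (θ₀ : Vec p) : Prop where
  integrable : Integrable (fun x => g x θ₀) P
  eq_zero : ∫ x, g x θ₀ ∂P = 0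
  unique : ∀ θ : Vec p, Integrable (fun x => g x θ) P → ∫ x, g x θ ∂P = 0 → θ = θ₀

/-- The covariance matrix `Var[g(X, θ)]`, `X ∼ P`. -/
def varMatrix {d p : ℕ} (g : Vec d → Vec p → Vec p) (P : Measure (Vec d)) (θ : Vec p) :
    Matrix (Fin p) (Fin p) ℝ :=
  Matrix.of fun i j => covariance (fun x => g x θ i) (fun x => g x θ j) P

/-- On the open set `U`, `g(x, ·)` has continuous first and second derivatives, and these are
bounded by a `P`-integrable function of `x`, which does not depend on `θ ∈ U`. -/
def RegularOn {d p : ℕ} (g : Vec d → Vec p → Vec p) (P : Measure (Vec d)) (U : Set (Vec p)) :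
    Prop :=
  ∃ H : Vec d → ℝ, Integrable H P ∧ ∀ᵐ x ∂P, ContDiffOn ℝ 2 (g x) U ∧
    ∀ θ ∈ U, ‖fderiv ℝ (g x) θ‖ ≤ H x ∧ ‖fderiv ℝ (fderiv ℝ (g x)) θ‖ ≤ H x

/-- The expected Jacobian `E[∂g(X, θ)/∂θ]`, `X ∼ P`, as a linear map. -/
def meanJacobian {d p : ℕ} (g : Vec d → Vec p → Vec p) (P : Measure (Vec d)) (θ : Vec p) :
    Vec p →L[ℝ] Vec p :=
  ∫ x, fderiv ℝ (g x) θ ∂P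

/-- `E[∂g(X, θ)/∂θ]` has rank `p`. -/
def FullRankJacobian {d p : ℕ} (g : Vec d → Vec p → Vec p) (P : Measure (Vec d))
    (θ : Vec p) : Prop :=
  Module.finrank ℝ (LinearMap.range (meanJacobian g P θ).toLinearMap) = p

/-- `E‖g(X, θ)‖³ < ∞` and `limsup_{‖t‖ → ∞} |E exp(i t'g(X, θ))| < 1`, `X ∼ P`. -/
structure MomentAndCramer {d p : ℕ} (g : Vec d → Vec p → Vec p) (P : Measure (Vec d))
    (θ : Vec p) : Prop where
  moment : Integrable (fun x => ‖g x θ‖ ^ 3) P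
  cramer : limsup (fun t : Vec p => ‖charFun (P.map fun x => g x θ) t‖)
    (Bornology.cobounded (Vec p)) < 1

/-! ### Sample side: the two-sample grouped empirical likelihood -/

/-- The group weights: `w₁, …, wₙ ≥ 0` with `∑ wᵢ = 1 / m`. -/
def IsGroupWeight {n : ℕ} (m : ℕ) (w : Fin n → ℝ) : Prop :=
  (∀ i, 0 ≤ w i) ∧ ∑ i, w i = 1 / (m : ℝ)

/-- `θ` solves the weighted estimating equation `∑ᵢ wᵢ ∑ₖ g(xᵢₖ, θ) = 0`. -/
def SolvesWeighted {d p n m : ℕ} (g : Vec d → Vec p → Vec p) (w : Fin n → ℝ)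
    (x : Fin n → Fin m → Vec d) (θ : Vec p) : Prop :=
  ∑ i, w i • ∑ k, g (x i k) θ = 0

/-- For every system of positive group weights, the weighted estimating equation has at most one
solution `θ`, so that this solution is a well-defined function `θ(w)` of the weights. -/
def SolutionWellDefined {d p n m : ℕ} (g : Vec d → Vec p → Vec p)
    (x : Fin n → Fin m → Vec d) : Prop :=
  ∀ w : Fin n → ℝ, IsGroupWeight m w → (∀ i, 0 < w i) →
    ∀ θ θ' : Vec p, SolvesWeighted g w x θ → SolvesWeighted g w x θ' → θ = θ'

/-- The two-sample grouped empirical likelihood ratio `R_G(π)`: the supremum of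
`∏ᵢ (N₁ vᵢ)ᵐ ∏ⱼ (N₂ wⱼ)ᵐ`, where `N₁ = m n₁`, `N₂ = m n₂`, over the group weights `v`, `w` for
which the two weighted estimating equations have solutions `θx ∈ Θx`, `θy ∈ Θy` with
`θy - θx = π`. Here `N₁⁻¹` and `N₂⁻¹` are the weights that maximize `∏ᵢ vᵢᵐ ∏ⱼ wⱼᵐ` when the
estimating equations are not imposed. The supremum is `0` if there are no such weights. -/
def gelRatio {d p n₁ n₂ m : ℕ} (g : Vec d → Vec p → Vec p) (Θx Θy : Set (Vec p)) (π : Vec p)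
    (x : Fin n₁ → Fin m → Vec d) (y : Fin n₂ → Fin m → Vec d) : ℝ≥0∞ :=
  sSup {r | ∃ (v : Fin n₁ → ℝ) (w : Fin n₂ → ℝ) (θx θy : Vec p),
    IsGroupWeight m v ∧ IsGroupWeight m w ∧ θx ∈ Θx ∧ θy ∈ Θy ∧
    SolvesWeighted g v x θx ∧ SolvesWeighted g w y θy ∧ θy - θx = π ∧
    r = ENNReal.ofReal ((∏ i, ((m : ℝ) * n₁ * v i) ^ m) * ∏ j, ((m : ℝ) * n₂ * w j) ^ m)}

/-- The grouped empirical log-likelihood ratio `-2 log R_G(π)`; it is `+∞` if `R_G(π) = 0`. -/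
def gelLogRatio {d p n₁ n₂ m : ℕ} (g : Vec d → Vec p → Vec p) (Θx Θy : Set (Vec p)) (π : Vec p)
    (x : Fin n₁ → Fin m → Vec d) (y : Fin n₂ → Fin m → Vec d) : EReal :=
  -2 * ENNReal.log (gelRatio g Θx Θy π x y)

/-- The sampling scheme with group size `m`: the `m n₁` observations `X i k` have law `PX`, the
`m n₂` observations `Y j t` have law `PY`, and all of them are independent. -/
structure IsTwoSample {Ω : Type*} [MeasurableSpace Ω] {d n₁ n₂ m : ℕ} (μ : Measure Ω)
    (PX PY : Measure (Vec d)) (X : Fin n₁ → Fin m → Ω → Vec d) (Y : Fin n₂ → Fin m → Ω → Vec d) :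
    Prop where
  law_X : ∀ i k, HasLaw (X i k) PX μ
  law_Y : ∀ j t, HasLaw (Y j t) PY μ
  indep : iIndepFun (Sum.elim (fun a : Fin n₁ × Fin m => X a.1 a.2)
    (fun b : Fin n₂ × Fin m => Y b.1 b.2)) μ

/-! ### Convergence in distribution to a chi-square law -/

/-- The chi-square law with `p` degrees of freedom: the law of `Z₁² + ⋯ + Z_p²` with independent
standard normal `Z₁, …, Z_p`. -/
def chiSquare (p : ℕ) : Measure ℝ :=
  (Measure.pi fun _ : Fin p => gaussianReal 0 1).map fun z => ∑ i, z i ^ 2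

/-- `T k` converges in distribution to `χ²_p` (`p ≥ 1`, so that the limiting distribution function
is continuous). As `T k` is a supremum over an uncountable family, it is not assumed to be
measurable: `μ` of a non-measurable set is its outer measure, and both `T k ≤ t` and its complement
are required to have the right limit. If `T k` is measurable, either limit implies the other. -/
def TendstoChiSquare {Ω : Type*} [MeasurableSpace Ω] (μ : Measure Ω) (T : ℕ → Ω → EReal)
    (p : ℕ) : Prop :=
  ∀ t : ℝ,
    Tendsto (fun k => μ {ω | T k ω ≤ (t : EReal)}) atTop (𝓝 (chiSquare p (Set.Iic t))) ∧
    Tendsto (fun k => μ {ω | (t : EReal) < T k ω}) atTop (𝓝 (chiSquare p (Set.Ioi t)))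

end

/-! Rescale the weights to mean one, `w i = m n v i`. The exponent `m` then cancels: the statistic
divided by `m` is the infimum of `negTwoLog w + negTwoLog u` over feasible relative weights, and the
observations enter through the group sums `z i = m^{-1/2} ∑ k, g (x i k) θ`.

For one sample at a fixed parameter, the least cost of enforcing `∑ w i • z i = 0` is asymptotically
`S' V⁻¹ S`, where `S = n^{-1/2} ∑ z i` and `V` is the second moment of `g`. The lower bound is weak
duality, valid for every bounded multiplier (`eventually_le_negTwoLog`); the upper bound comes from
explicit weights that are affine in `z i` (`eventually_exists_negTwoLog_le`).

At `θx = θx₀ + h / √N₁` and `θy = θx + π₀` the two normalized sums become `Sx + Jx h` and `Sy + ρ Jy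
h` up to `o(1)`, with `ρ = lim √(n₂ / n₁)`. If `ρ A Jy = Jx`, the contrast `D = Sx - A Sy` is free
of `h`, and minimizing the sum of the two quadratic forms over `h` leaves `D' (Vx + A Vy A')⁻¹ D =
‖M D‖²`, where `M' M` is that inverse. The central limit theorem makes `M D` asymptotically standard
normal, whence the chi-square law (`le_negTwoLog_add`, `exists_negTwoLog_add_le`,
`tendsto_measure_norm_contrast_le`).

The lower bound requires that nearly optimal parameters lie within `O(N^{-1/2})` of the truth. A
bounded likelihood ratio bounds `∑ (w i - 1)²`, so laws of large numbers survive arbitrary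
data-dependent weights of that kind. Consistency then follows either from a root near `θ₀` together
with uniqueness (`localized_of_unique`) or from compactness (`localized_of_compact`), and
linearization upgrades it to the rate (`exists_rate`). Arbitrary `m` is harmless because the third
moments of the group sums are bounded independently of `m`.

The asymptotic analysis is deterministic, along a filter on `ℕ × Ω`: convergence in probability is
convergence along `probFilter`. Boundedness in probability becomes honest boundedness after
restriction to events of probability close to one, and conditions such as "the statistic is at most
`t`" are imposed by refining the filter. -/

noncomputable section

/-! ### Relative weights -/

/-- Positive weights relative to the uniform weights: `w₁, …, wₙ > 0` with `∑ wᵢ = n`. -/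
def IsRelWeight {n : ℕ} (w : Fin n → ℝ) : Prop :=
  (∀ i, 0 < w i) ∧ ∑ i, w i = n

/-- The empirical log-likelihood ratio `-2 ∑ log wᵢ` of relative weights. -/
def negTwoLog {n : ℕ} (w : Fin n → ℝ) : ℝ := -2 * ∑ i, Real.log (w i)

/-- Twice the inequality `log √x ≤ √x - 1`. It converts a bounded likelihood ratio into a
Hellinger-type bound on the weights. -/
lemma Real.sqrt_sub_one_sq_le_sub_log {x : ℝ} (hx : 0 < x) :
    (√x - 1) ^ 2 ≤ x - 1 - Real.log x := by
  have h1 : Real.log (√x) ≤ √x - 1 := Real.log_le_sub_one_of_pos (Real.sqrt_pos.2 hx)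
  rw [Real.log_sqrt hx.le] at h1
  nlinarith [Real.sq_sqrt hx.le]

/-- Since `∑ (w i - 1) = 0`, these terms may be added freely, and every summand becomes nonnegative.
-/
lemma IsRelWeight.negTwoLog_eq {n : ℕ} {w : Fin n → ℝ} (hw : IsRelWeight w) :
    negTwoLog w = 2 * ∑ i, (w i - 1 - Real.log (w i)) := by
  simp only [negTwoLog, Finset.sum_sub_distrib, hw.2]
  simp

lemma IsRelWeight.negTwoLog_nonneg {n : ℕ} {w : Fin n → ℝ} (hw : IsRelWeight w) :
    0 ≤ negTwoLog w := by
  rw [hw.negTwoLog_eq]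
  exact mul_nonneg zero_le_two (Finset.sum_nonneg fun i _ =>
    (sq_nonneg _).trans (Real.sqrt_sub_one_sq_le_sub_log (hw.1 i)))

lemma IsRelWeight.sum_sqrt_sub_one_sq_le {n : ℕ} {w : Fin n → ℝ} (hw : IsRelWeight w) :
    ∑ i, (√(w i) - 1) ^ 2 ≤ negTwoLog w / 2 := by
  rw [hw.negTwoLog_eq, mul_div_cancel_left₀ _ two_ne_zero]
  exact Finset.sum_le_sum fun i _ => Real.sqrt_sub_one_sq_le_sub_log (hw.1 i)

/-- Relative weights with a bounded log-likelihood ratio are bounded and square-summably close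
to the uniform weights. -/
lemma exists_bound_of_negTwoLog_le (t : ℝ) :
    ∃ B : ℝ, 0 < B ∧ ∀ (n : ℕ) (w : Fin n → ℝ), IsRelWeight w → negTwoLog w ≤ t →
      (∀ i, w i ≤ B) ∧ ∑ i, (w i - 1) ^ 2 ≤ B := by
  set s : ℝ := √(|t| / 2) with hs
  have hs0 : 0 ≤ s := Real.sqrt_nonneg _
  have hs2 : s ^ 2 = |t| / 2 := Real.sq_sqrt (by positivity)
  -- The first summand bounds `w i` through `√(w i) ≤ 1 + s`; together with `w i - 1 = (√(w i) + 1)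
  -- (√(w i) - 1)` the second bounds `∑ (w i - 1)²`.
  refine ⟨(1 + s) ^ 2 + (2 + s) ^ 2 * s ^ 2, by positivity, fun n w hw ht => ?_⟩
  have hsum : ∑ i, (√(w i) - 1) ^ 2 ≤ s ^ 2 := by
    rw [hs2]; exact hw.sum_sqrt_sub_one_sq_le.trans (by linarith [le_abs_self t])
  have hsq : ∀ i, √(w i) ≤ 1 + s := fun i => by
    have h1 : (√(w i) - 1) ^ 2 ≤ s ^ 2 :=
      (Finset.single_le_sum (f := fun i => (√(w i) - 1) ^ 2) (fun _ _ => sq_nonneg _)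
        (Finset.mem_univ i)).trans hsum
    linarith [abs_le_of_sq_le_sq' h1 hs0]
  have hpos : ∀ i, 0 ≤ √(w i) := fun i => Real.sqrt_nonneg _
  have heq : ∀ i, √(w i) ^ 2 = w i := fun i => Real.sq_sqrt (hw.1 i).le
  constructor
  · intro i
    have := pow_le_pow_left₀ (hpos i) (hsq i) 2
    rw [heq] at this
    nlinarith [mul_nonneg (sq_nonneg (2 + s)) (sq_nonneg s)]
  · have : ∑ i, (w i - 1) ^ 2 ≤ ∑ i, (2 + s) ^ 2 * (√(w i) - 1) ^ 2 := by
      refine Finset.sum_le_sum fun i _ => ?_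
      have e : w i - 1 = (√(w i) + 1) * (√(w i) - 1) := by linear_combination - heq i
      rw [e, mul_pow]
      have h1 : √(w i) + 1 ≤ 2 + s := by linarith [hsq i]
      have h2 : 0 ≤ √(w i) + 1 := by linarith [hpos i]
      exact mul_le_mul_of_nonneg_right (pow_le_pow_left₀ h2 h1 2) (sq_nonneg _)
    rw [← Finset.mul_sum] at this
    nlinarith [mul_le_mul_of_nonneg_left hsum (sq_nonneg (2 + s)), sq_nonneg (1 + s)]

lemma sum_abs_le_sqrt_mul {n : ℕ} {u : Fin n → ℝ} {B : ℝ} (hB : ∑ i, u i ^ 2 ≤ B) :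
    ∑ i, |u i| ≤ √(n * B) := by
  apply Real.le_sqrt_of_sq_le
  have := sq_sum_le_card_mul_sum_sq (s := Finset.univ) (f := fun i => |u i|)
  simp only [sq_abs, Finset.card_univ, Fintype.card_fin] at this
  exact this.trans (by gcongr)

/-! ### Weighted averages over grouped samples -/

section Average

variable {D F F' : Type*} [NormedAddCommGroup F] [NormedSpace ℝ F] [NormedAddCommGroup F']
  [NormedSpace ℝ F'] {n m : ℕ}

/-- The average of `f` over all the observations `x i k` of a grouped sample, where the
observations of the group `i` have the relative weight `w i`. -/
def groupAvg (w : Fin n → ℝ) (x : Fin n → Fin m → D) (f : D → F) : F :=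
  ((n : ℝ) * m)⁻¹ • ∑ i, w i • ∑ k, f (x i k)

/-- The sum of `f` over the group `i`, divided by the square root of the group size. -/
def groupSum (x : Fin n → Fin m → D) (f : D → F) (i : Fin n) : F :=
  (√(m : ℝ))⁻¹ • ∑ k, f (x i k)

lemma groupAvg_add (w : Fin n → ℝ) (x : Fin n → Fin m → D) (f f' : D → F) :
    groupAvg w x (fun y => f y + f' y) = groupAvg w x f + groupAvg w x f' := by
  simp [groupAvg, Finset.sum_add_distrib]

lemma groupAvg_sub (w : Fin n → ℝ) (x : Fin n → Fin m → D) (f f' : D → F) :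
    groupAvg w x (fun y => f y - f' y) = groupAvg w x f - groupAvg w x f' := by
  simp [groupAvg, Finset.sum_sub_distrib, smul_sub]

lemma groupAvg_clm (w : Fin n → ℝ) (x : Fin n → Fin m → D) (f : D → F) (L : F →L[ℝ] F') :
    groupAvg w x (fun y => L (f y)) = L (groupAvg w x f) := by
  simp [groupAvg]

lemma groupAvg_const_mul (w : Fin n → ℝ) (x : Fin n → Fin m → D) (f : D → ℝ) (c : ℝ) :
    groupAvg w x (fun y => c * f y) = c * groupAvg w x f :=
  groupAvg_clm w x f (c • ContinuousLinearMap.id ℝ ℝ)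

lemma groupAvg_mono {w : Fin n → ℝ} (hw : ∀ i, 0 ≤ w i) {x : Fin n → Fin m → D} {f f' : D → ℝ}
    (h : ∀ i k, f (x i k) ≤ f' (x i k)) : groupAvg w x f ≤ groupAvg w x f' := by
  simp only [groupAvg, smul_eq_mul]
  gcongr with i _ k _
  · exact hw i
  · exact h i k

lemma norm_groupAvg_le {w : Fin n → ℝ} (hw : ∀ i, 0 ≤ w i) {x : Fin n → Fin m → D} {f : D → F}
    {f' : D → ℝ} (h : ∀ i k, ‖f (x i k)‖ ≤ f' (x i k)) : ‖groupAvg w x f‖ ≤ groupAvg w x f' := by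
  simp only [groupAvg]
  rw [norm_smul, Real.norm_of_nonneg (by positivity), smul_eq_mul]
  gcongr
  refine (norm_sum_le _ _).trans (Finset.sum_le_sum fun i _ => ?_)
  rw [norm_smul, Real.norm_of_nonneg (hw i), smul_eq_mul]
  have := hw i
  gcongr
  exact (norm_sum_le _ _).trans (Finset.sum_le_sum fun k _ => h i k)

lemma isRelWeight_one : IsRelWeight (1 : Fin n → ℝ) := ⟨fun _ => one_pos, by simp⟩

lemma groupAvg_sub_groupAvg_one (w : Fin n → ℝ) (x : Fin n → Fin m → D) (f : D → F) :
    groupAvg w x f - groupAvg 1 x f = groupAvg (fun i => w i - 1) x f := by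
  simp [groupAvg, sub_smul, Finset.sum_sub_distrib, smul_sub]

/-- The weighted average depends on bounded weights through their distance from the uniform
weights, up to the truncated tails of the function. -/
lemma abs_groupAvg_sub_le {w : Fin n → ℝ} {B : ℝ} (hB : ∀ i, |w i - 1| ≤ B)
    (hB2 : ∑ i, (w i - 1) ^ 2 ≤ B) (hn : 0 < n) (hm : 0 < m) (x : Fin n → Fin m → D) (f : D → ℝ)
    {M : ℝ} (hM : 0 ≤ M) :
    |groupAvg w x f - groupAvg 1 x f| ≤
      M * (√(n * B) / n) + B * groupAvg 1 x (fun y => max (|f y| - M) 0) := by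
  rw [groupAvg_sub_groupAvg_one]
  have h1 : |groupAvg (fun i => w i - 1) x f| ≤
      groupAvg (fun i => |w i - 1|) x (fun y => |f y|) := by
    simp only [groupAvg, smul_eq_mul]
    rw [abs_mul, abs_of_nonneg (by positivity : 0 ≤ ((n : ℝ) * m)⁻¹)]
    gcongr
    refine (Finset.abs_sum_le_sum_abs _ _).trans (Finset.sum_le_sum fun i _ => ?_)
    rw [abs_mul]
    gcongr
    exact Finset.abs_sum_le_sum_abs _ _
  -- Split `|f|` at the level `M`: the bounded part is paid for by `∑ |w i - 1| ≤ √(n B)`, the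
  -- excess by the uniform bound `|w i - 1| ≤ B`.
  have h2 : groupAvg (fun i => |w i - 1|) x (fun y => |f y|) ≤
      groupAvg (fun i => |w i - 1|) x (fun y => M + max (|f y| - M) 0) :=
    groupAvg_mono (fun i => abs_nonneg _) fun i k => by
      linarith [le_max_left (|f (x i k)| - M) 0]
  rw [groupAvg_add] at h2
  have h3 : groupAvg (fun i => |w i - 1|) x (fun _ => M) ≤ M * (√(n * B) / n) := by
    simp only [groupAvg, Finset.sum_const, Finset.card_univ, Fintype.card_fin, nsmul_eq_mul,
      smul_eq_mul, ← Finset.sum_mul]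
    have e : ((n : ℝ) * m)⁻¹ * ((∑ i, |w i - 1|) * (m * M)) = M * ((∑ i, |w i - 1|) / n) := by
      field_simp
    rw [e]
    gcongr
    exact sum_abs_le_sqrt_mul hB2
  have h4 : groupAvg (fun i => |w i - 1|) x (fun y => max (|f y| - M) 0) ≤
      B * groupAvg 1 x (fun y => max (|f y| - M) 0) := by
    simp only [groupAvg, smul_eq_mul, Pi.one_apply, one_mul]
    rw [mul_left_comm, Finset.mul_sum Finset.univ _ B]
    gcongr with i
    exact hB i
  linarith

end Average

/-! ### Regular arrays of grouped samples -/

/-- The second moment operator `n⁻¹ ∑ zᵢ zᵢ'`. -/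
def secondMoment {E : Type*} [NormedAddCommGroup E] [InnerProductSpace ℝ E] {n : ℕ}
    (z : Fin n → E) : E →L[ℝ] E :=
  (n : ℝ)⁻¹ • ∑ i, InnerProductSpace.rankOne ℝ (z i) (z i)

/-- The law of large numbers, for real functions, for an array of grouped samples along `l`. -/
structure EmpiricalLaw {α D : Type*} [MeasurableSpace D] (l : Filter α) (P : Measure D)
    (n m : α → ℕ) (x : ∀ a, Fin (n a) → Fin (m a) → D) : Prop where
  n_tendsto : Tendsto n l atTop
  m_pos : ∀ a, 0 < m a
  ae : ∀ q : D → Prop, (∀ᵐ y ∂P, q y) → ∀ᶠ a in l, ∀ i k, q (x a i k)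
  lln : ∀ f : D → ℝ, Integrable f P → Tendsto (fun a => groupAvg 1 (x a) f) l (𝓝 (∫ y, f y ∂P))

/-- The properties of the group sums of `ξ` which a grouped sample has with high probability. -/
structure RegularGroups {α D E : Type*} [MeasurableSpace D] [NormedAddCommGroup E]
    [InnerProductSpace ℝ E] (l : Filter α) (P : Measure D) (ξ : D → E)
    (n m : α → ℕ) (x : ∀ a, Fin (n a) → Fin (m a) → D) : Prop where
  second : Tendsto (fun a => secondMoment (groupSum (x a) ξ)) l
    (𝓝 (∫ y, InnerProductSpace.rankOne ℝ (ξ y) (ξ y) ∂P))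
  max_le : ∀ δ : ℝ, 0 < δ → ∀ᶠ a in l, ∀ i, ‖groupSum (x a) ξ i‖ ≤ δ * √(n a : ℝ)

section Array

variable {α β D : Type*} [MeasurableSpace D] {l : Filter α} {P : Measure D}
  {n m : α → ℕ} {x : ∀ a, Fin (n a) → Fin (m a) → D}

lemma EmpiricalLaw.comp (h : EmpiricalLaw l P n m x) {l' : Filter β} {φ : β → α}
    (hφ : Tendsto φ l' l) :
    EmpiricalLaw l' P (fun b => n (φ b)) (fun b => m (φ b)) (fun b => x (φ b)) where
  n_tendsto := h.n_tendsto.comp hφ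
  m_pos _ := h.m_pos _
  ae q hq := hφ.eventually (h.ae q hq)
  lln f hf := (h.lln f hf).comp hφ

lemma RegularGroups.comp {E : Type*} [NormedAddCommGroup E] [InnerProductSpace ℝ E] {ξ : D → E}
    (h : RegularGroups l P ξ n m x) {l' : Filter β} {φ : β → α}
    (hφ : Tendsto φ l' l) :
    RegularGroups l' P ξ (fun b => n (φ b)) (fun b => m (φ b)) (fun b => x (φ b)) where
  second := h.second.comp hφ
  max_le δ hδ := hφ.eventually (h.max_le δ hδ)

lemma EmpiricalLaw.tendsto_cast (h : EmpiricalLaw l P n m x) :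
    Tendsto (fun a => (n a : ℝ)) l atTop :=
  tendsto_natCast_atTop_atTop.comp h.n_tendsto

lemma EmpiricalLaw.tendsto_sqrt (h : EmpiricalLaw l P n m x) :
    Tendsto (fun a => √(n a : ℝ)) l atTop :=
  Real.tendsto_sqrt_atTop.comp h.tendsto_cast

lemma integral_trunc_tendsto {f : D → ℝ} (hf : Integrable f P) :
    Tendsto (fun M : ℕ => ∫ y, max (|f y| - M) 0 ∂P) atTop (𝓝 0) := by
  suffices h : Tendsto (fun M : ℕ => ∫ y, max (|f y| - M) 0 ∂P) atTop (𝓝 (∫ _, (0 : ℝ) ∂P)) by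
    simpa using h
  refine tendsto_integral_of_dominated_convergence (fun y => |f y|) (fun M => ?_) hf.abs
    (fun M => ?_) ?_
  · exact ((hf.abs.aestronglyMeasurable.sub aestronglyMeasurable_const).sup
      aestronglyMeasurable_const)
  · refine ae_of_all _ fun y => ?_
    rw [Real.norm_of_nonneg (le_max_right _ _)]
    exact max_le (by linarith [(Nat.cast_nonneg M : (0 : ℝ) ≤ M)]) (abs_nonneg _)
  · refine ae_of_all _ fun y => ?_
    refine tendsto_const_nhds.congr' ?_
    filter_upwards [eventually_ge_atTop ⌈|f y|⌉₊] with M hM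
    rw [max_eq_right]
    linarith [Nat.ceil_le.1 hM]

lemma integrable_trunc {f : D → ℝ} (hf : Integrable f P) {M : ℝ} (hM : 0 ≤ M) :
    Integrable (fun y => max (|f y| - M) 0) P := by
  refine hf.mono ((hf.abs.aestronglyMeasurable.sub aestronglyMeasurable_const).sup
      aestronglyMeasurable_const) (ae_of_all _ fun y => ?_)
  rw [Real.norm_of_nonneg (le_max_right _ _)]
  exact max_le (by simp [hM]) (norm_nonneg _)

/-- Bounded levels: `w a` are relative weights with `-2 ∑ log w ≤ t` along `l`. -/
def LevelLE (l : Filter α) (n : α → ℕ) (t : ℝ) (w : ∀ a, Fin (n a) → ℝ) : Prop :=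
  ∀ᶠ a in l, IsRelWeight (w a) ∧ negTwoLog (w a) ≤ t

lemma LevelLE.exists_bound {t : ℝ} {w : ∀ a, Fin (n a) → ℝ} (h : LevelLE l n t w) :
    ∃ B : ℝ, 0 < B ∧ ∀ᶠ a in l, IsRelWeight (w a) ∧ (∀ i, |w a i - 1| ≤ B) ∧
      ∑ i, (w a i - 1) ^ 2 ≤ B := by
  obtain ⟨B, hB, H⟩ := exists_bound_of_negTwoLog_le t
  refine ⟨B + 1, by positivity, h.mono fun a ha => ⟨ha.1, fun i => ?_, ?_⟩⟩
  · have h1 := (H _ _ ha.1 ha.2).1 i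
    have h2 := ha.1.1 i
    rw [abs_le]; constructor <;> linarith
  · linarith [(H _ _ ha.1 ha.2).2]

/-- In `abs_groupAvg_sub_le`, first fix `M` so that the expected excess over `M` is small, then let
`n` grow to remove `M √(n B) / n`. The weights enter only through `B`, so they may depend on the
data in any way. -/
lemma EmpiricalLaw.tendsto_groupAvg_real (h : EmpiricalLaw l P n m x) {t : ℝ}
    {w : ∀ a, Fin (n a) → ℝ} (hw : LevelLE l n t w) {f : D → ℝ} (hf : Integrable f P) :
    Tendsto (fun a => groupAvg (w a) (x a) f) l (𝓝 (∫ y, f y ∂P)) := by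
  obtain ⟨B, hB, hwB⟩ := hw.exists_bound
  have key : Tendsto (fun a => groupAvg (w a) (x a) f - groupAvg 1 (x a) f) l (𝓝 0) := by
    rw [Metric.tendsto_nhds]
    intro ε hε
    obtain ⟨M, hM⟩ := ((integral_trunc_tendsto hf).eventually
      (gt_mem_nhds (show (0 : ℝ) < ε / (2 * B) by positivity))).exists
    have h1 := h.lln _ (integrable_trunc hf (Nat.cast_nonneg M))
    have h2 : Tendsto (fun a => M * (√(n a * B) / n a)) l (𝓝 (M * 0)) := by
      refine Tendsto.const_mul _ ?_
      have e : ∀ a, √(n a * B) / n a = √B / √(n a : ℝ) := fun a => by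
        rw [Real.sqrt_mul (Nat.cast_nonneg _)]
        rcases Nat.eq_zero_or_pos (n a) with h0 | h0
        · simp [h0]
        · have : (0 : ℝ) < n a := Nat.cast_pos.2 h0
          have h2 : √(n a : ℝ) ≠ 0 := (Real.sqrt_pos.2 this).ne'
          rw [div_eq_div_iff this.ne' h2]
          rw [mul_right_comm, Real.mul_self_sqrt this.le, mul_comm]
      simp_rw [e]
      exact tendsto_const_nhds.div_atTop h.tendsto_sqrt
    have h3 := h2.add (h1.const_mul B)
    have h4 : M * 0 + B * ∫ y, max (|f y| - M) 0 ∂P < ε := by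
      have : B * ∫ y, max (|f y| - M) 0 ∂P < B * (ε / (2 * B)) := by gcongr
      have e : B * (ε / (2 * B)) = ε / 2 := by field_simp
      linarith
    filter_upwards [hwB, h3.eventually (gt_mem_nhds h4), h.n_tendsto.eventually_gt_atTop 0]
      with a ha h5 hna
    rw [dist_zero_right, Real.norm_eq_abs]
    exact (abs_groupAvg_sub_le ha.2.1 ha.2.2 hna (h.m_pos a) (x a) f
      (Nat.cast_nonneg M)).trans_lt h5
  simpa using key.add (h.lln f hf)

/-- The law of large numbers for averages with relative weights of bounded level. -/
lemma EmpiricalLaw.tendsto_groupAvg (h : EmpiricalLaw l P n m x) {F : Type*}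
    [NormedAddCommGroup F] [NormedSpace ℝ F] [FiniteDimensional ℝ F] {t : ℝ}
    {w : ∀ a, Fin (n a) → ℝ} (hw : LevelLE l n t w) {f : D → F} (hf : Integrable f P) :
    Tendsto (fun a => groupAvg (w a) (x a) f) l (𝓝 (∫ y, f y ∂P)) := by
  have : CompleteSpace F := FiniteDimensional.complete ℝ F
  let e : F ≃L[ℝ] (Fin (Module.finrank ℝ F) → ℝ) :=
    ContinuousLinearEquiv.ofFinrankEq (by simp)
  have h1 : Tendsto (fun a => e (groupAvg (w a) (x a) f)) l (𝓝 (e (∫ y, f y ∂P))) := by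
    rw [tendsto_pi_nhds]
    intro j
    let L : F →L[ℝ] ℝ := (ContinuousLinearMap.proj (R := ℝ) (φ := fun _ => ℝ) j).comp
      (e : F →L[ℝ] (Fin (Module.finrank ℝ F) → ℝ))
    have h2 := h.tendsto_groupAvg_real hw (L.integrable_comp hf)
    rw [L.integral_comp_comm hf] at h2
    simp_rw [groupAvg_clm] at h2
    exact h2
  simpa [Function.comp_def] using (e.symm.continuous.tendsto _).comp h1

lemma levelLE_one (l : Filter α) (n : α → ℕ) : LevelLE l n 0 (fun _ => 1) :=
  Eventually.of_forall fun a => ⟨isRelWeight_one, by simp [negTwoLog]⟩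

/-- The group averages of an integrable function are of a smaller order than the number of
groups, uniformly over the groups. -/
lemma EmpiricalLaw.groupMean_le (h : EmpiricalLaw l P n m x) {f : D → ℝ} (hf : Integrable f P)
    {δ : ℝ} (hδ : 0 < δ) :
    ∀ᶠ a in l, ∀ i, (m a : ℝ)⁻¹ * ∑ k, |f (x a i k)| ≤ δ * n a := by
  -- The excess over `M` within one group is at most `n` times its average over all groups, hence at
  -- most `δ n / 2`; the part below `M` is at most `δ n / 2` once `n` is large.
  obtain ⟨M, hM⟩ := ((integral_trunc_tendsto hf).eventually
      (gt_mem_nhds (show (0 : ℝ) < δ / 2 by positivity))).exists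
  have h1 := h.lln _ (integrable_trunc hf (Nat.cast_nonneg M))
  have h2 := h.tendsto_cast.eventually_ge_atTop (2 * M / δ)
  filter_upwards [h1.eventually (gt_mem_nhds hM), h2, h.n_tendsto.eventually_gt_atTop 0]
    with a h1 h2 hn i
  have hm : (0 : ℝ) < m a := Nat.cast_pos.2 (h.m_pos a)
  have hn' : (0 : ℝ) < n a := Nat.cast_pos.2 hn
  have h3 : (m a : ℝ)⁻¹ * ∑ k, max (|f (x a i k)| - M) 0 ≤
      n a * groupAvg 1 (x a) (fun y => max (|f y| - M) 0) := by
    simp only [groupAvg, Pi.one_apply, smul_eq_mul, one_mul]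
    rw [← mul_assoc, mul_inv, mul_inv_cancel_left₀ hn'.ne']
    gcongr
    exact Finset.single_le_sum (f := fun i => ∑ k, max (|f (x a i k)| - M) 0)
      (fun i _ => Finset.sum_nonneg fun k _ => le_max_right _ _) (Finset.mem_univ i)
  have h4 : (m a : ℝ)⁻¹ * ∑ k, |f (x a i k)| ≤
      (m a : ℝ)⁻¹ * ∑ k : Fin (m a), ((M : ℝ) + max (|f (x a i k)| - M) 0) := by
    gcongr with k
    linarith [le_max_left (|f (x a i k)| - M) 0]
  rw [Finset.sum_add_distrib, mul_add] at h4
  simp only [Finset.sum_const, Finset.card_univ, Fintype.card_fin, nsmul_eq_mul] at h4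
  rw [inv_mul_cancel_left₀ hm.ne'] at h4
  rw [div_le_iff₀ hδ] at h2
  nlinarith

end Array

/-! ### Quadratic approximation of the empirical log-likelihood ratio -/

section Quadratic

open scoped RealInnerProductSpace

variable {E : Type*} [NormedAddCommGroup E] [InnerProductSpace ℝ E]

/-- The Taylor remainder is at most `|b|³ / (1 - |b|)`, and the denominator is at least `1 / 2`. -/
lemma abs_log_one_sub_add_le {b δ : ℝ} (hb : |b| ≤ δ) (hδ : δ ≤ 1 / 2) :
    |Real.log (1 - b) + b + b ^ 2 / 2| ≤ 2 * δ * b ^ 2 := by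
  have h := Real.abs_log_sub_add_sum_range_le (x := b) (by linarith) 2
  simp only [Finset.sum_range_succ, Finset.sum_range_zero] at h
  norm_num at h
  have e : Real.log (1 - b) + b + b ^ 2 / 2 = b + b ^ 2 / 2 + Real.log (1 - b) := by ring
  rw [e]
  refine h.trans ?_
  rw [div_le_iff₀ (by linarith)]
  have h1 : |b| ^ 3 ≤ δ * b ^ 2 := by
    rw [pow_succ, sq_abs, mul_comm]
    exact mul_le_mul_of_nonneg_right hb (sq_nonneg _)
  have h0 : 0 ≤ δ * b ^ 2 := mul_nonneg ((abs_nonneg b).trans hb) (sq_nonneg _)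
  nlinarith

lemma inner_secondMoment_self {n : ℕ} (z : Fin n → E) (v : E) :
    ⟪secondMoment z v, v⟫ = (n : ℝ)⁻¹ * ∑ i, ⟪v, z i⟫ ^ 2 := by
  simp only [secondMoment, smul_apply, sum_apply,
    InnerProductSpace.rankOne_apply, inner_smul_left, sum_inner, RCLike.conj_to_real]
  congr 1
  refine Finset.sum_congr rfl fun i _ => ?_
  rw [real_inner_comm]
  ring

/-- Lower bound for the log-likelihood ratio by weak duality. -/
lemma IsRelWeight.le_negTwoLog {n : ℕ} {w : Fin n → ℝ} (hw : IsRelWeight w) {a : Fin n → ℝ}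
    {δ : ℝ} (ha : ∀ i, |a i| ≤ δ) (hδ : δ ≤ 1 / 4) (hwa : ∑ i, w i * a i = 0) :
    2 * ∑ i, a i - (1 + 4 * δ) * ∑ i, a i ^ 2 ≤ negTwoLog w := by
  -- Apply `log y ≤ y - 1` to `y = w i (1 + a i)` and expand `log (1 + a i)` to second order. After
  -- summation the two constraints annihilate `w i * a i` and `w i - 1`, so the bound no longer
  -- involves the weights.
  have h1 : ∀ i, Real.log (w i) ≤ w i * a i + (w i - 1) - a i + (1 + 4 * δ) / 2 * a i ^ 2 := by
    intro i
    have h2 := abs_log_one_sub_add_le (b := -a i) (δ := δ) (by rw [abs_neg]; exact ha i)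
      (by linarith)
    rw [abs_le] at h2
    have h3 : 0 < 1 + a i := by linarith [(abs_le.1 (ha i)).1]
    have h4 := Real.log_le_sub_one_of_pos (mul_pos (hw.1 i) h3)
    rw [Real.log_mul (hw.1 i).ne' h3.ne'] at h4
    have h5 : Real.log (1 - -a i) = Real.log (1 + a i) := by ring_nf
    rw [h5] at h2
    nlinarith [h2.1]
  have h6 := Finset.sum_le_sum fun i (_ : i ∈ Finset.univ) => h1 i
  simp only [Finset.sum_add_distrib, Finset.sum_sub_distrib, ← Finset.mul_sum, hwa, hw.2] at h6
  simp at h6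
  simp only [negTwoLog]
  nlinarith

lemma negTwoLog_le {n : ℕ} {b : Fin n → ℝ} {δ : ℝ} (hb : ∀ i, |b i| ≤ δ) (hδ : δ ≤ 1 / 4) :
    negTwoLog (fun i => 1 - b i) ≤ 2 * ∑ i, b i + (1 + 4 * δ) * ∑ i, b i ^ 2 := by
  have h1 : ∀ i, - Real.log (1 - b i) ≤ b i + (1 + 4 * δ) / 2 * b i ^ 2 := fun i => by
    have h2 := abs_log_one_sub_add_le (hb i) (by linarith)
    rw [abs_le] at h2
    nlinarith [h2.1]
  have h6 := Finset.sum_le_sum fun i (_ : i ∈ Finset.univ) => h1 i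
  simp only [Finset.sum_add_distrib, ← Finset.mul_sum, Finset.sum_neg_distrib] at h6
  simp only [negTwoLog]
  nlinarith

variable {α : Type*} {l : Filter α} {n : α → ℕ} {z : ∀ a, Fin (n a) → E} {V : E →L[ℝ] E}

/-- Asymptotic quadratic lower bound for the log-likelihood ratio of weights satisfying
`∑ wᵢ zᵢ = 0`. -/
lemma eventually_le_negTwoLog (hn : Tendsto n l atTop)
    (hV : Tendsto (fun a => secondMoment (z a)) l (𝓝 V))
    (hmax : ∀ δ : ℝ, 0 < δ → ∀ᶠ a in l, ∀ i, ‖z a i‖ ≤ δ * √(n a : ℝ))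
    {κ : α → E} {R : ℝ} (hκ : ∀ᶠ a in l, ‖κ a‖ ≤ R)
    {w : ∀ a, Fin (n a) → ℝ} (hw : ∀ᶠ a in l, IsRelWeight (w a))
    (hwz : ∀ᶠ a in l, ∑ i, w a i • z a i = 0) {ε : ℝ} (hε : 0 < ε) :
    ∀ᶠ a in l, 2 * ⟪κ a, (√(n a : ℝ))⁻¹ • ∑ i, z a i⟫ - ⟪V (κ a), κ a⟫ - ε ≤
      negTwoLog (w a) := by
  set R' : ℝ := |R| + 1 with hR'
  have hR'0 : 0 < R' := by positivity
  -- `C` eventually bounds the empirical quadratic form at `κ`; `δ` is then chosen so that the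
  -- excess factor `4 δ` costs at most `ε / 2`.
  set C : ℝ := (‖V‖ + 1) * R' ^ 2 with hC
  have hC0 : 0 < C := by positivity
  set δ : ℝ := min (1 / 4) (ε / (8 * C)) with hδ
  have hδ0 : 0 < δ := by positivity
  have hδC : 4 * δ * C ≤ ε / 2 := by
    have : δ ≤ ε / (8 * C) := min_le_right _ _
    rw [le_div_iff₀ (by positivity)] at this
    linarith
  have hη : 0 < min 1 (ε / (2 * R' ^ 2)) := by positivity
  filter_upwards [hκ, hw, hwz, hmax (δ / R') (by positivity),
    (tendsto_iff_norm_sub_tendsto_zero.1 hV).eventually (gt_mem_nhds hη),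
    hn.eventually_gt_atTop 0] with a hκ hw hwz hmax hV hn
  have hn' : (0 : ℝ) < n a := Nat.cast_pos.2 hn
  have hs : 0 < √(n a : ℝ) := Real.sqrt_pos.2 hn'
  have hκ' : ‖κ a‖ ≤ R' := hκ.trans (by rw [hR']; linarith [le_abs_self R])
  have hκ2 : ‖κ a‖ ^ 2 ≤ R' ^ 2 := pow_le_pow_left₀ (norm_nonneg _) hκ' 2
  -- The dual variables are `n^{-1/2} ⟪κ, z i⟫`; they are uniformly small because `max ‖z i‖ =
  -- o(√n)`.
  have h1 := hw.le_negTwoLog (a := fun i => (√(n a : ℝ))⁻¹ * ⟪κ a, z a i⟫) (δ := δ)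
    (fun i => by
      rw [abs_mul, abs_of_pos (inv_pos.2 hs)]
      have : |⟪κ a, z a i⟫| ≤ R' * (δ / R' * √(n a : ℝ)) :=
        (abs_real_inner_le_norm _ _).trans (mul_le_mul hκ' (hmax i) (norm_nonneg _) hR'0.le)
      calc _ ≤ (√(n a : ℝ))⁻¹ * (R' * (δ / R' * √(n a : ℝ))) := by gcongr
        _ = δ := by field_simp) (min_le_left _ _)
    (by
      have : ∑ i, w a i * ((√(n a : ℝ))⁻¹ * ⟪κ a, z a i⟫) =
          (√(n a : ℝ))⁻¹ * ⟪κ a, ∑ i, w a i • z a i⟫ := by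
        rw [inner_sum, Finset.mul_sum]
        refine Finset.sum_congr rfl fun i _ => ?_
        rw [inner_smul_right]; ring
      rw [this, hwz, inner_zero_right, mul_zero])
  have e1 : ∑ i, (√(n a : ℝ))⁻¹ * ⟪κ a, z a i⟫ = ⟪κ a, (√(n a : ℝ))⁻¹ • ∑ i, z a i⟫ := by
    rw [inner_smul_right, inner_sum, Finset.mul_sum]
  have e2 : ∑ i, ((√(n a : ℝ))⁻¹ * ⟪κ a, z a i⟫) ^ 2 = ⟪secondMoment (z a) (κ a), κ a⟫ := by
    rw [inner_secondMoment_self, Finset.mul_sum]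
    refine Finset.sum_congr rfl fun i _ => ?_
    rw [mul_pow, inv_pow, Real.sq_sqrt hn'.le]
  rw [e1, e2] at h1
  have h2 : ⟪secondMoment (z a) (κ a), κ a⟫ - ⟪V (κ a), κ a⟫ ≤
      ‖secondMoment (z a) - V‖ * ‖κ a‖ ^ 2 := by
    rw [← inner_sub_left, ← sub_apply, sq, ← mul_assoc]
    exact (real_inner_le_norm _ _).trans
      (mul_le_mul_of_nonneg_right (ContinuousLinearMap.le_opNorm _ _) (norm_nonneg _))
  have h3 : ⟪V (κ a), κ a⟫ ≤ ‖V‖ * ‖κ a‖ ^ 2 := by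
    rw [sq, ← mul_assoc]
    exact (real_inner_le_norm _ _).trans
      (mul_le_mul_of_nonneg_right (ContinuousLinearMap.le_opNorm _ _) (norm_nonneg _))
  have h4 : ‖secondMoment (z a) - V‖ * ‖κ a‖ ^ 2 ≤ ε / 2 := by
    calc _ ≤ ε / (2 * R' ^ 2) * R' ^ 2 := by
          gcongr
          exact hV.le.trans (min_le_right _ _)
      _ = ε / 2 := by field_simp
  have h5 : ⟪secondMoment (z a) (κ a), κ a⟫ ≤ C := by
    have : ‖secondMoment (z a) - V‖ * ‖κ a‖ ^ 2 ≤ 1 * R' ^ 2 := by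
      gcongr
      exact hV.le.trans (min_le_left _ _)
    have h6 : ‖V‖ * ‖κ a‖ ^ 2 ≤ ‖V‖ * R' ^ 2 := by gcongr
    rw [hC]; linarith
  have h6 : 4 * δ * ⟪secondMoment (z a) (κ a), κ a⟫ ≤ ε / 2 :=
    (mul_le_mul_of_nonneg_left h5 (by positivity)).trans hδC
  linarith

lemma sum_inner_sub_mean {N : ℕ} (y : Fin N → E) (hN : 0 < N) (v : E) :
    ∑ i, ⟪v, y i - (N : ℝ)⁻¹ • ∑ j, y j⟫ = 0 := by
  rw [← inner_sum, Finset.sum_sub_distrib]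
  have hN' : (N : ℝ) ≠ 0 := Nat.cast_ne_zero.2 hN.ne'
  simp only [Finset.sum_const, Finset.card_univ, Fintype.card_fin, ← Nat.cast_smul_eq_nsmul ℝ,
    smul_smul]
  rw [mul_inv_cancel₀ hN', one_smul, sub_self, inner_zero_right]

/-- The centred second moment operator. -/
lemma sum_inner_sub_mean_smul {N : ℕ} (y : Fin N → E) (hN : 0 < N) (v : E) :
    ∑ i, ⟪v, y i - (N : ℝ)⁻¹ • ∑ j, y j⟫ • y i =
      (N : ℝ) • (secondMoment y - InnerProductSpace.rankOne ℝ ((N : ℝ)⁻¹ • ∑ j, y j)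
        ((N : ℝ)⁻¹ • ∑ j, y j)) v := by
  have hN' : (N : ℝ) ≠ 0 := Nat.cast_ne_zero.2 hN.ne'
  simp only [inner_sub_right, sub_smul, Finset.sum_sub_distrib, ← Finset.smul_sum,
    sub_apply, secondMoment, smul_apply,
    sum_apply, InnerProductSpace.rankOne_apply, smul_sub, smul_smul,
    mul_inv_cancel₀ hN', one_smul]
  congr 1
  · exact Finset.sum_congr rfl fun i _ => by rw [real_inner_comm]
  · rw [real_inner_comm]; congr 1; field_simp

/-- Asymptotic quadratic upper bound for the least log-likelihood ratio of weights satisfying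
`∑ wᵢ zᵢ = 0`. -/
lemma eventually_exists_negTwoLog_le [FiniteDimensional ℝ E] (hn : Tendsto n l atTop)
    (hV : Tendsto (fun a => secondMoment (z a)) l (𝓝 V)) (hVinj : Function.Injective V)
    (hmax : ∀ δ : ℝ, 0 < δ → ∀ᶠ a in l, ∀ i, ‖z a i‖ ≤ δ * √(n a : ℝ))
    {κ : α → E} {R : ℝ} (hκ : ∀ᶠ a in l, ‖κ a‖ ≤ R)
    (hs : Tendsto (fun a => (√(n a : ℝ))⁻¹ • ∑ i, z a i - V (κ a)) l (𝓝 0))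
    {ε : ℝ} (hε : 0 < ε) :
    ∀ᶠ a in l, ∃ w : Fin (n a) → ℝ, IsRelWeight w ∧ ∑ i, w i • z a i = 0 ∧
      negTwoLog w ≤ ⟪V (κ a), κ a⟫ + ε := by
  have : CompleteSpace E := FiniteDimensional.complete ℝ E
  let e : E ≃L[ℝ] E := (LinearEquiv.ofInjectiveEndo (V : E →ₗ[ℝ] E) hVinj).toContinuousLinearEquiv
  have he : (e : E →L[ℝ] E) = V := by ext v; rfl
  set s : α → E := fun a => (√(n a : ℝ))⁻¹ • ∑ i, z a i with hs_def
  set zb : α → E := fun a => (n a : ℝ)⁻¹ • ∑ i, z a i with hzb_def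
  have hzbs : ∀ a, zb a = (√(n a : ℝ))⁻¹ • s a := fun a => by
    simp only [hzb_def, hs_def, smul_smul]
    rw [← mul_inv, Real.mul_self_sqrt (Nat.cast_nonneg _)]
  have hκO : κ =O[l] (fun _ => (1 : ℝ)) := Asymptotics.IsBigO.of_bound R (hκ.mono fun a h => by
    simpa using h)
  have hVκO : (fun a => V (κ a)) =O[l] (fun _ => (1 : ℝ)) :=
    (V.isBigO_comp κ l).trans hκO
  have hsO : s =O[l] (fun _ => (1 : ℝ)) := by
    have := ((Asymptotics.isLittleO_one_iff ℝ).2 hs).isBigO.add hVκO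
    simpa using this
  have hsqrt : Tendsto (fun a => (√(n a : ℝ))⁻¹) l (𝓝 0) :=
    tendsto_inv_atTop_zero.comp (Real.tendsto_sqrt_atTop.comp
      (tendsto_natCast_atTop_atTop.comp hn))
  have hzb0 : Tendsto zb l (𝓝 0) := by
    rw [← Asymptotics.isLittleO_one_iff ℝ]
    have := ((Asymptotics.isLittleO_one_iff ℝ).2 hsqrt).smul_isBigO hsO
    simp only [smul_eq_mul, mul_one] at this
    exact this.congr_left fun a => (hzbs a).symm
  -- The empirical covariance. The mean is of order `n^{-1/2}`, so `U` has the same limit `V` as the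
  -- second moment and is eventually invertible.
  set U : α → E →L[ℝ] E := fun a =>
    secondMoment (z a) - InnerProductSpace.rankOne ℝ (zb a) (zb a) with hU_def
  have hU : Tendsto U l (𝓝 (e : E →L[ℝ] E)) := by
    rw [he]
    have : Tendsto (fun a => InnerProductSpace.rankOne ℝ (zb a) (zb a)) l (𝓝 0) := by
      rw [tendsto_zero_iff_norm_tendsto_zero]
      simp only [InnerProductSpace.norm_rankOne]
      simpa using hzb0.norm.mul hzb0.norm
    simpa using hV.sub this
  have hUinv : Tendsto (fun a => (U a).inverse) l (𝓝 (e.symm : E →L[ℝ] E)) := by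
    have h1 := (contDiffAt_map_inverse (𝕜 := ℝ) (n := 1) e).continuousAt
    have h2 := h1.tendsto.comp hU
    simpa [Function.comp_def] using h2
  -- `κ` solves only the limiting equation `V κ ≈ s`. Solving `U κ' = s` exactly makes the
  -- constraint hold exactly in the sample, and `κ' - κ` tends to zero.
  set κ' : α → E := fun a => (U a).inverse (s a) with hκ'_def
  have hUκ' : ∀ᶠ a in l, U a (κ' a) = s a := by
    filter_upwards [hU.eventually (ContinuousLinearEquiv.nhds e)] with a ha
    obtain ⟨e', he'⟩ := ha
    simp only [hκ'_def, ← he']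
    simp
  have hκ'κ : Tendsto (fun a => κ' a - κ a) l (𝓝 0) := by
    have h1 : Tendsto (fun a => (U a).inverse (s a - V (κ a))) l (𝓝 ((e.symm : E →L[ℝ] E) 0)) :=
      (isBoundedBilinearMap_apply.continuous.tendsto ((e.symm : E →L[ℝ] E), (0 : E))).comp
        (hUinv.prodMk_nhds hs)
    have h2 : Tendsto (fun a => ((U a).inverse - (e.symm : E →L[ℝ] E)) (V (κ a))) l (𝓝 0) := by
      have h3 : Tendsto (fun a => (U a).inverse - (e.symm : E →L[ℝ] E)) l (𝓝 0) := by
        simpa using hUinv.sub_const (e.symm : E →L[ℝ] E)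
      rw [← Asymptotics.isLittleO_one_iff ℝ] at h3 ⊢
      refine (Asymptotics.IsBigO.of_bound 1 (Eventually.of_forall fun a => ?_)).trans_isLittleO
        (h3.norm_left.mul_isBigO hVκO.norm_left |>.trans_isBigO (by
          exact Asymptotics.isBigO_const_const _ one_ne_zero _))
      simp only [norm_mul, norm_norm, one_mul]
      exact ContinuousLinearMap.le_opNorm _ _
    have h4 := h1.add h2
    simp only [map_zero, add_zero] at h4
    refine h4.congr fun a => ?_
    have h5 : (e.symm : E →L[ℝ] E) (V (κ a)) = κ a := by
      rw [← he]; exact e.symm_apply_apply _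
    simp only [sub_apply, map_sub, h5]
    simp [hκ'_def]
  have hκ'O : κ' =O[l] (fun _ => (1 : ℝ)) := by
    have := ((Asymptotics.isLittleO_one_iff ℝ).2 hκ'κ).isBigO.add hκO
    simpa using this
  obtain ⟨R', hR'0, hR'⟩ := hκ'O.exists_pos
  have hval : Tendsto (fun a => ⟪s a, κ' a⟫ - ⟪V (κ a), κ a⟫) l (𝓝 0) := by
    have h1 : Tendsto (fun a => ⟪s a - V (κ a), κ' a⟫) l (𝓝 0) := by
      rw [← Asymptotics.isLittleO_one_iff ℝ] at hs ⊢
      refine (Asymptotics.IsBigO.of_bound 1 (Eventually.of_forall fun a => ?_)).trans_isLittleO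
        (hs.norm_left.mul_isBigO hκ'O.norm_left |>.trans_isBigO (by
          exact Asymptotics.isBigO_const_const _ one_ne_zero _))
      simp only [norm_mul, norm_norm, one_mul]
      exact norm_inner_le_norm _ _
    have h2 : Tendsto (fun a => ⟪V (κ a), κ' a - κ a⟫) l (𝓝 0) := by
      rw [← Asymptotics.isLittleO_one_iff ℝ] at hκ'κ ⊢
      refine (Asymptotics.IsBigO.of_bound 1 (Eventually.of_forall fun a => ?_)).trans_isLittleO
        (hVκO.norm_left.mul_isLittleO hκ'κ.norm_left |>.trans_isBigO (by
          exact Asymptotics.isBigO_const_const _ one_ne_zero _))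
      simp only [norm_mul, norm_norm, one_mul]
      exact norm_inner_le_norm _ _
    have h3 := h1.add h2
    rw [add_zero] at h3
    refine h3.congr fun a => ?_
    simp only [inner_sub_left, inner_sub_right]
    ring
  obtain ⟨C, hC0, hC⟩ := (hsO.norm_left.mul hκ'O.norm_left).exists_pos
  have hC := hC.bound
  simp only [norm_mul, norm_norm, norm_one, mul_one] at hC
  set δ : ℝ := min (1 / 4) (ε / (8 * C)) with hδ
  have hδ0 : 0 < δ := by positivity
  have hδC : 4 * δ * C ≤ ε / 2 := by
    have : δ ≤ ε / (8 * C) := min_le_right _ _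
    rw [le_div_iff₀ (by positivity)] at this
    linarith
  have hη : 0 < δ / (2 * R') := by positivity
  filter_upwards [hUκ', hR'.bound, hC, hmax (δ / (2 * R')) hη, hn.eventually_gt_atTop 0,
    hval.eventually (gt_mem_nhds (show (0 : ℝ) < ε / 2 by positivity)),
    hzb0.norm.eventually (gt_mem_nhds (by simpa using hη))] with a hUκ hR' hC hmax hn hval hzb
  simp only [norm_one, mul_one] at hR'
  have hn' : (0 : ℝ) < n a := Nat.cast_pos.2 hn
  have hsq : 0 < √(n a : ℝ) := Real.sqrt_pos.2 hn'
  have hsq1 : 1 ≤ √(n a : ℝ) := Real.one_le_sqrt.2 (by exact_mod_cast hn)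
  -- The weights will be `1 - b i`. Centring gives `∑ b i = 0`, and `U κ' = s` gives `∑ b i • z i =
  -- ∑ z i`, which is the required equation.
  set b : Fin (n a) → ℝ := fun i => (√(n a : ℝ))⁻¹ * ⟪κ' a, z a i - zb a⟫ with hb_def
  have hb : ∀ i, |b i| ≤ δ := fun i => by
    simp only [hb_def]
    rw [abs_mul, abs_of_pos (inv_pos.2 hsq)]
    have h1 : ‖z a i - zb a‖ ≤ δ / (2 * R') * √(n a : ℝ) + δ / (2 * R') * √(n a : ℝ) := by
      refine (norm_sub_le _ _).trans (add_le_add (hmax i) (hzb.le.trans ?_))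
      exact le_mul_of_one_le_right hη.le hsq1
    calc _ ≤ (√(n a : ℝ))⁻¹ * (R' * (δ / (2 * R') * √(n a : ℝ) + δ / (2 * R') * √(n a : ℝ))) := by
          gcongr
          exact (abs_real_inner_le_norm _ _).trans (by gcongr)
      _ = δ := by field_simp; ring
  have hb0 : ∑ i, b i = 0 := by
    simp only [hb_def, ← Finset.mul_sum]
    rw [sum_inner_sub_mean _ hn, mul_zero]
  have hbz : ∑ i, b i • z a i = √(n a : ℝ) • s a := by
    simp only [hb_def, mul_smul, ← Finset.smul_sum]
    rw [sum_inner_sub_mean_smul _ hn]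
    change _ • _ • U a (κ' a) = _
    rw [hUκ, smul_smul]
    congr 1
    rw [inv_mul_eq_div, Real.div_sqrt]
  -- One factor `b i` is expanded by its definition; the centring term then drops out because `∑ b i
  -- = 0`.
  have hb2 : ∑ i, b i ^ 2 = ⟪s a, κ' a⟫ := by
    have h1 : ∑ i, b i ^ 2 = (√(n a : ℝ))⁻¹ * ⟪κ' a, ∑ i, b i • z a i - (∑ i, b i) • zb a⟫ := by
      rw [Finset.sum_smul, ← Finset.sum_sub_distrib, inner_sum, Finset.mul_sum]
      refine Finset.sum_congr rfl fun i _ => ?_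
      rw [← smul_sub, inner_smul_right]
      simp only [hb_def]; ring
    rw [h1, hb0, hbz, zero_smul, sub_zero, inner_smul_right, inv_mul_cancel_left₀ hsq.ne',
      real_inner_comm]
  refine ⟨fun i => 1 - b i, ⟨fun i => ?_, ?_⟩, ?_, ?_⟩
  · linarith [(abs_le.1 (hb i)).2, min_le_left (1 / 4) (ε / (8 * C))]
  · simp [Finset.sum_sub_distrib, hb0]
  · simp only [sub_smul, one_smul, Finset.sum_sub_distrib, hbz, hs_def]
    rw [smul_smul, mul_inv_cancel₀ hsq.ne', one_smul, sub_self]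
  · refine (negTwoLog_le hb (min_le_left _ _)).trans ?_
    rw [hb0, hb2]
    have h1 : ⟪s a, κ' a⟫ ≤ C := (real_inner_le_norm _ _).trans hC
    have h2 : 4 * δ * ⟪s a, κ' a⟫ ≤ ε / 2 :=
      (mul_le_mul_of_nonneg_left h1 (by positivity)).trans hδC
    linarith

end Quadratic

/-! ### Local linear approximation of the weighted estimating equations -/

section Smooth

open scoped RealInnerProductSpace

variable {E F : Type*} [NormedAddCommGroup E] [NormedSpace ℝ E] [NormedAddCommGroup F]
  [NormedSpace ℝ F]

lemma norm_image_sub_le_of_fderiv_le {f : E → F} {U K : Set E} {H : ℝ} (hU : IsOpen U)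
    (hf : ContDiffOn ℝ 2 f U) (hH : ∀ θ ∈ U, ‖fderiv ℝ f θ‖ ≤ H) (hK : Convex ℝ K) (hKU : K ⊆ U)
    {θ θ' : E} (hθ : θ ∈ K) (hθ' : θ' ∈ K) : ‖f θ - f θ'‖ ≤ H * ‖θ - θ'‖ :=
  hK.norm_image_sub_le_of_norm_fderiv_le
    (fun _ hy => (hf.differentiableOn two_ne_zero).differentiableAt (hU.mem_nhds (hKU hy)))
    (fun _ hy => hH _ (hKU hy)) hθ' hθ

/-- The second derivative bound keeps `fderiv ℝ f` within `H δ` of its value at the centre, and the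
mean value inequality is applied to `f` minus that linear map. -/
lemma norm_image_sub_sub_fderiv_le {f : E → F} {U : Set E} {H δ : ℝ} (hU : IsOpen U)
    (hf : ContDiffOn ℝ 2 f U) (hH : ∀ θ ∈ U, ‖fderiv ℝ (fderiv ℝ f) θ‖ ≤ H) {θ₀ θ θ' : E}
    (hδU : Metric.closedBall θ₀ δ ⊆ U) (hθ : θ ∈ Metric.closedBall θ₀ δ)
    (hθ' : θ' ∈ Metric.closedBall θ₀ δ) :
    ‖f θ - f θ' - fderiv ℝ f θ₀ (θ - θ')‖ ≤ H * δ * ‖θ - θ'‖ := by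
  have hδ : 0 ≤ δ := dist_nonneg.trans (Metric.mem_closedBall.1 hθ)
  have h0 : θ₀ ∈ Metric.closedBall θ₀ δ := Metric.mem_closedBall_self hδ
  have hH0 : 0 ≤ H := (norm_nonneg (fderiv ℝ (fderiv ℝ f) θ₀)).trans (hH θ₀ (hδU h0))
  have hd : ∀ y ∈ U, DifferentiableAt ℝ f y := fun y hy =>
    (hf.differentiableOn two_ne_zero).differentiableAt (hU.mem_nhds hy)
  have hd2 : ∀ y ∈ U, DifferentiableAt ℝ (fderiv ℝ f) y := fun y hy =>
    ((hf.fderiv_of_isOpen hU (m := 1) (by norm_num)).differentiableOn one_ne_zero).differentiableAt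
      (hU.mem_nhds hy)
  refine (convex_closedBall θ₀ δ).norm_image_sub_le_of_norm_hasFDerivWithin_le'
    (f' := fderiv ℝ f)
    (fun y hy => (hd y (hδU hy)).hasFDerivAt.hasFDerivWithinAt) (fun y hy => ?_) hθ' hθ
  have := (convex_closedBall θ₀ δ).norm_image_sub_le_of_norm_fderiv_le (f := fderiv ℝ f)
    (fun y hy => hd2 y (hδU hy)) (fun y hy => hH y (hδU hy)) h0 hy
  refine this.trans (mul_le_mul_of_nonneg_left ?_ hH0)
  rw [← dist_eq_norm]; exact hy

end Smooth

/-! ### Consistency and rate of the solutions of weighted estimating equations. -/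

section Estimation

open scoped RealInnerProductSpace

variable {α : Type*} {d p : ℕ} {l : Filter α} {P : Measure (Vec d)} {g : Vec d → Vec p → Vec p}
  {U : Set (Vec p)} {θ₀ : Vec p}
  {n m : α → ℕ} {x : ∀ a, Fin (n a) → Fin (m a) → Vec d}

/-- `√N` times the average of `g(x, θ)` over the grouped sample. -/
def normSum {n m : ℕ} (g : Vec d → Vec p → Vec p) (θ : Vec p) (x : Fin n → Fin m → Vec d) :
    Vec p :=
  √((n : ℝ) * m) • groupAvg 1 x (fun y => g y θ)

/-- Puts the normalized sum in the form `n^{-1/2} ∑ z i` to which the quadratic approximations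
apply. -/
lemma normSum_eq {n m : ℕ} (g : Vec d → Vec p → Vec p) (θ : Vec p) (x : Fin n → Fin m → Vec d) :
    normSum g θ x = (√(n : ℝ))⁻¹ • ∑ i, groupSum x (fun y => g y θ) i := by
  simp only [normSum, groupAvg, groupSum, Pi.one_apply, one_smul, ← Finset.smul_sum, smul_smul]
  congr 1
  rw [← div_eq_mul_inv, Real.sqrt_div_self', ← mul_inv, Real.sqrt_mul (Nat.cast_nonneg _),
    one_div]

lemma EmpiricalLaw.tendsto_sqrt_mul (h : EmpiricalLaw l P n m x) :
    Tendsto (fun a => √((n a : ℝ) * m a)) l atTop := by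
  refine tendsto_atTop_mono (fun a => ?_) h.tendsto_sqrt
  refine Real.sqrt_le_sqrt (le_mul_of_one_le_right (Nat.cast_nonneg _) ?_)
  exact_mod_cast h.m_pos a

/-- The weighted average of `g(x, θ)` is approximated by its expected Jacobian near `θ₀`. -/
lemma EmpiricalLaw.approximatesLinear (h : EmpiricalLaw l P n m x) (hU : IsOpen U) (hθ₀ : θ₀ ∈ U)
    (hR : RegularOn g P U) (hJ : Integrable (fun y => fderiv ℝ (g y) θ₀) P) {ε : ℝ} (hε : 0 < ε) :
    ∃ δ > 0, Metric.closedBall θ₀ δ ⊆ U ∧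
      ∀ (t : ℝ) (w : ∀ a, Fin (n a) → ℝ), LevelLE l n t w →
      ∀ᶠ a in l, ∀ θ ∈ Metric.closedBall θ₀ δ, ∀ θ' ∈ Metric.closedBall θ₀ δ,
        ‖groupAvg (w a) (x a) (fun y => g y θ) - groupAvg (w a) (x a) (fun y => g y θ')
          - meanJacobian g P θ₀ (θ - θ')‖ ≤ ε * ‖θ - θ'‖ := by
  obtain ⟨H, hH, hae⟩ := hR
  obtain ⟨δ₀, hδ₀, hδ₀U⟩ := Metric.nhds_basis_closedBall.mem_iff.1 (hU.mem_nhds hθ₀)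
  set C : ℝ := |∫ y, H y ∂P| + 1 with hC
  have hC0 : 0 < C := by positivity
  have hδpos : 0 < min δ₀ (ε / (2 * C)) := by positivity
  have hsub : Metric.closedBall θ₀ (min δ₀ (ε / (2 * C))) ⊆ U :=
    (Metric.closedBall_subset_closedBall (min_le_left _ _)).trans hδ₀U
  -- The radius is fixed before the level and the weights. The Taylor error is at most `δ` times the
  -- weighted average of `H`, which is eventually below `C`; the fluctuation of the weighted
  -- Jacobian about its mean takes the other `ε / 2`.
  refine ⟨min δ₀ (ε / (2 * C)), hδpos, hsub, fun t w hw => ?_⟩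
  set δ := min δ₀ (ε / (2 * C)) with hδ
  have h1 := h.tendsto_groupAvg hw hH
  have h2 := h.tendsto_groupAvg hw hJ
  have h3 : ∫ y, H y ∂P < C := by rw [hC]; linarith [le_abs_self (∫ y, H y ∂P)]
  filter_upwards [h.ae _ hae, h1.eventually (gt_mem_nhds h3),
    (tendsto_iff_norm_sub_tendsto_zero.1 h2).eventually
      (gt_mem_nhds (show (0 : ℝ) < ε / 2 by positivity)), hw]
    with a ha h1 h2 hw θ hθ θ' hθ'
  have hw0 : ∀ i, 0 ≤ w a i := fun i => (hw.1.1 i).le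
  have e1 : groupAvg (w a) (x a) (fun y => g y θ) - groupAvg (w a) (x a) (fun y => g y θ')
      - meanJacobian g P θ₀ (θ - θ') =
      groupAvg (w a) (x a) (fun y => g y θ - g y θ' - fderiv ℝ (g y) θ₀ (θ - θ')) +
      (groupAvg (w a) (x a) (fun y => fderiv ℝ (g y) θ₀) - meanJacobian g P θ₀) (θ - θ') := by
    have e2 : groupAvg (w a) (x a) (fun y => fderiv ℝ (g y) θ₀ (θ - θ')) =
        groupAvg (w a) (x a) (fun y => fderiv ℝ (g y) θ₀) (θ - θ') :=
      groupAvg_clm (w a) (x a) (fun y => fderiv ℝ (g y) θ₀)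
        (ContinuousLinearMap.apply ℝ (Vec p) (θ - θ'))
    rw [groupAvg_sub (w a) (x a) (fun y => g y θ - g y θ'), groupAvg_sub, e2, sub_apply]
    abel
  rw [e1]
  have h4 : ‖groupAvg (w a) (x a) (fun y => g y θ - g y θ' - fderiv ℝ (g y) θ₀ (θ - θ'))‖ ≤
      ε / 2 * ‖θ - θ'‖ := by
    have h5 := norm_groupAvg_le (w := w a) hw0 (x := x a)
      (f := fun y => g y θ - g y θ' - fderiv ℝ (g y) θ₀ (θ - θ'))
      (f' := fun y => (δ * ‖θ - θ'‖) * H y) (fun i k => by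
        have := norm_image_sub_sub_fderiv_le hU (ha i k).1 (fun θ hθ => ((ha i k).2 θ hθ).2)
          hsub hθ hθ'
        refine this.trans (le_of_eq (by ring)))
    rw [groupAvg_const_mul] at h5
    refine h5.trans ?_
    have h6 : δ * C ≤ ε / 2 := by
      have : δ ≤ ε / (2 * C) := min_le_right _ _
      rw [le_div_iff₀ (by positivity)] at this
      linarith
    have h7 : δ * groupAvg (w a) (x a) H ≤ ε / 2 :=
      (mul_le_mul_of_nonneg_left h1.le hδpos.le).trans h6
    nlinarith [norm_nonneg (θ - θ')]
  have h5 : ‖(groupAvg (w a) (x a) (fun y => fderiv ℝ (g y) θ₀) - meanJacobian g P θ₀) (θ - θ')‖ ≤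
      ε / 2 * ‖θ - θ'‖ :=
    (ContinuousLinearMap.le_opNorm _ _).trans (by gcongr; exact h2.le)
  refine (norm_add_le _ _).trans ?_
  linarith

/-- The left side is the trace of the second moment operator. -/
lemma inv_mul_sum_norm_sq_le {N : ℕ} (z : Fin N → Vec p) :
    (N : ℝ)⁻¹ * ∑ i, ‖z i‖ ^ 2 ≤ p * ‖secondMoment z‖ := by
  set b := EuclideanSpace.basisFun (Fin p) ℝ
  have h1 : (N : ℝ)⁻¹ * ∑ i, ‖z i‖ ^ 2 = ∑ j, ⟪secondMoment z (b j), b j⟫ := by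
    simp_rw [inner_secondMoment_self]
    rw [← Finset.mul_sum, Finset.sum_comm]
    congr 1
    refine Finset.sum_congr rfl fun i _ => ?_
    rw [← b.sum_sq_norm_inner_right (z i)]
    simp
  rw [h1]
  have h2 : ∀ j ∈ Finset.univ, ⟪secondMoment z (b j), b j⟫ ≤ ‖secondMoment z‖ := fun j _ => by
    refine (real_inner_le_norm _ _).trans ?_
    have := (secondMoment z).le_opNorm (b j)
    simpa [b.norm_eq_one] using this
  simpa using Finset.sum_le_card_nsmul _ _ _ h2

lemma norm_sq_inv_sqrt_smul_sum_le {N : ℕ} (u : Fin N → ℝ) (z : Fin N → Vec p) :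
    ‖(√(N : ℝ))⁻¹ • ∑ i, u i • z i‖ ^ 2 ≤ (∑ i, u i ^ 2) * ((N : ℝ)⁻¹ * ∑ i, ‖z i‖ ^ 2) := by
  rw [norm_smul, mul_pow, norm_inv, inv_pow, Real.norm_of_nonneg (Real.sqrt_nonneg _),
    Real.sq_sqrt (Nat.cast_nonneg _)]
  have h1 : ‖∑ i, u i • z i‖ ≤ ∑ i, |u i| * ‖z i‖ :=
    (norm_sum_le _ _).trans (le_of_eq (Finset.sum_congr rfl fun i _ => norm_smul _ _))
  have h2 := Finset.sum_mul_sq_le_sq_mul_sq Finset.univ (fun i => |u i|) (fun i => ‖z i‖)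
  simp only [sq_abs] at h2
  rw [mul_left_comm]
  exact mul_le_mul_of_nonneg_left ((pow_le_pow_left₀ (norm_nonneg _) h1 2).trans h2)
    (inv_nonneg.2 (Nat.cast_nonneg _))

/-- Weights of bounded level move the average of `g(x, θ₀)` by at most the order `N^{-1/2}`. -/
lemma RegularGroups.exists_bound_groupAvg (hG : RegularGroups l P (fun y => g y θ₀) n m x)
    (h : EmpiricalLaw l P n m x)
    {R : ℝ} (hS : ∀ᶠ a in l, ‖normSum g θ₀ (x a)‖ ≤ R) {t : ℝ}
    {w : ∀ a, Fin (n a) → ℝ} (hw : LevelLE l n t w) :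
    ∃ C : ℝ, ∀ᶠ a in l, √((n a : ℝ) * m a) * ‖groupAvg (w a) (x a) (fun y => g y θ₀)‖ ≤ C := by
  obtain ⟨B, hB, hwB⟩ := hw.exists_bound
  set V : Vec p →L[ℝ] Vec p := ∫ y, InnerProductSpace.rankOne ℝ (g y θ₀) (g y θ₀) ∂P
  refine ⟨R + √(B * (p * (‖V‖ + 1))), ?_⟩
  filter_upwards [hwB, hS, hG.second.norm.eventually (gt_mem_nhds (lt_add_one ‖V‖)),
    h.n_tendsto.eventually_gt_atTop 0] with a hw hS hV hn
  have hn' : (0 : ℝ) < n a := Nat.cast_pos.2 hn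
  have hm' : (0 : ℝ) < m a := Nat.cast_pos.2 (h.m_pos a)
  set Z := groupSum (x a) (fun y => g y θ₀) with hZ
  -- The effect of the weights is `n^{-1/2} ∑ (w i - 1) Z i`. By Cauchy-Schwarz it is controlled by
  -- `∑ (w i - 1)² ≤ B` and the trace of the second moment.
  have e1 : √((n a : ℝ) * m a) • groupAvg (w a) (x a) (fun y => g y θ₀) =
      normSum g θ₀ (x a) + (√(n a : ℝ))⁻¹ • ∑ i, (w a i - 1) • Z i := by
    rw [normSum, ← sub_eq_iff_eq_add', ← smul_sub, groupAvg_sub_groupAvg_one]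
    simp only [groupAvg, hZ, groupSum, Finset.smul_sum, smul_smul]
    refine Finset.sum_congr rfl fun i _ => Finset.sum_congr rfl fun k _ => ?_
    congr 1
    rw [Real.sqrt_mul hn'.le]
    have h1 := (Real.sqrt_pos.2 hn').ne'
    have h2 := (Real.sqrt_pos.2 hm').ne'
    field_simp
    rw [Real.sq_sqrt hn'.le, Real.sq_sqrt hm'.le]
  have e2 : √((n a : ℝ) * m a) * ‖groupAvg (w a) (x a) (fun y => g y θ₀)‖ =
      ‖√((n a : ℝ) * m a) • groupAvg (w a) (x a) (fun y => g y θ₀)‖ := by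
    rw [norm_smul, Real.norm_of_nonneg (Real.sqrt_nonneg _)]
  rw [e2, e1]
  refine (norm_add_le _ _).trans (add_le_add hS ?_)
  apply Real.le_sqrt_of_sq_le
  refine (norm_sq_inv_sqrt_smul_sum_le _ _).trans (mul_le_mul hw.2.2 ?_ ?_ hB.le)
  · exact (inv_mul_sum_norm_sq_le Z).trans
      (mul_le_mul_of_nonneg_left hV.le (Nat.cast_nonneg _))
  · exact mul_nonneg (by positivity) (Finset.sum_nonneg fun i _ => sq_nonneg _)

lemma exists_inverse_bound {J : Vec p →L[ℝ] Vec p} (hJ : Function.Injective J) :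
    ∃ c > 0, ∀ v, c * ‖v‖ ≤ ‖J v‖ := by
  obtain ⟨K, hK, hJK⟩ := (J : Vec p →ₗ[ℝ] Vec p).exists_antilipschitzWith
    (LinearMap.ker_eq_bot.2 hJ)
  refine ⟨(K : ℝ)⁻¹, by positivity, fun v => ?_⟩
  have h1 := hJK.le_mul_dist v 0
  simp only [dist_zero_right, map_zero] at h1
  rw [inv_mul_le_iff₀ (by positivity)]
  exact h1

/-- The rate of convergence of the solutions of the weighted estimating equation. -/
lemma RegularGroups.exists_rate (hG : RegularGroups l P (fun y => g y θ₀) n m x)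
    (h : EmpiricalLaw l P n m x) (hU : IsOpen U) (hθ₀ : θ₀ ∈ U) (hR : RegularOn g P U)
    (hJ : Integrable (fun y => fderiv ℝ (g y) θ₀) P)
    (hJinj : Function.Injective (meanJacobian g P θ₀))
    {R : ℝ} (hS : ∀ᶠ a in l, ‖normSum g θ₀ (x a)‖ ≤ R) {t : ℝ}
    {w : ∀ a, Fin (n a) → ℝ} (hw : LevelLE l n t w) {θ : α → Vec p}
    (hθ : ∀ᶠ a in l, groupAvg (w a) (x a) (fun y => g y (θ a)) = 0)
    (hloc : ∀ δ > 0, ∀ᶠ a in l, θ a ∈ Metric.closedBall θ₀ δ) :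
    ∃ C : ℝ, ∀ᶠ a in l, √((n a : ℝ) * m a) * ‖θ a - θ₀‖ ≤ C := by
  obtain ⟨c, hc, hcJ⟩ := exists_inverse_bound hJinj
  -- With linearization error `c / 2`, half of the lower bound `c ‖v‖ ≤ ‖J v‖` survives and is
  -- compared with the average at `θ₀`, which is `O(N^{-1/2})`.
  obtain ⟨δ, hδ, -, happ⟩ := h.approximatesLinear hU hθ₀ hR hJ (half_pos hc)
  obtain ⟨C, hC⟩ := hG.exists_bound_groupAvg h hS hw
  refine ⟨2 * C / c, ?_⟩
  filter_upwards [hloc δ hδ, happ t w hw, hC, hθ] with a hloc happ hC hθ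
  have h1 := happ _ hloc _ (Metric.mem_closedBall_self hδ.le)
  rw [hθ, zero_sub] at h1
  have h2 := hcJ (θ a - θ₀)
  have h3 : ‖meanJacobian g P θ₀ (θ a - θ₀)‖ ≤
      c / 2 * ‖θ a - θ₀‖ + ‖groupAvg (w a) (x a) (fun y => g y θ₀)‖ := by
    have e : meanJacobian g P θ₀ (θ a - θ₀) =
      -(-groupAvg (w a) (x a) (fun y => g y θ₀) - meanJacobian g P θ₀ (θ a - θ₀)) -
        groupAvg (w a) (x a) (fun y => g y θ₀) := by abel
    rw [e]
    refine (norm_sub_le _ _).trans ?_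
    rw [norm_neg]
    gcongr
  have h4 : c / 2 * ‖θ a - θ₀‖ ≤ ‖groupAvg (w a) (x a) (fun y => g y θ₀)‖ := by linarith
  rw [le_div_iff₀ hc]
  have h5 := mul_le_mul_of_nonneg_left h4 (Real.sqrt_nonneg ((n a : ℝ) * m a))
  linarith

/-- A unique solution of the weighted estimating equation is close to `θ₀`. -/
lemma RegularGroups.localized_of_unique (hG : RegularGroups l P (fun y => g y θ₀) n m x)
    (h : EmpiricalLaw l P n m x) (hU : IsOpen U) (hθ₀ : θ₀ ∈ U) (hR : RegularOn g P U)
    (hJ : Integrable (fun y => fderiv ℝ (g y) θ₀) P)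
    (hJinj : Function.Injective (meanJacobian g P θ₀))
    {R : ℝ} (hS : ∀ᶠ a in l, ‖normSum g θ₀ (x a)‖ ≤ R) {t : ℝ}
    {w : ∀ a, Fin (n a) → ℝ} (hw : LevelLE l n t w) {θ : α → Vec p}
    (hθ : ∀ᶠ a in l, ∀ θ', groupAvg (w a) (x a) (fun y => g y θ') = 0 → θ' = θ a)
    {δ : ℝ} (hδ : 0 < δ) : ∀ᶠ a in l, θ a ∈ Metric.closedBall θ₀ δ := by
  let e : Vec p ≃L[ℝ] Vec p := (LinearEquiv.ofInjectiveEndo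
    (meanJacobian g P θ₀ : Vec p →ₗ[ℝ] Vec p) hJinj).toContinuousLinearEquiv
  have he : (e : Vec p →L[ℝ] Vec p) = meanJacobian g P θ₀ := by ext v; rfl
  -- The zero space is set apart because there the inverse has norm zero, and the constant below
  -- would not be positive.
  rcases subsingleton_or_nontrivial (Vec p) with hp | hp
  · refine Eventually.of_forall fun a => ?_
    rw [Subsingleton.elim (θ a) θ₀]
    exact Metric.mem_closedBall_self hδ.le
  have hN : 0 < ‖(e.symm : Vec p →L[ℝ] Vec p)‖ := e.norm_symm_pos
  -- Half of the reciprocal norm of the inverse: a map within `ε` of `e` carries the ball of radius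
  -- `δ₂` onto a set containing the ball of radius `ε δ₂` about the image of the centre.
  set ε : NNReal := ‖(e.symm : Vec p →L[ℝ] Vec p)‖₊⁻¹ / 2 with hε_def
  have hε : (0 : ℝ) < ε := by
    simp only [hε_def, NNReal.coe_div, NNReal.coe_inv, coe_nnnorm]
    positivity
  obtain ⟨δ₁, hδ₁, -, happ⟩ := h.approximatesLinear hU hθ₀ hR hJ hε
  obtain ⟨C, hC⟩ := hG.exists_bound_groupAvg h hS hw
  set δ₂ := min δ δ₁ with hδ₂
  have hδ₂0 : 0 < δ₂ := by positivity
  filter_upwards [happ t w hw, hC, hθ, h.tendsto_sqrt_mul.eventually_gt_atTop (C / (ε * δ₂)),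
    h.tendsto_sqrt_mul.eventually_gt_atTop 0]
    with a happ hC hθ hN1 hN2
  have hsub := Metric.closedBall_subset_closedBall (x := θ₀) (min_le_right δ δ₁)
  have hA : ApproximatesLinearOn (fun θ => groupAvg (w a) (x a) (fun y => g y θ))
      (e : Vec p →L[ℝ] Vec p) (Metric.closedBall θ₀ δ₂) ε := by
    intro θ hθ θ' hθ'
    rw [he]
    exact happ θ (hsub hθ) θ' (hsub hθ')
  -- Quantitative inverse function theorem. The average at `θ₀` tends to zero, so the covered ball
  -- contains zero; the resulting root near `θ₀` is `θ a` by uniqueness.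
  have hsurj := hA.surjOn_closedBall_of_nonlinearRightInverse e.toNonlinearRightInverse
    hδ₂0.le subset_rfl
  have hmem : (0 : Vec p) ∈ Metric.closedBall (groupAvg (w a) (x a) (fun y => g y θ₀))
      (((e.toNonlinearRightInverse.nnnorm : ℝ)⁻¹ - ε) * δ₂) := by
    rw [mem_closedBall_iff_norm', sub_zero]
    have e1 : (e.toNonlinearRightInverse.nnnorm : ℝ)⁻¹ - ε = ε := by
      have : (e.toNonlinearRightInverse.nnnorm : ℝ) = ‖(e.symm : Vec p →L[ℝ] Vec p)‖ := rfl
      rw [this]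
      simp only [hε_def, NNReal.coe_div, NNReal.coe_inv, coe_nnnorm]
      norm_num
      ring
    rw [e1]
    rw [div_lt_iff₀ (by positivity)] at hN1
    have h1 := hC.trans hN1.le
    exact le_of_mul_le_mul_left h1 hN2
  obtain ⟨θ', hθ', h0⟩ := hsurj hmem
  rw [← hθ θ' h0]
  exact Metric.closedBall_subset_closedBall (min_le_left δ δ₁) hθ'

/-- A solution of the weighted estimating equation in a compact convex set on which the model is
regular is close to `θ₀`. -/
lemma EmpiricalLaw.localized_of_compact (h : EmpiricalLaw l P n m x)
    (hP : IsParameter g P θ₀) (hg : ∀ θ, Measurable fun y => g y θ)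
    (hU : IsOpen U) (hR : RegularOn g P U)
    {K : Set (Vec p)} (hK : IsCompact K) (hKc : Convex ℝ K) (hKU : K ⊆ U) (hθK : θ₀ ∈ K) {t : ℝ}
    {w : ∀ a, Fin (n a) → ℝ} (hw : LevelLE l n t w) {θ : α → Vec p} (hθ : ∀ᶠ a in l, θ a ∈ K)
    (hθ0 : ∀ᶠ a in l, groupAvg (w a) (x a) (fun y => g y (θ a)) = 0)
    {δ : ℝ} (hδ : 0 < δ) : ∀ᶠ a in l, θ a ∈ Metric.closedBall θ₀ δ := by
  obtain ⟨H, hH, hae⟩ := hR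
  have hcomp : IsCompact (K \ Metric.ball θ₀ δ) := hK.diff Metric.isOpen_ball
  -- Uniqueness of the parameter excludes only those `θ'` at which the mean exists; on `K` existence
  -- follows from the integrable Lipschitz constant `H`.
  have hint : ∀ θ' ∈ K, Integrable (fun y => g y θ') P := fun θ' hθ' => by
    have h1 : Integrable (fun y => g y θ' - g y θ₀) P := by
      refine (hH.mul_const ‖θ' - θ₀‖).mono' (((hg θ').sub (hg θ₀)).aestronglyMeasurable) ?_
      filter_upwards [hae] with y hy
      exact norm_image_sub_le_of_fderiv_le hU hy.1 (fun θ hθ => (hy.2 θ hθ).1) hKc hKU hθ' hθK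
    exact (h1.add hP.integrable).congr (ae_of_all _ fun y => by simp)
  -- Compactness reduces the claim to a neighbourhood of each `θ' ≠ θ₀`, where the weighted average
  -- at `θ'` stays away from zero.
  have key : ∀ᶠ a in l, θ a ∉ K \ Metric.ball θ₀ δ := by
    refine hcomp.induction_on (p := fun s => ∀ᶠ a in l, θ a ∉ s) (by simp)
      (fun s s' hss' hs' => hs'.mono fun a ha h => ha (hss' h))
      (fun s s' hs hs' => by
        filter_upwards [hs, hs'] with a h1 h2 h3
        exact h3.elim h1 h2) (fun θ' hθ' => ?_)
    have hne : ∫ y, g y θ' ∂P ≠ 0 := fun h0 => by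
      have := hP.unique θ' (hint θ' hθ'.1) h0
      exact hθ'.2 (this ▸ Metric.mem_ball_self hδ)
    set η := ‖∫ y, g y θ' ∂P‖ with hη
    have hη0 : 0 < η := norm_pos_iff.2 hne
    set C : ℝ := |∫ y, H y ∂P| + 1 with hC
    have hC0 : 0 < C := by positivity
    -- On this ball the average moves by at most `η / 2` from its value at `θ'`, whose norm
    -- eventually exceeds `η / 2`; hence it cannot vanish.
    refine ⟨Metric.ball θ' (η / (2 * C)) ∩ K, ?_, ?_⟩
    · rw [Set.inter_comm]
      exact inter_mem (mem_of_superset self_mem_nhdsWithin Set.sdiff_subset)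
        (mem_nhdsWithin_of_mem_nhds (Metric.ball_mem_nhds _ (by positivity)))
    · have h1 := (h.tendsto_groupAvg hw (hint θ' hθ'.1)).norm
      have h2 := h.tendsto_groupAvg hw hH
      have h3 : ∫ y, H y ∂P < C := by rw [hC]; linarith [le_abs_self (∫ y, H y ∂P)]
      filter_upwards [h1.eventually (lt_mem_nhds (show η / 2 < η by linarith)),
        h2.eventually (gt_mem_nhds h3), h.ae _ hae, hθ0, hw] with a h1 h2 hae hθ0 hw hmem
      have h4 := norm_groupAvg_le (w := w a) (fun i => (hw.1.1 i).le) (x := x a)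
        (f := fun y => g y θ' - g y (θ a)) (f' := fun y => ‖θ' - θ a‖ * H y) (fun i k => by
          rw [mul_comm]
          exact norm_image_sub_le_of_fderiv_le hU (hae i k).1
            (fun θ hθ => ((hae i k).2 θ hθ).1) hKc hKU hθ'.1 hmem.2)
      rw [groupAvg_sub, hθ0, sub_zero, groupAvg_const_mul] at h4
      have h5 : ‖θ' - θ a‖ ≤ η / (2 * C) := by
        rw [← dist_eq_norm, dist_comm]; exact (Metric.mem_ball.1 hmem.1).le
      have h6 : ‖θ' - θ a‖ * groupAvg (w a) (x a) H ≤ η / (2 * C) * C :=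
        (mul_le_mul_of_nonneg_left h2.le (norm_nonneg _)).trans
          (mul_le_mul_of_nonneg_right h5 hC0.le)
      have h7 : η / (2 * C) * C = η / 2 := by field_simp
      linarith
  filter_upwards [key, hθ] with a h1 h2
  by_contra h3
  exact h1 ⟨h2, fun h4 => h3 (Metric.ball_subset_closedBall h4)⟩

/-! ### Parameters at distance `O(N^{-1/2})` from the truth. -/

section LocalParameter

variable {θ : α → Vec p} {R : ℝ}

lemma EmpiricalLaw.localized_of_rate (h : EmpiricalLaw l P n m x)
    (hθ : ∀ᶠ a in l, √((n a : ℝ) * m a) * ‖θ a - θ₀‖ ≤ R) {δ : ℝ} (hδ : 0 < δ) :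
    ∀ᶠ a in l, θ a ∈ Metric.closedBall θ₀ δ := by
  filter_upwards [hθ, h.tendsto_sqrt_mul.eventually_gt_atTop (R / δ),
    h.tendsto_sqrt_mul.eventually_gt_atTop 0] with a h1 h2 h3
  rw [mem_closedBall_iff_norm]
  rw [div_lt_iff₀ hδ] at h2
  exact le_of_mul_le_mul_left (h1.trans h2.le) h3

/-- Uniform weights have level zero, so `approximatesLinear` applies with arbitrarily small relative
error; multiplied by `√N ‖θ - θ₀‖ = O(1)` that error still tends to zero. -/
lemma EmpiricalLaw.normSum_sub_tendsto (h : EmpiricalLaw l P n m x)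
    (hU : IsOpen U) (hθ₀ : θ₀ ∈ U) (hR : RegularOn g P U)
    (hJ : Integrable (fun y => fderiv ℝ (g y) θ₀) P)
    (hθ : ∀ᶠ a in l, √((n a : ℝ) * m a) * ‖θ a - θ₀‖ ≤ R) :
    Tendsto (fun a => normSum g (θ a) (x a) - (normSum g θ₀ (x a) +
      meanJacobian g P θ₀ (√((n a : ℝ) * m a) • (θ a - θ₀)))) l (𝓝 0) := by
  rw [Metric.tendsto_nhds]
  intro ε hε
  have hε' : 0 < ε / (2 * (|R| + 1)) := by positivity
  obtain ⟨δ, hδ, -, happ⟩ := h.approximatesLinear hU hθ₀ hR hJ hε'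
  filter_upwards [happ 0 _ (levelLE_one l n), hθ, h.localized_of_rate hθ hδ] with a h1 h2 h3
  have h4 := h1 _ h3 _ (Metric.mem_closedBall_self hδ.le)
  rw [dist_zero_right]
  have e : normSum g (θ a) (x a) - (normSum g θ₀ (x a) +
      meanJacobian g P θ₀ (√((n a : ℝ) * m a) • (θ a - θ₀))) = √((n a : ℝ) * m a) •
      (groupAvg 1 (x a) (fun y => g y (θ a)) - groupAvg 1 (x a) (fun y => g y θ₀)
          - meanJacobian g P θ₀ (θ a - θ₀)) := by
    rw [ContinuousLinearMap.map_smul]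
    simp only [normSum, smul_sub]
    abel
  rw [e, norm_smul, Real.norm_of_nonneg (Real.sqrt_nonneg _)]
  calc _ ≤ √((n a : ℝ) * m a) * (ε / (2 * (|R| + 1)) * ‖θ a - θ₀‖) := by
        gcongr
    _ = ε / (2 * (|R| + 1)) * (√((n a : ℝ) * m a) * ‖θ a - θ₀‖) := by ring
    _ ≤ ε / (2 * (|R| + 1)) * (|R| + 1) :=
        mul_le_mul_of_nonneg_left (by linarith [le_abs_self R]) hε'.le
    _ = ε / 2 := by field_simp
    _ < ε := by linarith

lemma norm_rankOne_self_sub_le (u v : Vec p) :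
    ‖InnerProductSpace.rankOne ℝ u u - InnerProductSpace.rankOne ℝ v v‖ ≤
      ‖u - v‖ * (‖u‖ + ‖v‖) := by
  have e : InnerProductSpace.rankOne ℝ u u - InnerProductSpace.rankOne ℝ v v =
      InnerProductSpace.rankOne ℝ (u - v) u + InnerProductSpace.rankOne ℝ v (u - v) := by
    simp
  rw [e]
  refine (norm_add_le _ _).trans ?_
  simp only [InnerProductSpace.norm_rankOne]
  nlinarith

/-- The group sums are regular at parameters at a distance of the order `N^{-1/2}` from `θ₀`. -/
lemma RegularGroups.local (hG : RegularGroups l P (fun y => g y θ₀) n m x)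
    (h : EmpiricalLaw l P n m x) (hU : IsOpen U) (hθ₀ : θ₀ ∈ U) (hR : RegularOn g P U)
    (hθ : ∀ᶠ a in l, √((n a : ℝ) * m a) * ‖θ a - θ₀‖ ≤ R) :
    Tendsto (fun a => secondMoment (groupSum (x a) (fun y => g y (θ a)))) l
      (𝓝 (∫ y, InnerProductSpace.rankOne ℝ (g y θ₀) (g y θ₀) ∂P)) ∧
    ∀ δ : ℝ, 0 < δ → ∀ᶠ a in l, ∀ i,
      ‖groupSum (x a) (fun y => g y (θ a)) i‖ ≤ δ * √(n a : ℝ) := by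
  obtain ⟨H, hH, hae⟩ := hR
  obtain ⟨δ₀, hδ₀, hδ₀U⟩ := Metric.nhds_basis_closedBall.mem_iff.1 (hU.mem_nhds hθ₀)
  set R' : ℝ := |R| + 1 with hR'
  have hR'0 : 0 < R' := by positivity
  -- The factor `m^{-1/2}` of the group sum and the factor `(n m)^{-1/2}` of the displacement
  -- combine to `n^{-1/2}` times the group mean of `|H|`.
  have hdiff : ∀ᶠ a in l, ∀ i, ‖groupSum (x a) (fun y => g y (θ a)) i -
      groupSum (x a) (fun y => g y θ₀) i‖ ≤
        R' * ((√(n a : ℝ))⁻¹ * ((m a : ℝ)⁻¹ * ∑ k, |H (x a i k)|)) := by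
    filter_upwards [h.ae _ hae, hθ, h.localized_of_rate hθ hδ₀, h.n_tendsto.eventually_gt_atTop 0]
      with a hae hθ hloc hn i
    have hn' : (0 : ℝ) < n a := Nat.cast_pos.2 hn
    have hm' : (0 : ℝ) < m a := Nat.cast_pos.2 (h.m_pos a)
    have h1 := Real.sqrt_pos.2 hn'
    have h2 := Real.sqrt_pos.2 hm'
    simp only [groupSum, ← smul_sub, ← Finset.sum_sub_distrib]
    rw [norm_smul, norm_inv, Real.norm_of_nonneg h2.le]
    have h3 : ‖∑ k, (g (x a i k) (θ a) - g (x a i k) θ₀)‖ ≤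
        (∑ k, |H (x a i k)|) * ‖θ a - θ₀‖ := by
      rw [Finset.sum_mul]
      refine (norm_sum_le _ _).trans (Finset.sum_le_sum fun k _ => ?_)
      exact (norm_image_sub_le_of_fderiv_le hU (hae i k).1
            (fun θ hθ => ((hae i k).2 θ hθ).1) (convex_closedBall θ₀ δ₀) hδ₀U hloc
            (Metric.mem_closedBall_self hδ₀.le)).trans (by gcongr; exact le_abs_self _)
    have h4 : ‖θ a - θ₀‖ ≤ R' * ((√(n a : ℝ))⁻¹ * (√(m a : ℝ))⁻¹) := by
      rw [← mul_inv, ← div_eq_mul_inv, le_div_iff₀ (by positivity), ← Real.sqrt_mul hn'.le, mul_comm]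
      exact hθ.trans (by rw [hR']; linarith [le_abs_self R])
    have h5 : (m a : ℝ)⁻¹ = (√(m a : ℝ))⁻¹ * (√(m a : ℝ))⁻¹ := by
      rw [← mul_inv, Real.mul_self_sqrt hm'.le]
    have h6 : 0 ≤ ∑ k, |H (x a i k)| := Finset.sum_nonneg fun k _ => abs_nonneg _
    calc _ ≤ (√(m a : ℝ))⁻¹ * ((∑ k, |H (x a i k)|) *
          (R' * ((√(n a : ℝ))⁻¹ * (√(m a : ℝ))⁻¹))) := by
          gcongr
          exact h3.trans (by gcongr)
      _ = _ := by rw [h5]; ring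
  have hmax : ∀ δ : ℝ, 0 < δ → ∀ᶠ a in l, ∀ i,
      ‖groupSum (x a) (fun y => g y (θ a)) i‖ ≤ δ * √(n a : ℝ) := by
    intro δ hδ
    filter_upwards [hdiff, hG.max_le (δ / 2) (by positivity),
      h.groupMean_le hH (show 0 < δ / (2 * R') by positivity),
      h.n_tendsto.eventually_gt_atTop 0] with a h1 h2 h3 hn i
    have hn' : (0 : ℝ) < n a := Nat.cast_pos.2 hn
    have hs := Real.sqrt_pos.2 hn'
    have h4 : R' * ((√(n a : ℝ))⁻¹ * ((m a : ℝ)⁻¹ * ∑ k, |H (x a i k)|)) ≤ δ / 2 * √(n a : ℝ) := by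
      calc _ ≤ R' * ((√(n a : ℝ))⁻¹ * (δ / (2 * R') * n a)) :=
            mul_le_mul_of_nonneg_left (mul_le_mul_of_nonneg_left (h3 i) (by positivity)) hR'0.le
        _ = δ / 2 * ((√(n a : ℝ))⁻¹ * n a) := by field_simp
        _ = _ := by rw [inv_mul_eq_div, Real.div_sqrt]
    have h5 := norm_le_norm_add_norm_sub' (groupSum (x a) (fun y => g y (θ a)) i)
      (groupSum (x a) (fun y => g y θ₀) i)
    linarith [h1 i, h2 i]
  refine ⟨?_, hmax⟩
  -- By `‖uu' - vv'‖ ≤ ‖u - v‖ (‖u‖ + ‖v‖)` each term is at most `n^{-1/2}` times a group mean of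
  -- `|H|`, multiplied by `o(√n)`; averaging leaves `o(1)` times the overall mean of `|H|`.
  have hsub : Tendsto (fun a => secondMoment (groupSum (x a) (fun y => g y (θ a))) -
      secondMoment (groupSum (x a) (fun y => g y θ₀))) l (𝓝 0) := by
    rw [Metric.tendsto_nhds]
    intro ε hε
    set C : ℝ := |∫ y, |H y| ∂P| + 1 with hC
    have hC0 : 0 < C := by positivity
    have h3 : ∫ y, |H y| ∂P < C := by rw [hC]; linarith [le_abs_self (∫ y, |H y| ∂P)]
    have hδ : 0 < ε / (4 * R' * C) := by positivity
    filter_upwards [hdiff, hG.max_le _ hδ, hmax _ hδ, (h.lln _ hH.abs).eventually (gt_mem_nhds h3),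
      h.n_tendsto.eventually_gt_atTop 0] with a h1 h2 h3 h4 hn
    have hn' : (0 : ℝ) < n a := Nat.cast_pos.2 hn
    have hm' : (0 : ℝ) < m a := Nat.cast_pos.2 (h.m_pos a)
    have hs := Real.sqrt_pos.2 hn'
    rw [dist_zero_right]
    simp only [secondMoment, ← smul_sub, ← Finset.sum_sub_distrib]
    rw [norm_smul, norm_inv, Real.norm_of_nonneg hn'.le]
    have h5 : ‖∑ i, (InnerProductSpace.rankOne ℝ (groupSum (x a) (fun y => g y (θ a)) i)
        (groupSum (x a) (fun y => g y (θ a)) i) -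
        InnerProductSpace.rankOne ℝ (groupSum (x a) (fun y => g y θ₀) i)
        (groupSum (x a) (fun y => g y θ₀) i))‖ ≤
        ∑ i, (ε / (2 * C)) * ((m a : ℝ)⁻¹ * ∑ k, |H (x a i k)|) := by
      refine (norm_sum_le _ _).trans (Finset.sum_le_sum fun i _ => ?_)
      refine (norm_rankOne_self_sub_le _ _).trans ?_
      have h6 : 0 ≤ (m a : ℝ)⁻¹ * ∑ k, |H (x a i k)| :=
        mul_nonneg (by positivity) (Finset.sum_nonneg fun k _ => abs_nonneg _)
      calc _ ≤ R' * ((√(n a : ℝ))⁻¹ * ((m a : ℝ)⁻¹ * ∑ k, |H (x a i k)|)) *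
            (ε / (4 * R' * C) * √(n a : ℝ) + ε / (4 * R' * C) * √(n a : ℝ)) := by
            gcongr
            · exact h1 i
            · exact h3 i
            · exact h2 i
        _ = _ := by field_simp; ring
    calc _ ≤ (n a : ℝ)⁻¹ * ∑ i, (ε / (2 * C)) * ((m a : ℝ)⁻¹ * ∑ k, |H (x a i k)|) := by gcongr
      _ = ε / (2 * C) * groupAvg 1 (x a) (fun y => |H y|) := by
        simp only [groupAvg, Pi.one_apply, smul_eq_mul, one_mul, ← Finset.mul_sum]
        rw [mul_inv]; ring
      _ ≤ ε / (2 * C) * C := by gcongr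
      _ = ε / 2 := by field_simp
      _ < ε := by linarith
  simpa using hsub.add hG.second

end LocalParameter

end Estimation

/-! ### Two samples -/

section TwoSample

open scoped RealInnerProductSpace

/-- The second moment operator of `g(X, θ)`, `X ∼ P`. -/
def momentOp {d p : ℕ} (g : Vec d → Vec p → Vec p) (P : Measure (Vec d)) (θ : Vec p) :
    Vec p →L[ℝ] Vec p :=
  ∫ y, InnerProductSpace.rankOne ℝ (g y θ) (g y θ) ∂P

/-- The regularity conditions on the population. -/
structure RegularModel {d p : ℕ} (g : Vec d → Vec p → Vec p) (P : Measure (Vec d))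
    (U : Set (Vec p)) (θ₀ : Vec p) : Prop where
  isOpen : IsOpen U
  mem : θ₀ ∈ U
  measurable : ∀ θ, Measurable fun y => g y θ
  isParameter : IsParameter g P θ₀
  regularOn : RegularOn g P U
  integrable_fderiv : Integrable (fun y => fderiv ℝ (g y) θ₀) P
  injective_jacobian : Function.Injective (meanJacobian g P θ₀)
  injective_momentOp : Function.Injective (momentOp g P θ₀)

/-- The properties which grouped samples have with high probability. -/
structure GoodSample {α : Type*} {d p : ℕ} (l : Filter α) (g : Vec d → Vec p → Vec p)
    (P : Measure (Vec d)) (θ₀ : Vec p) (n m : α → ℕ) (x : ∀ a, Fin (n a) → Fin (m a) → Vec d) :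
    Prop where
  law : EmpiricalLaw l P n m x
  groups : RegularGroups l P (fun y => g y θ₀) n m x
  bounded : (fun a => normSum g θ₀ (x a)) =O[l] (fun _ => (1 : ℝ))

variable {α β : Type*} {d p : ℕ} {l : Filter α} {P PX PY : Measure (Vec d)}
  {g : Vec d → Vec p → Vec p} {U Ux Uy : Set (Vec p)} {θ₀ θx₀ θy₀ : Vec p} {n n₁ n₂ m : α → ℕ}
  {x : ∀ a, Fin (n a) → Fin (m a) → Vec d}

lemma GoodSample.comp (h : GoodSample l g P θ₀ n m x) {l' : Filter β} {φ : β → α}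
    (hφ : Tendsto φ l' l) :
    GoodSample l' g P θ₀ (fun b => n (φ b)) (fun b => m (φ b)) (fun b => x (φ b)) where
  law := h.law.comp hφ
  groups := h.groups.comp hφ
  bounded := h.bounded.comp_tendsto hφ

lemma GoodSample.normSum_le (h : GoodSample l g P θ₀ n m x) :
    ∃ R : ℝ, ∀ᶠ a in l, ‖normSum g θ₀ (x a)‖ ≤ R := by
  obtain ⟨R, hR⟩ := h.bounded.bound
  exact ⟨R, by simpa using hR⟩

/-- The duality bound for the group sums at the moving parameter `θ a`; `RegularGroups.local`
carries over the moment and maximum conditions from `θ₀`. -/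
lemma GoodSample.le_negTwoLog (h : GoodSample l g P θ₀ n m x) (hM : RegularModel g P U θ₀)
    {θ : α → Vec p} {C : ℝ} (hθ : ∀ᶠ a in l, √((n a : ℝ) * m a) * ‖θ a - θ₀‖ ≤ C)
    {κ : α → Vec p} (hκ : κ =O[l] (fun _ => (1 : ℝ)))
    {w : ∀ a, Fin (n a) → ℝ} (hw : ∀ᶠ a in l, IsRelWeight (w a))
    (hwθ : ∀ᶠ a in l, groupAvg (w a) (x a) (fun y => g y (θ a)) = 0) {ε : ℝ} (hε : 0 < ε) :
    ∀ᶠ a in l, 2 * ⟪κ a, normSum g (θ a) (x a)⟫ - ⟪momentOp g P θ₀ (κ a), κ a⟫ - ε ≤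
      negTwoLog (w a) := by
  obtain ⟨hV, hmax⟩ := h.groups.local h.law hM.isOpen hM.mem hM.regularOn hθ
  obtain ⟨R, hR⟩ := hκ.bound
  simp only [norm_one, mul_one] at hR
  simp_rw [normSum_eq]
  refine eventually_le_negTwoLog h.law.n_tendsto hV hmax hR hw ?_ hε
  filter_upwards [hwθ, h.law.n_tendsto.eventually_gt_atTop 0] with a ha hn
  have hn' : (0 : ℝ) < n a := Nat.cast_pos.2 hn
  have hm' : (0 : ℝ) < m a := Nat.cast_pos.2 (h.law.m_pos a)
  simp only [groupAvg, smul_eq_zero, inv_eq_zero, (mul_pos hn' hm').ne', false_or] at ha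
  simp only [groupSum, smul_comm (w a _), ← Finset.smul_sum, ha, smul_zero]

lemma GoodSample.exists_negTwoLog_le (h : GoodSample l g P θ₀ n m x) (hM : RegularModel g P U θ₀)
    {θ : α → Vec p} {C : ℝ} (hθ : ∀ᶠ a in l, √((n a : ℝ) * m a) * ‖θ a - θ₀‖ ≤ C)
    {κ : α → Vec p} (hκ : κ =O[l] (fun _ => (1 : ℝ)))
    (hs : Tendsto (fun a => normSum g (θ a) (x a) - momentOp g P θ₀ (κ a)) l (𝓝 0))
    {ε : ℝ} (hε : 0 < ε) :
    ∀ᶠ a in l, ∃ w : Fin (n a) → ℝ, IsRelWeight w ∧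
      groupAvg w (x a) (fun y => g y (θ a)) = 0 ∧
      negTwoLog w ≤ ⟪momentOp g P θ₀ (κ a), κ a⟫ + ε := by
  obtain ⟨hV, hmax⟩ := h.groups.local h.law hM.isOpen hM.mem hM.regularOn hθ
  obtain ⟨R, hR⟩ := hκ.bound
  simp only [norm_one, mul_one] at hR
  simp_rw [normSum_eq] at hs
  have h1 := eventually_exists_negTwoLog_le h.law.n_tendsto hV hM.injective_momentOp hmax hR hs hε
  filter_upwards [h1] with a ⟨w, hw, hw0, hle⟩
  refine ⟨w, hw, ?_, hle⟩
  have hm' : (0 : ℝ) < m a := Nat.cast_pos.2 (h.law.m_pos a)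
  simp only [groupSum, smul_comm (w _), ← Finset.smul_sum] at hw0
  rw [smul_eq_zero, or_iff_right (inv_ne_zero (Real.sqrt_pos.2 hm').ne')] at hw0
  rw [groupAvg, hw0, smul_zero]

/-- The difference of the normalized sums which governs the two-sample statistic. -/
def contrast (g : Vec d → Vec p → Vec p) (θx θy : Vec p) (A : Vec p →L[ℝ] Vec p)
    {n₁ n₂ m : ℕ} (x : Fin n₁ → Fin m → Vec d) (y : Fin n₂ → Fin m → Vec d) : Vec p :=
  normSum g θx x - A (normSum g θy y)

variable {xs : ∀ a, Fin (n₁ a) → Fin (m a) → Vec d} {ys : ∀ a, Fin (n₂ a) → Fin (m a) → Vec d}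

lemma isLittleO_one_inner {u v : α → Vec p} (hu : u =O[l] (fun _ => (1 : ℝ)))
    (hv : Tendsto v l (𝓝 0)) : Tendsto (fun a => ⟪u a, v a⟫) l (𝓝 0) := by
  rw [← Asymptotics.isLittleO_one_iff ℝ] at hv ⊢
  refine (Asymptotics.IsBigO.of_bound 1 (Eventually.of_forall fun a => ?_)).trans_isLittleO
    (hu.norm_left.mul_isLittleO hv.norm_left |>.trans_isBigO
      (Asymptotics.isBigO_const_const _ one_ne_zero _))
  simp only [norm_mul, norm_norm, one_mul]
  exact norm_inner_le_norm _ _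

lemma isBigO_one_clm {u : α → Vec p} (hu : u =O[l] (fun _ => (1 : ℝ))) (L : Vec p →L[ℝ] Vec p) :
    (fun a => L (u a)) =O[l] (fun _ => (1 : ℝ)) :=
  (L.isBigO_comp u l).trans hu

lemma tendsto_smul_isBigO_one {u : α → Vec p} (hu : u =O[l] (fun _ => (1 : ℝ))) {r : α → ℝ}
    (hr : Tendsto r l (𝓝 0)) : Tendsto (fun a => r a • u a) l (𝓝 0) := by
  rw [← Asymptotics.isLittleO_one_iff ℝ] at hr ⊢
  simpa using hr.smul_isBigO hu

/-- Expresses `√N₂` through `√N₁`, so that one local parameter serves both samples. -/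
lemma sqrt_mul_eq_ratio {a b c : ℝ} (ha : 0 < a) (hb : 0 ≤ b) :
    √(b * c) = √(b / a) * √(a * c) := by
  rw [← Real.sqrt_mul (by positivity)]
  congr 1
  field_simp

/-- The asymptotic lower bound for the two-sample log-likelihood ratio of weights which satisfy
the estimating equations near the true parameters. -/
lemma le_negTwoLog_add (hx : GoodSample l g PX θx₀ n₁ m xs) (hy : GoodSample l g PY θy₀ n₂ m ys)
    (hMx : RegularModel g PX Ux θx₀) (hMy : RegularModel g PY Uy θy₀)
    {ρ : ℝ} (hρ : Tendsto (fun a => √((n₂ a : ℝ) / n₁ a)) l (𝓝 ρ))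
    {A M : Vec p →L[ℝ] Vec p} (hA : ∀ v, ρ • A (meanJacobian g PY θy₀ v) = meanJacobian g PX θx₀ v)
    (hM : ∀ v, momentOp g PX θx₀ (M.adjoint (M v)) +
      A (momentOp g PY θy₀ (A.adjoint (M.adjoint (M v)))) = v)
    {θ : α → Vec p} {C : ℝ} (hθ : ∀ᶠ a in l, √((n₁ a : ℝ) * m a) * ‖θ a - θx₀‖ ≤ C)
    {w : ∀ a, Fin (n₁ a) → ℝ} (hw : ∀ᶠ a in l, IsRelWeight (w a))
    (hwθ : ∀ᶠ a in l, groupAvg (w a) (xs a) (fun y => g y (θ a)) = 0)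
    {u : ∀ a, Fin (n₂ a) → ℝ} (hu : ∀ᶠ a in l, IsRelWeight (u a))
    (huθ : ∀ᶠ a in l, groupAvg (u a) (ys a) (fun y => g y (θ a + (θy₀ - θx₀))) = 0)
    {ε : ℝ} (hε : 0 < ε) :
    ∀ᶠ a in l, ‖M (contrast g θx₀ θy₀ A (xs a) (ys a))‖ ^ 2 - ε ≤
      negTwoLog (w a) + negTwoLog (u a) := by
  set D : α → Vec p := fun a => contrast g θx₀ θy₀ A (xs a) (ys a) with hD
  -- `κ = (Vx + A Vy A')⁻¹ D` is the optimal multiplier. Pairing it with `κ' = -A' κ` cancels the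
  -- unknown local parameter, since `ρ A Jy = Jx`.
  set κ : α → Vec p := fun a => M.adjoint (M (D a)) with hκ
  set κ' : α → Vec p := fun a => -A.adjoint (κ a) with hκ'
  have hDO : D =O[l] (fun _ => (1 : ℝ)) := hx.bounded.sub (isBigO_one_clm hy.bounded A)
  have hκO : κ =O[l] (fun _ => (1 : ℝ)) := isBigO_one_clm (isBigO_one_clm hDO M) _
  have hκ'O : κ' =O[l] (fun _ => (1 : ℝ)) := (isBigO_one_clm hκO _).neg_left
  set h₁ : α → Vec p := fun a => √((n₁ a : ℝ) * m a) • (θ a - θx₀) with hh₁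
  have hh₁O : h₁ =O[l] (fun _ => (1 : ℝ)) := by
    refine Asymptotics.IsBigO.of_bound C (hθ.mono fun a ha => ?_)
    simpa [hh₁, norm_smul, abs_of_nonneg (Real.sqrt_nonneg _)] using ha
  have hθy_eq : ∀ a, θ a + (θy₀ - θx₀) - θy₀ = θ a - θx₀ := fun a => by abel
  have hh₂ : ∀ᶠ a in l, √((n₂ a : ℝ) * m a) • (θ a + (θy₀ - θx₀) - θy₀) =
      √((n₂ a : ℝ) / n₁ a) • h₁ a := by
    filter_upwards [hx.law.n_tendsto.eventually_gt_atTop 0] with a ha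
    rw [hθy_eq, sqrt_mul_eq_ratio (Nat.cast_pos.2 ha) (Nat.cast_nonneg _), mul_smul]
  have hθy : ∀ᶠ a in l, √((n₂ a : ℝ) * m a) * ‖θ a + (θy₀ - θx₀) - θy₀‖ ≤ (|ρ| + 1) * |C| := by
    filter_upwards [hx.law.n_tendsto.eventually_gt_atTop 0, hθ,
      hρ.eventually (gt_mem_nhds (show ρ < |ρ| + 1 by linarith [le_abs_self ρ]))] with a ha h1 h2
    rw [hθy_eq, sqrt_mul_eq_ratio (Nat.cast_pos.2 ha) (Nat.cast_nonneg _), mul_assoc]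
    exact mul_le_mul h2.le (h1.trans (le_abs_self C)) (by positivity) (by positivity)
  have L1 := hx.le_negTwoLog hMx hθ hκO hw hwθ (show 0 < ε / 3 by positivity)
  have L2 := hy.le_negTwoLog hMy hθy hκ'O hu huθ (show 0 < ε / 3 by positivity)
  have R1 := hx.law.normSum_sub_tendsto hMx.isOpen hMx.mem hMx.regularOn hMx.integrable_fderiv hθ
  have R2 := hy.law.normSum_sub_tendsto hMy.isOpen hMy.mem hMy.regularOn hMy.integrable_fderiv hθy
  have E1 := isLittleO_one_inner hκO R1
  have E2 := isLittleO_one_inner hκ'O R2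
  have E3 : Tendsto (fun a => ⟪κ' a, (√((n₂ a : ℝ) / n₁ a) - ρ) •
      meanJacobian g PY θy₀ (h₁ a)⟫) l (𝓝 0) :=
    isLittleO_one_inner hκ'O (tendsto_smul_isBigO_one (isBigO_one_clm hh₁O _)
      (by simpa using hρ.sub_const ρ))
  -- The linearization errors enter the dual bounds with factor two: `2 ε / 6` here and `ε / 3` from
  -- each of `L1` and `L2` add up to `ε`.
  have E := ((E1.add E2).add E3).eventually
    (lt_mem_nhds (show -(ε / 6) < 0 + 0 + 0 by linarith))
  filter_upwards [L1, L2, E, hh₂] with a L1 L2 E hh₂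
  rw [hh₂] at E
  have e1 : ⟪κ' a, ρ • meanJacobian g PY θy₀ (h₁ a)⟫ = -⟪κ a, meanJacobian g PX θx₀ (h₁ a)⟫ := by
    rw [← hA, hκ', inner_neg_left, ContinuousLinearMap.adjoint_inner_left, map_smul]
  have e2 : ⟪κ' a, normSum g θy₀ (ys a)⟫ = -⟪κ a, A (normSum g θy₀ (ys a))⟫ := by
    rw [hκ', inner_neg_left, ContinuousLinearMap.adjoint_inner_left]
  have e3 : ⟪κ a, D a⟫ = ‖M (D a)‖ ^ 2 := by
    simp only [hκ]
    rw [ContinuousLinearMap.adjoint_inner_left, real_inner_self_eq_norm_sq]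
  have e4 : ⟪momentOp g PX θx₀ (κ a), κ a⟫ + ⟪momentOp g PY θy₀ (κ' a), κ' a⟫ = ⟪κ a, D a⟫ := by
    simp only [hκ', map_neg, inner_neg_neg]
    have h5 : momentOp g PX θx₀ (κ a) + A (momentOp g PY θy₀ (A.adjoint (κ a))) = D a := hM (D a)
    rw [ContinuousLinearMap.adjoint_inner_right A, ← inner_add_left, h5, real_inner_comm]
  have e5 : ⟪κ a, D a⟫ = ⟪κ a, normSum g θx₀ (xs a)⟫ - ⟪κ a, A (normSum g θy₀ (ys a))⟫ := by
    simp only [hD, contrast, inner_sub_right]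
  change ‖M (D a)‖ ^ 2 - ε ≤ _
  change -(ε / 6) < ⟪κ a, _ - (_ + meanJacobian g PX θx₀ (h₁ a))⟫ + _ + _ at E
  simp only [inner_sub_right, inner_add_right, inner_smul_right, sub_smul, map_smul] at E e1
  linarith

/-- The asymptotic upper bound for the least two-sample log-likelihood ratio. -/
lemma exists_negTwoLog_add_le (hx : GoodSample l g PX θx₀ n₁ m xs)
    (hy : GoodSample l g PY θy₀ n₂ m ys)
    (hMx : RegularModel g PX Ux θx₀) (hMy : RegularModel g PY Uy θy₀)
    {ρ : ℝ} (hρ : Tendsto (fun a => √((n₂ a : ℝ) / n₁ a)) l (𝓝 ρ)) (hρ0 : ρ ≠ 0)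
    {A M : Vec p →L[ℝ] Vec p} (hA : ∀ v, ρ • A (meanJacobian g PY θy₀ v) = meanJacobian g PX θx₀ v)
    (hM : ∀ v, momentOp g PX θx₀ (M.adjoint (M v)) +
      A (momentOp g PY θy₀ (A.adjoint (M.adjoint (M v)))) = v)
    {Kx Ky : Set (Vec p)} (hKx : Kx ∈ 𝓝 θx₀) (hKy : Ky ∈ 𝓝 θy₀)
    {ε : ℝ} (hε : 0 < ε) :
    ∀ᶠ a in l, ∃ θ ∈ Kx, θ + (θy₀ - θx₀) ∈ Ky ∧ ∃ (w : Fin (n₁ a) → ℝ) (u : Fin (n₂ a) → ℝ),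
      IsRelWeight w ∧ IsRelWeight u ∧ groupAvg w (xs a) (fun y => g y θ) = 0 ∧
      groupAvg u (ys a) (fun y => g y (θ + (θy₀ - θx₀))) = 0 ∧
      negTwoLog w + negTwoLog u ≤ ‖M (contrast g θx₀ θy₀ A (xs a) (ys a))‖ ^ 2 + ε := by
  set D : α → Vec p := fun a => contrast g θx₀ θy₀ A (xs a) (ys a) with hD
  set κ : α → Vec p := fun a => M.adjoint (M (D a)) with hκ
  set κ' : α → Vec p := fun a => -A.adjoint (κ a) with hκ'
  have hDO : D =O[l] (fun _ => (1 : ℝ)) := hx.bounded.sub (isBigO_one_clm hy.bounded A)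
  have hκO : κ =O[l] (fun _ => (1 : ℝ)) := isBigO_one_clm (isBigO_one_clm hDO M) _
  have hκ'O : κ' =O[l] (fun _ => (1 : ℝ)) := (isBigO_one_clm hκO _).neg_left
  set Jx := meanJacobian g PX θx₀ with hJx
  set Jy := meanJacobian g PY θy₀ with hJy
  let e : Vec p ≃L[ℝ] Vec p := (LinearEquiv.ofInjectiveEndo
    (Jx : Vec p →ₗ[ℝ] Vec p) hMx.injective_jacobian).toContinuousLinearEquiv
  have he : ∀ v, Jx (e.symm v) = v := fun v => e.apply_symm_apply v
  -- The minimizing local parameter: it is chosen so that `Sx + Jx h₁ = Vx κ`.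
  set h₁ : α → Vec p := fun a => e.symm (momentOp g PX θx₀ (κ a) - normSum g θx₀ (xs a)) with hh₁
  have hh₁O : h₁ =O[l] (fun _ => (1 : ℝ)) :=
    isBigO_one_clm ((isBigO_one_clm hκO _).sub hx.bounded) (e.symm : Vec p →L[ℝ] Vec p)
  -- `ρ A Jy = Jx` is onto, so `A` is onto and hence injective; the equation for the second sample
  -- may therefore be checked after applying `A`.
  have hAinj : Function.Injective A := by
    have hsurj : Function.Surjective A := fun v => ⟨ρ • Jy (e.symm v), by
      rw [map_smul, hA, he]⟩
    exact LinearMap.injective_iff_surjective (f := (A : Vec p →ₗ[ℝ] Vec p)) |>.2 hsurj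
  -- The same local parameter also balances the second sample: after `A` this is the defining
  -- equation `Vx κ + A Vy A' κ = D`.
  have hbal : ∀ a, normSum g θy₀ (ys a) + ρ • Jy (h₁ a) = momentOp g PY θy₀ (κ' a) := fun a => by
    apply hAinj
    have h1 := hM (D a)
    rw [map_add, map_smul, hA]
    simp only [hh₁, he, hκ', map_neg]
    rw [← eq_sub_iff_add_eq'] at h1
    rw [h1]
    simp only [hD, contrast, hκ]
    abel
  set θ : α → Vec p := fun a => θx₀ + (√((n₁ a : ℝ) * m a))⁻¹ • h₁ a with hθ_def
  have hθ_eq : ∀ᶠ a in l, √((n₁ a : ℝ) * m a) • (θ a - θx₀) = h₁ a := by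
    filter_upwards [hx.law.tendsto_sqrt_mul.eventually_gt_atTop 0] with a ha
    simp only [hθ_def, add_sub_cancel_left, smul_smul, mul_inv_cancel₀ ha.ne', one_smul]
  obtain ⟨C, hC⟩ := hh₁O.bound
  have hθ : ∀ᶠ a in l, √((n₁ a : ℝ) * m a) * ‖θ a - θx₀‖ ≤ C := by
    filter_upwards [hC, hθ_eq] with a h1 h2
    rw [← h2, norm_smul, Real.norm_of_nonneg (Real.sqrt_nonneg _)] at h1
    simpa using h1
  have hθy_eq : ∀ a, θ a + (θy₀ - θx₀) - θy₀ = θ a - θx₀ := fun a => by abel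
  have hh₂ : ∀ᶠ a in l, √((n₂ a : ℝ) * m a) • (θ a + (θy₀ - θx₀) - θy₀) =
      √((n₂ a : ℝ) / n₁ a) • h₁ a := by
    filter_upwards [hx.law.n_tendsto.eventually_gt_atTop 0, hθ_eq] with a ha h1
    rw [hθy_eq, sqrt_mul_eq_ratio (Nat.cast_pos.2 ha) (Nat.cast_nonneg _), mul_smul, h1]
  have hθy : ∀ᶠ a in l, √((n₂ a : ℝ) * m a) * ‖θ a + (θy₀ - θx₀) - θy₀‖ ≤ (|ρ| + 1) * |C| := by
    filter_upwards [hx.law.n_tendsto.eventually_gt_atTop 0, hθ,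
      hρ.eventually (gt_mem_nhds (show ρ < |ρ| + 1 by linarith [le_abs_self ρ]))] with a ha h1 h2
    rw [hθy_eq, sqrt_mul_eq_ratio (Nat.cast_pos.2 ha) (Nat.cast_nonneg _), mul_assoc]
    exact mul_le_mul h2.le (h1.trans (le_abs_self C)) (by positivity) (by positivity)
  have R1 := hx.law.normSum_sub_tendsto hMx.isOpen hMx.mem hMx.regularOn hMx.integrable_fderiv hθ
  have R2 := hy.law.normSum_sub_tendsto hMy.isOpen hMy.mem hMy.regularOn hMy.integrable_fderiv hθy
  have T1 : Tendsto (fun a => normSum g (θ a) (xs a) - momentOp g PX θx₀ (κ a)) l (𝓝 0) := by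
    refine R1.congr' ?_
    filter_upwards [hθ_eq] with a ha
    rw [ha, ← hJx]
    simp only [hh₁, he]
    abel
  have T2 : Tendsto (fun a => normSum g (θ a + (θy₀ - θx₀)) (ys a) - momentOp g PY θy₀ (κ' a)) l
      (𝓝 0) := by
    have h1 := R2.add (tendsto_smul_isBigO_one (isBigO_one_clm hh₁O Jy)
      (r := fun a => √((n₂ a : ℝ) / n₁ a) - ρ) (by simpa using hρ.sub_const ρ))
    rw [add_zero] at h1
    refine h1.congr' ?_
    filter_upwards [hh₂] with a ha
    rw [ha, ← hJy, ← hbal, map_smul, sub_smul]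
    abel
  obtain ⟨δx, hδx, hδKx⟩ := Metric.nhds_basis_closedBall.mem_iff.1 hKx
  obtain ⟨δy, hδy, hδKy⟩ := Metric.nhds_basis_closedBall.mem_iff.1 hKy
  filter_upwards [hx.exists_negTwoLog_le hMx hθ hκO T1 (half_pos hε),
    hy.exists_negTwoLog_le hMy hθy hκ'O T2 (half_pos hε),
    hx.law.localized_of_rate hθ hδx, hy.law.localized_of_rate hθy hδy]
    with a ⟨w, hw, hw0, hwle⟩ ⟨u, hu, hu0, hule⟩ h1 h2
  refine ⟨θ a, hδKx h1, hδKy h2, w, u, hw, hu, hw0, hu0, ?_⟩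
  have e3 : ⟪κ a, D a⟫ = ‖M (D a)‖ ^ 2 := by
    simp only [hκ]
    rw [ContinuousLinearMap.adjoint_inner_left, real_inner_self_eq_norm_sq]
  have e4 : ⟪momentOp g PX θx₀ (κ a), κ a⟫ + ⟪momentOp g PY θy₀ (κ' a), κ' a⟫ = ⟪κ a, D a⟫ := by
    simp only [hκ', map_neg, inner_neg_neg]
    have h5 : momentOp g PX θx₀ (κ a) + A (momentOp g PY θy₀ (A.adjoint (κ a))) = D a := hM (D a)
    rw [ContinuousLinearMap.adjoint_inner_right A, ← inner_add_left, h5, real_inner_comm]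
  change _ ≤ ‖M (D a)‖ ^ 2 + ε
  linarith

end TwoSample

/-! ### The log-likelihood ratio in terms of relative weights -/

section Ratio

variable {d p n₁ n₂ m : ℕ} {g : Vec d → Vec p → Vec p} {Θx Θy : Set (Vec p)} {π : Vec p}
  {x : Fin n₁ → Fin m → Vec d} {y : Fin n₂ → Fin m → Vec d}

lemma EReal.neg_two_mul_div_le_iff {L : EReal} {m : ℕ} (hm : 0 < m) {t : ℝ} :
    -2 * L / (m : EReal) ≤ (t : EReal) ↔ ((-(m * t) / 2 : ℝ) : EReal) ≤ L := by
  have hm0 : (0 : EReal) < (m : EReal) := by exact_mod_cast hm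
  have hm' : (m : EReal) ≠ ⊤ := EReal.natCast_ne_top m
  rw [EReal.div_le_iff_le_mul hm0 hm']
  have e2 : (-2 : EReal) = ((-2 : ℝ) : EReal) := by rw [EReal.coe_neg]; rfl
  have em : (m : EReal) = ((m : ℝ) : EReal) := by norm_cast
  rw [e2, em, ← EReal.coe_mul]
  induction L with
  | bot =>
    rw [EReal.coe_mul_bot_of_neg (by norm_num)]
    simp only [top_le_iff, le_bot_iff, EReal.coe_ne_top, EReal.coe_ne_bot]
  | top =>
    rw [EReal.coe_mul_top_of_neg (by norm_num)]
    simp only [bot_le, le_top]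
  | coe L =>
    rw [← EReal.coe_mul, EReal.coe_le_coe_iff, EReal.coe_le_coe_iff]
    constructor <;> intro h <;> linarith

lemma gelLogRatio_div_le_iff (hm : 0 < m) {t : ℝ} :
    gelLogRatio g Θx Θy π x y / (m : EReal) ≤ (t : EReal) ↔
      ENNReal.ofReal (Real.exp (-(m * t) / 2)) ≤ gelRatio g Θx Θy π x y := by
  rw [gelLogRatio, EReal.neg_two_mul_div_le_iff hm, ← ENNReal.log_le_log_iff,
    ENNReal.log_ofReal_of_pos (Real.exp_pos _), Real.log_exp]

lemma solvesWeighted_iff {n : ℕ} (hn : 0 < n) (hm : 0 < m) {x : Fin n → Fin m → Vec d}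
    {w v : Fin n → ℝ} (hwv : ∀ i, (m : ℝ) * n * v i = w i) {θ : Vec p} :
    SolvesWeighted g v x θ ↔ groupAvg w x (fun y => g y θ) = 0 := by
  have hn' : (0 : ℝ) < n := Nat.cast_pos.2 hn
  have hm' : (0 : ℝ) < m := Nat.cast_pos.2 hm
  have e : groupAvg w x (fun y => g y θ) = ∑ i, v i • ∑ k, g (x i k) θ := by
    rw [groupAvg, Finset.smul_sum]
    refine Finset.sum_congr rfl fun i _ => ?_
    rw [smul_smul, ← hwv i]
    congr 1
    field_simp
  rw [e, SolvesWeighted]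

lemma isRelWeight_iff {n : ℕ} (hn : 0 < n) (hm : 0 < m) {w v : Fin n → ℝ}
    (hwv : ∀ i, (m : ℝ) * n * v i = w i) :
    IsRelWeight w ↔ IsGroupWeight m v ∧ ∀ i, 0 < v i := by
  have hn' : (0 : ℝ) < n := Nat.cast_pos.2 hn
  have hm' : (0 : ℝ) < m := Nat.cast_pos.2 hm
  have h1 : (∑ i, w i = n) ↔ ∑ i, v i = 1 / (m : ℝ) := by
    rw [← Finset.sum_congr rfl fun i _ => hwv i, ← Finset.mul_sum, eq_div_iff hm'.ne']
    constructor
    · intro h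
      have : (n : ℝ) * (∑ i, v i * m) = n * 1 := by rw [← Finset.sum_mul]; linarith
      rw [← Finset.sum_mul] at this
      exact mul_left_cancel₀ hn'.ne' this
    · intro h
      linear_combination (n : ℝ) * h
  have h2 : (∀ i, 0 < w i) ↔ ∀ i, 0 < v i := by
    refine forall_congr' fun i => ?_
    rw [← hwv i]
    exact mul_pos_iff_of_pos_left (mul_pos hm' hn')
  rw [IsRelWeight, IsGroupWeight, h1, h2]
  exact ⟨fun h => ⟨⟨fun i => (h.1 i).le, h.2⟩, h.1⟩, fun h => ⟨h.2, h.1.2⟩⟩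

/-- The exponent `m` becomes a factor of the log-likelihood ratio, which the normalization by `m`
removes. -/
lemma prod_pow_eq_exp {n m : ℕ} {w : Fin n → ℝ} (hw : ∀ i, 0 < w i) :
    ∏ i, w i ^ m = Real.exp (-(m * negTwoLog w) / 2) := by
  have : -(m * negTwoLog w) / 2 = ∑ i, m * Real.log (w i) := by
    rw [negTwoLog, ← Finset.mul_sum]; ring
  rw [this, Real.exp_sum]
  refine Finset.prod_congr rfl fun i _ => ?_
  rw [mul_comm, Real.exp_mul, Real.exp_log (hw i), Real.rpow_natCast]

lemma gelLogRatio_div_le (hn₁ : 0 < n₁) (hn₂ : 0 < n₂) (hm : 0 < m) {w : Fin n₁ → ℝ}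
    {u : Fin n₂ → ℝ} {θx θy : Vec p} (hw : IsRelWeight w) (hu : IsRelWeight u)
    (hθx : θx ∈ Θx) (hθy : θy ∈ Θy) (hwx : groupAvg w x (fun y => g y θx) = 0)
    (huy : groupAvg u y (fun y => g y θy) = 0) (hπ : θy - θx = π) {t : ℝ}
    (ht : negTwoLog w + negTwoLog u ≤ t) :
    gelLogRatio g Θx Θy π x y / (m : EReal) ≤ (t : EReal) := by
  rw [gelLogRatio_div_le_iff hm]
  have hm' : (0 : ℝ) < m := Nat.cast_pos.2 hm
  have h1 : ∀ i, (m : ℝ) * n₁ * (w i / (m * n₁)) = w i := fun i =>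
    mul_div_cancel₀ _ (by positivity)
  have h2 : ∀ i, (m : ℝ) * n₂ * (u i / (m * n₂)) = u i := fun i =>
    mul_div_cancel₀ _ (by positivity)
  refine le_trans ?_ (le_sSup ⟨fun i => w i / (m * n₁), fun i => u i / (m * n₂), θx, θy,
    ((isRelWeight_iff hn₁ hm h1).1 hw).1, ((isRelWeight_iff hn₂ hm h2).1 hu).1, hθx, hθy,
    (solvesWeighted_iff hn₁ hm h1).2 hwx, (solvesWeighted_iff hn₂ hm h2).2 huy, hπ, rfl⟩)
  simp only [h1, h2]
  rw [prod_pow_eq_exp hw.1, prod_pow_eq_exp hu.1, ← Real.exp_add]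
  refine ENNReal.ofReal_le_ofReal (Real.exp_le_exp.2 ?_)
  nlinarith

/-- The supremum need not be attained, which explains the slack `t < s`. A vanishing weight would
make the product zero since `m > 0`, so nearly optimal weights are positive. -/
lemma exists_of_gelLogRatio_div_le (hn₁ : 0 < n₁) (hn₂ : 0 < n₂) (hm : 0 < m) {t s : ℝ}
    (ht : gelLogRatio g Θx Θy π x y / (m : EReal) ≤ (t : EReal)) (hts : t < s) :
    ∃ (w : Fin n₁ → ℝ) (u : Fin n₂ → ℝ), ∃ θx ∈ Θx, ∃ θy ∈ Θy, IsRelWeight w ∧ IsRelWeight u ∧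
      groupAvg w x (fun y => g y θx) = 0 ∧ groupAvg u y (fun y => g y θy) = 0 ∧ θy - θx = π ∧
      negTwoLog w + negTwoLog u ≤ s := by
  rw [gelLogRatio_div_le_iff hm] at ht
  have hm' : (0 : ℝ) < m := Nat.cast_pos.2 hm
  have h1 : ENNReal.ofReal (Real.exp (-(m * s) / 2)) < gelRatio g Θx Θy π x y := by
    refine lt_of_lt_of_le ?_ ht
    rw [ENNReal.ofReal_lt_ofReal_iff (Real.exp_pos _), Real.exp_lt_exp]
    nlinarith
  obtain ⟨r, ⟨v, w, θx, θy, hv, hw, hθx, hθy, hvx, hwy, hπ, rfl⟩, hr⟩ := lt_sSup_iff.1 h1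
  have hpos := ENNReal.ofReal_pos.1 (lt_of_le_of_lt bot_le hr)
  have hv0 : ∀ i, 0 < v i := fun i => by
    refine lt_of_le_of_ne (hv.1 i) fun h => hpos.ne' ?_
    rw [Finset.prod_eq_zero (Finset.mem_univ i), zero_mul]
    rw [← h, mul_zero, zero_pow hm.ne']
  have hw0 : ∀ i, 0 < w i := fun i => by
    refine lt_of_le_of_ne (hw.1 i) fun h => hpos.ne' ?_
    rw [Finset.prod_eq_zero (Finset.mem_univ i), mul_zero]
    rw [← h, mul_zero, zero_pow hm.ne']
  have hw' := (isRelWeight_iff hn₁ hm (w := fun i => m * n₁ * v i) fun i => rfl).2 ⟨hv, hv0⟩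
  have hu' := (isRelWeight_iff hn₂ hm (w := fun i => m * n₂ * w i) fun i => rfl).2 ⟨hw, hw0⟩
  refine ⟨fun i => m * n₁ * v i, fun i => m * n₂ * w i, θx, hθx, θy, hθy, hw', hu',
    (solvesWeighted_iff hn₁ hm fun i => rfl).1 hvx, (solvesWeighted_iff hn₂ hm fun i => rfl).1 hwy,
    hπ, ?_⟩
  rw [ENNReal.ofReal_lt_ofReal_iff hpos, prod_pow_eq_exp (w := fun i => m * n₁ * v i) hw'.1,
    prod_pow_eq_exp (w := fun i => m * n₂ * w i) hu'.1, ← Real.exp_add, Real.exp_lt_exp] at hr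
  nlinarith

end Ratio

/-! ### Square roots of inverse covariance operators. -/

section Whitening

open scoped RealInnerProductSpace

variable {E : Type*} [NormedAddCommGroup E] [InnerProductSpace ℝ E] [FiniteDimensional ℝ E]
  [CompleteSpace E]

/-- A positive definite operator has an inverse of the form `M' M`. -/
lemma exists_whitening {T : E →L[ℝ] E} (hT : ∀ u v, ⟪T u, v⟫ = ⟪u, T v⟫)
    (hpos : ∀ v, v ≠ 0 → 0 < ⟪T v, v⟫) : ∃ M : E →L[ℝ] E, ∀ v, T (M.adjoint (M v)) = v := by
  have hsym : (T : E →ₗ[ℝ] E).IsSymmetric := fun u v => hT u v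
  set b := hsym.eigenvectorBasis rfl with hb
  set ev := hsym.eigenvalues rfl with hev
  have hTb : ∀ i, T (b i) = ev i • b i := fun i => hsym.apply_eigenvectorBasis rfl i
  have hev0 : ∀ i, 0 < ev i := fun i => by
    have h := hpos (b i) (b.orthonormal.ne_zero i)
    rw [hTb, inner_smul_left, real_inner_self_eq_norm_sq, b.norm_eq_one] at h
    simpa using h
  -- The self-adjoint inverse square root, in an orthonormal eigenbasis.
  refine ⟨∑ i, (√(ev i))⁻¹ • InnerProductSpace.rankOne ℝ (b i) (b i), fun v => ?_⟩
  have hadj : (∑ i, (√(ev i))⁻¹ • InnerProductSpace.rankOne ℝ (b i) (b i)).adjoint =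
      ∑ i, (√(ev i))⁻¹ • InnerProductSpace.rankOne ℝ (b i) (b i) := by
    rw [map_sum]
    refine Finset.sum_congr rfl fun i _ => ?_
    rw [LinearIsometryEquiv.map_smulₛₗ, InnerProductSpace.adjoint_rankOne]
    simp
  have happ : ∀ v, (∑ i, (√(ev i))⁻¹ • InnerProductSpace.rankOne ℝ (b i) (b i)) v =
      ∑ i, ((√(ev i))⁻¹ * ⟪b i, v⟫) • b i := fun v => by
    simp [sum_apply, smul_smul]
  have hin : ∀ j, ⟪b j, ∑ i, ((√(ev i))⁻¹ * ⟪b i, v⟫) • b i⟫ = (√(ev j))⁻¹ * ⟪b j, v⟫ := fun j => by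
    rw [inner_sum, Finset.sum_eq_single j]
    · rw [inner_smul_right, real_inner_self_eq_norm_sq, b.norm_eq_one]; simp
    · intro i _ hij
      rw [inner_smul_right, b.orthonormal.2 hij.symm, mul_zero]
    · simp
  rw [hadj, happ v, happ]
  simp only [hin, map_sum, map_smul, hTb, smul_smul]
  conv_rhs => rw [← b.sum_repr' v]
  refine Finset.sum_congr rfl fun i _ => ?_
  congr 1
  have h1 : √(ev i) ≠ 0 := (Real.sqrt_pos.2 (hev0 i)).ne'
  have h2 := Real.sq_sqrt (hev0 i).le
  field_simp
  rw [h2, mul_comm]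

end Whitening

/-! ### Asymptotic equivalence of the statistic and a quadratic form -/

section Equivalence

variable {α : Type*} {d p : ℕ} {l : Filter α} {PX PY : Measure (Vec d)}
  {g : Vec d → Vec p → Vec p} {Ux Uy Θx Θy : Set (Vec p)} {θx₀ θy₀ : Vec p} {n₁ n₂ m : α → ℕ}
  {xs : ∀ a, Fin (n₁ a) → Fin (m a) → Vec d} {ys : ∀ a, Fin (n₂ a) → Fin (m a) → Vec d}
  {ρ : ℝ} {A M : Vec p →L[ℝ] Vec p}

lemma gelLogRatio_div_le_of_good (hx : GoodSample l g PX θx₀ n₁ m xs)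
    (hy : GoodSample l g PY θy₀ n₂ m ys)
    (hMx : RegularModel g PX Ux θx₀) (hMy : RegularModel g PY Uy θy₀)
    (hρ : Tendsto (fun a => √((n₂ a : ℝ) / n₁ a)) l (𝓝 ρ)) (hρ0 : ρ ≠ 0)
    (hA : ∀ v, ρ • A (meanJacobian g PY θy₀ v) = meanJacobian g PX θx₀ v)
    (hM : ∀ v, momentOp g PX θx₀ (M.adjoint (M v)) +
      A (momentOp g PY θy₀ (A.adjoint (M.adjoint (M v)))) = v)
    (hΘx : Θx ∈ 𝓝 θx₀) (hΘy : Θy ∈ 𝓝 θy₀) {ε : ℝ} (hε : 0 < ε) (t : ℝ) :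
    ∀ᶠ a in l, ‖M (contrast g θx₀ θy₀ A (xs a) (ys a))‖ ^ 2 ≤ t - ε →
      gelLogRatio g Θx Θy (θy₀ - θx₀) (xs a) (ys a) / (m a : EReal) ≤ (t : EReal) := by
  filter_upwards [exists_negTwoLog_add_le hx hy hMx hMy hρ hρ0 hA hM hΘx hΘy hε,
    hx.law.n_tendsto.eventually_gt_atTop 0, hy.law.n_tendsto.eventually_gt_atTop 0]
    with a ⟨θ, hθx, hθy, w, u, hw, hu, hw0, hu0, hle⟩ h1 h2 ht
  exact gelLogRatio_div_le h1 h2 (hx.law.m_pos a) hw hu hθx hθy hw0 hu0 (by abel) (by linarith)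

/-- Solutions of the weighted estimating equation in `Θ` are consistent, along every filter finer
than `l`. -/
def Consistent (l : Filter α) (g : Vec d → Vec p → Vec p) (θ₀ : Vec p) (Θ : Set (Vec p))
    (n m : α → ℕ) (x : ∀ a, Fin (n a) → Fin (m a) → Vec d) : Prop :=
  ∀ l' ≤ l, ∀ (t : ℝ) (w : ∀ a, Fin (n a) → ℝ) (θ : α → Vec p), LevelLE l' n t w →
    (∀ᶠ a in l', θ a ∈ Θ) → (∀ᶠ a in l', groupAvg (w a) (x a) (fun y => g y (θ a)) = 0) →
    ∀ δ > 0, ∀ᶠ a in l', θ a ∈ Metric.closedBall θ₀ δ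

/-- Along the filter restricted to the indices where the statistic is at most `t`, nearly optimal
weights and solutions can be selected. Their level is bounded, so consistency gives the rate, and
the rate admits the asymptotic lower bound. -/
lemma le_of_gelLogRatio_div_le (hx : GoodSample l g PX θx₀ n₁ m xs)
    (hy : GoodSample l g PY θy₀ n₂ m ys)
    (hMx : RegularModel g PX Ux θx₀) (hMy : RegularModel g PY Uy θy₀)
    (hρ : Tendsto (fun a => √((n₂ a : ℝ) / n₁ a)) l (𝓝 ρ))
    (hA : ∀ v, ρ • A (meanJacobian g PY θy₀ v) = meanJacobian g PX θx₀ v)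
    (hM : ∀ v, momentOp g PX θx₀ (M.adjoint (M v)) +
      A (momentOp g PY θy₀ (A.adjoint (M.adjoint (M v)))) = v)
    (hcons : Consistent l g θx₀ Θx n₁ m xs) {ε : ℝ} (hε : 0 < ε) (t : ℝ) :
    ∀ᶠ a in l, gelLogRatio g Θx Θy (θy₀ - θx₀) (xs a) (ys a) / (m a : EReal) ≤ (t : EReal) →
      ‖M (contrast g θx₀ θy₀ A (xs a) (ys a))‖ ^ 2 ≤ t + ε := by
  set l' := l ⊓ 𝓟 {a | gelLogRatio g Θx Θy (θy₀ - θx₀) (xs a) (ys a) / (m a : EReal) ≤ (t : EReal)}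
    with hl'
  suffices H : ∀ᶠ a in l', ‖M (contrast g θx₀ θy₀ A (xs a) (ys a))‖ ^ 2 ≤ t + ε from
    eventually_inf_principal.1 H
  have hle : l' ≤ l := inf_le_left
  have hx' : GoodSample l' g PX θx₀ n₁ m xs := hx.comp hle
  have hy' : GoodSample l' g PY θy₀ n₂ m ys := hy.comp hle
  have hex : ∀ᶠ a in l', ∃ q : (Fin (n₁ a) → ℝ) × (Fin (n₂ a) → ℝ) × Vec p, IsRelWeight q.1 ∧
      IsRelWeight q.2.1 ∧ q.2.2 ∈ Θx ∧ groupAvg q.1 (xs a) (fun y => g y q.2.2) = 0 ∧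
      groupAvg q.2.1 (ys a) (fun y => g y (q.2.2 + (θy₀ - θx₀))) = 0 ∧
      negTwoLog q.1 + negTwoLog q.2.1 ≤ t + ε / 2 := by
    filter_upwards [mem_inf_of_right (mem_principal_self _),
      hx'.law.n_tendsto.eventually_gt_atTop 0, hy'.law.n_tendsto.eventually_gt_atTop 0]
      with a ha h1 h2
    obtain ⟨w, u, θx, hθx, θy, hθy, hw, hu, hw0, hu0, hπ, hl⟩ := exists_of_gelLogRatio_div_le h1 h2
      (hx.law.m_pos a) ha (show t < t + ε / 2 by linarith)
    refine ⟨(w, u, θx), hw, hu, hθx, hw0, ?_, hl⟩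
    rw [← hπ, add_sub_cancel]
    exact hu0
  -- `choose` needs a value at every index; the property is asked only where some triple has it, and
  -- the zero triple is the default elsewhere.
  have hex' : ∀ a, ∃ q : (Fin (n₁ a) → ℝ) × (Fin (n₂ a) → ℝ) × Vec p,
      (∃ q : (Fin (n₁ a) → ℝ) × (Fin (n₂ a) → ℝ) × Vec p, IsRelWeight q.1 ∧
      IsRelWeight q.2.1 ∧ q.2.2 ∈ Θx ∧ groupAvg q.1 (xs a) (fun y => g y q.2.2) = 0 ∧
      groupAvg q.2.1 (ys a) (fun y => g y (q.2.2 + (θy₀ - θx₀))) = 0 ∧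
      negTwoLog q.1 + negTwoLog q.2.1 ≤ t + ε / 2) → IsRelWeight q.1 ∧
      IsRelWeight q.2.1 ∧ q.2.2 ∈ Θx ∧ groupAvg q.1 (xs a) (fun y => g y q.2.2) = 0 ∧
      groupAvg q.2.1 (ys a) (fun y => g y (q.2.2 + (θy₀ - θx₀))) = 0 ∧
      negTwoLog q.1 + negTwoLog q.2.1 ≤ t + ε / 2 := fun a => by
    by_cases h : ∃ q : (Fin (n₁ a) → ℝ) × (Fin (n₂ a) → ℝ) × Vec p, IsRelWeight q.1 ∧
      IsRelWeight q.2.1 ∧ q.2.2 ∈ Θx ∧ groupAvg q.1 (xs a) (fun y => g y q.2.2) = 0 ∧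
      groupAvg q.2.1 (ys a) (fun y => g y (q.2.2 + (θy₀ - θx₀))) = 0 ∧
      negTwoLog q.1 + negTwoLog q.2.1 ≤ t + ε / 2
    · obtain ⟨q, hq⟩ := h
      exact ⟨q, fun _ => hq⟩
    · exact ⟨(0, 0, 0), fun h' => absurd h' h⟩
  choose q hq using hex'
  have hall := hex.mono fun a ha => hq a ha
  -- The contribution of the second sample is nonnegative, so the total bounds the first.
  have hlev : LevelLE l' n₁ (t + ε / 2) (fun a => (q a).1) := hall.mono fun a ha =>
    ⟨ha.1, by linarith [ha.2.1.negTwoLog_nonneg, ha.2.2.2.2.2]⟩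
  have hloc := hcons l' hle _ _ (fun a => (q a).2.2) hlev (hall.mono fun a ha => ha.2.2.1)
    (hall.mono fun a ha => ha.2.2.2.1)
  obtain ⟨R, hR⟩ := hx'.normSum_le
  obtain ⟨C, hC⟩ := hx'.groups.exists_rate hx'.law hMx.isOpen hMx.mem hMx.regularOn
    hMx.integrable_fderiv hMx.injective_jacobian hR hlev (hall.mono fun a ha => ha.2.2.2.1) hloc
  filter_upwards [le_negTwoLog_add hx' hy' hMx hMy (hρ.mono_left hle) hA hM hC
    (hall.mono fun a ha => ha.1) (hall.mono fun a ha => ha.2.2.2.1)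
    (hall.mono fun a ha => ha.2.1) (hall.mono fun a ha => ha.2.2.2.2.1) (half_pos hε), hall]
    with a h1 h2
  linarith [h2.2.2.2.2.2]

lemma GoodSample.consistent_of_wellDefined (hx : GoodSample l g PX θx₀ n₁ m xs)
    (hMx : RegularModel g PX Ux θx₀) (hwd : ∀ᶠ a in l, SolutionWellDefined g (xs a))
    (Θ : Set (Vec p)) : Consistent l g θx₀ Θ n₁ m xs := by
  intro l' hle t w θ hw _ hθ δ hδ
  have hx' : GoodSample l' g PX θx₀ n₁ m xs := hx.comp hle
  obtain ⟨R, hR⟩ := hx'.normSum_le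
  refine hx'.groups.localized_of_unique hx'.law hMx.isOpen hMx.mem hMx.regularOn
    hMx.integrable_fderiv hMx.injective_jacobian hR hw ?_ hδ
  filter_upwards [hle hwd, hw, hθ, hx'.law.n_tendsto.eventually_gt_atTop 0] with a h1 h2 h3 hn θ' h4
  have hm := hx.law.m_pos a
  have hm' : (0 : ℝ) < m a := Nat.cast_pos.2 hm
  have hn' : (0 : ℝ) < n₁ a := Nat.cast_pos.2 hn
  have e : ∀ i, (m a : ℝ) * n₁ a * (w a i / (m a * n₁ a)) = w a i := fun i =>
    mul_div_cancel₀ _ (by positivity)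
  obtain ⟨h5, h6⟩ := (isRelWeight_iff hn hm e).1 h2.1
  exact h1 _ h5 h6 _ _ ((solvesWeighted_iff hn hm e).2 h4) ((solvesWeighted_iff hn hm e).2 h3)

lemma GoodSample.consistent_of_compact (hx : GoodSample l g PX θx₀ n₁ m xs)
    (hMx : RegularModel g PX Ux θx₀) {K : Set (Vec p)} (hK : IsCompact K) (hKc : Convex ℝ K)
    (hKU : K ⊆ Ux) (hθK : K ∈ 𝓝 θx₀) : Consistent l g θx₀ K n₁ m xs := by
  intro l' hle t w θ hw hθK' hθ δ hδ
  have hx' : GoodSample l' g PX θx₀ n₁ m xs := hx.comp hle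
  exact hx'.law.localized_of_compact hMx.isParameter hMx.measurable hMx.isOpen hMx.regularOn hK hKc
    hKU (mem_of_mem_nhds hθK) hw hθK' hθ hδ

end Equivalence

/-! ### Convergence in probability as convergence along a filter -/

section ProbFilter

variable {Ω : Type*} [MeasurableSpace Ω] {μ : Measure Ω}

/-- The filter of the sequences of events whose probability tends to one. -/
def probFilter (μ : Measure Ω) : Filter (ℕ × Ω) where
  sets := {s | Tendsto (fun k => μ {ω | (k, ω) ∉ s}) atTop (𝓝 0)}
  univ_sets := by simp
  sets_of_superset {s t} hs hst := by
    refine tendsto_of_tendsto_of_tendsto_of_le_of_le tendsto_const_nhds hs (fun _ => zero_le)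
      (fun k => measure_mono fun ω hω h => hω (hst h))
  inter_sets {s t} hs ht := by
    have h := Tendsto.add hs ht
    rw [add_zero] at h
    refine tendsto_of_tendsto_of_tendsto_of_le_of_le tendsto_const_nhds h (fun _ => zero_le)
      (fun k => (measure_mono fun ω hω => ?_).trans (measure_union_le _ _))
    by_contra h'
    simp only [Set.mem_union, Set.mem_ofPred_eq, not_or, not_not] at h'
    exact hω h'

lemma eventually_probFilter {q : ℕ × Ω → Prop} :
    (∀ᶠ a in probFilter μ, q a) ↔ Tendsto (fun k => μ {ω | ¬ q (k, ω)}) atTop (𝓝 0) := Iff.rfl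

lemma eventually_probFilter_of_ae {q : ℕ × Ω → Prop} (h : ∀ k, ∀ᵐ ω ∂μ, q (k, ω)) :
    ∀ᶠ a in probFilter μ, q a := by
  rw [eventually_probFilter]
  refine tendsto_const_nhds.congr fun k => ?_
  exact ((ae_iff.1 (h k))).symm

lemma tendsto_fst_probFilter : Tendsto Prod.fst (probFilter μ) atTop := by
  rw [tendsto_atTop]
  intro K
  rw [eventually_probFilter]
  refine tendsto_const_nhds.congr' ?_
  filter_upwards [eventually_ge_atTop K] with k hk
  simp [hk]

/-- Markov's inequality. -/
lemma tendsto_probFilter_of_integral {f : ℕ × Ω → ℝ} (hf : ∀ k, Integrable (fun ω => f (k, ω)) μ)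
    (h : Tendsto (fun k => ∫ ω, |f (k, ω)| ∂μ) atTop (𝓝 0)) :
    Tendsto f (probFilter μ) (𝓝 0) := by
  rw [Metric.tendsto_nhds]
  intro ε hε
  rw [eventually_probFilter]
  have h1 : Tendsto (fun k => ENNReal.ofReal (ε⁻¹ * ∫ ω, |f (k, ω)| ∂μ)) atTop (𝓝 0) := by
    have := ENNReal.tendsto_ofReal (h.const_mul ε⁻¹)
    simpa using this
  refine tendsto_of_tendsto_of_tendsto_of_le_of_le tendsto_const_nhds h1 (fun _ => zero_le)
    (fun k => ?_)
  have h2 := mul_meas_ge_le_integral_of_nonneg (ae_of_all μ fun ω => abs_nonneg (f (k, ω)))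
    (hf k).abs ε
  have h3 : {ω | ¬ dist (f (k, ω)) 0 < ε} = {ω | ε ≤ |f (k, ω)|} := by
    ext ω; simp
  have hfin : μ {ω | ε ≤ |f (k, ω)|} ≠ ⊤ := ((hf k).abs.measure_ge_lt_top hε).ne
  change μ {ω | ¬ dist (f (k, ω)) 0 < ε} ≤ _
  rw [h3, ← ENNReal.ofReal_toReal hfin]
  refine ENNReal.ofReal_le_ofReal ?_
  rw [le_inv_mul_iff₀ hε]
  exact h2

end ProbFilter

/-! ### A weak law of large numbers for arrays -/

section WeakLaw

variable {Ω : Type*} [MeasurableSpace Ω] {μ : Measure Ω} [IsProbabilityMeasure μ]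

lemma sq_integral_abs_le {f : Ω → ℝ} (hf : MemLp f 2 μ) :
    (∫ ω, |f ω| ∂μ) ^ 2 ≤ ∫ ω, f ω ^ 2 ∂μ := by
  have h := variance_eq_sub hf.abs
  have h0 := variance_nonneg (fun ω => |f ω|) μ
  have h1 : ∫ ω, (|f| ^ 2) ω ∂μ = ∫ ω, f ω ^ 2 ∂μ :=
    integral_congr_ae (ae_of_all _ fun ω => sq_abs (f ω))
  rw [h1] at h
  change Var[fun ω => |f ω|; μ] = _ - (∫ ω, |f ω| ∂μ) ^ 2 at h
  linarith

/-- Truncation of a real number at the level `M`. -/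
def clip (M x : ℝ) : ℝ := max (-M) (min x M)

lemma abs_clip_le {M : ℝ} (hM : 0 ≤ M) (x : ℝ) : |clip M x| ≤ M := by
  rw [clip, abs_le]
  exact ⟨le_max_left _ _, max_le (by linarith) (min_le_right _ _)⟩

lemma abs_sub_clip {M : ℝ} (hM : 0 ≤ M) (x : ℝ) : |x - clip M x| = max (|x| - M) 0 := by
  unfold clip
  rcases le_total x M with h1 | h1
  · rw [min_eq_left h1]
    rcases le_total (-M) x with h2 | h2
    · rw [max_eq_right h2, sub_self, abs_zero, max_eq_right]
      linarith [abs_le.2 ⟨h2, h1⟩]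
    · rw [max_eq_left h2, abs_of_nonpos (by linarith), abs_of_nonpos (by linarith),
        max_eq_left (by linarith)]
      ring
  · rw [min_eq_right h1, max_eq_right (by linarith), abs_of_nonneg (by linarith),
      abs_of_nonneg (by linarith), max_eq_left (by linarith)]

lemma measurable_clip (M : ℝ) : Measurable (clip M) := by
  unfold clip; fun_prop

/-- Truncate at `M`: the centred truncated average has second moment at most `M² / N` by pairwise
independence, and the truncation error costs `τ` once for the variables and once for their means. -/
lemma integral_abs_avg_sub_le {ι : Type*} [Fintype ι] [Nonempty ι] {W : ι → Ω → ℝ} {c : ℝ}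
    (hW : ∀ i, Integrable (W i) μ) (hc : ∀ i, ∫ ω, W i ω ∂μ = c)
    (hind : Pairwise fun i j => IndepFun (W i) (W j) μ) {M τ s : ℝ} (hM : 0 ≤ M) (hs : 0 < s)
    (hτ : ∀ i, ∫ ω, max (|W i ω| - M) 0 ∂μ ≤ τ) :
    ∫ ω, |(Fintype.card ι : ℝ)⁻¹ * ∑ i, W i ω - c| ∂μ ≤
      M ^ 2 / (Fintype.card ι * s) + s + 2 * τ := by
  set N : ℝ := ((Fintype.card ι : ℕ) : ℝ) with hN
  have hN0 : 0 < N := by rw [hN]; exact_mod_cast Fintype.card_pos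
  have hclipm : ∀ i, AEStronglyMeasurable (fun ω => clip M (W i ω)) μ := fun i =>
    ((measurable_clip M).comp_aemeasurable (hW i).aemeasurable).aestronglyMeasurable
  have hclip : ∀ i, MemLp (fun ω => clip M (W i ω)) 2 μ := fun i =>
    MemLp.of_bound (hclipm i) M (ae_of_all _ fun ω => abs_clip_le hM _)
  have hclipi : ∀ i, Integrable (fun ω => clip M (W i ω)) μ := fun i =>
    (hclip i).integrable one_le_two
  have hri : ∀ i, Integrable (fun ω => |W i ω - clip M (W i ω)|) μ := fun i =>
    ((hW i).sub (hclipi i)).abs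
  have hrτ : ∀ i, ∫ ω, |W i ω - clip M (W i ω)| ∂μ ≤ τ := fun i => by
    simp_rw [abs_sub_clip hM]; exact hτ i
  have hτ0 : 0 ≤ τ := (integral_nonneg fun ω => abs_nonneg _).trans (hrτ (Classical.arbitrary ι))
  set S : Ω → ℝ := ∑ i, fun ω => clip M (W i ω) with hS
  have hSm : MemLp S 2 μ := memLp_finsetSum' _ fun i _ => hclip i
  have hvar : Var[S; μ] ≤ N * M ^ 2 := by
    rw [hS, IndepFun.variance_sum (fun i _ => hclip i) (fun i _ j _ hij =>
      (hind hij).comp (measurable_clip M) (measurable_clip M))]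
    have : ∀ i ∈ Finset.univ, Var[fun ω => clip M (W i ω); μ] ≤ M ^ 2 := fun i _ => by
      refine (variance_le_sq_of_bounded (a := -M) (b := M) (ae_of_all _ fun ω => ?_)
        (hclipm i).aemeasurable).trans (le_of_eq (by ring))
      exact abs_le.1 (abs_clip_le hM _)
    refine (Finset.sum_le_card_nsmul _ _ _ this).trans (le_of_eq ?_)
    simp [hN]
  set T : Ω → ℝ := fun ω => N⁻¹ * (S ω - ∫ ω, S ω ∂μ) with hT
  have hSi : Integrable S μ := hSm.integrable one_le_two
  have hTi : Integrable T μ := (hSi.sub (integrable_const _)).const_mul _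
  have hT2 : ∫ ω, T ω ^ 2 ∂μ ≤ M ^ 2 / N := by
    have : ∫ ω, T ω ^ 2 ∂μ = (N⁻¹) ^ 2 * Var[S; μ] := by
      rw [variance_eq_integral hSm.aemeasurable, ← integral_const_mul]
      refine integral_congr_ae (ae_of_all _ fun ω => ?_)
      simp only [hT]; ring
    rw [this]
    calc _ ≤ (N⁻¹) ^ 2 * (N * M ^ 2) := by gcongr
      _ = M ^ 2 / N := by field_simp
  have hTm : MemLp T 2 μ := (hSm.sub (memLp_const _)).const_mul _
  have hTabs : ∫ ω, |T ω| ∂μ ≤ M ^ 2 / (N * s) + s := by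
    have h1 := (sq_integral_abs_le hTm).trans hT2
    have h2 : 0 ≤ ∫ ω, |T ω| ∂μ := integral_nonneg fun ω => abs_nonneg _
    rw [← div_div, div_add' _ _ _ hs.ne', le_div_iff₀ hs]
    -- If `a² ≤ q` then `2 a s ≤ q + s²`, which avoids a square root in the bound.
    nlinarith [sq_nonneg (∫ ω, |T ω| ∂μ - s)]
  have hpt : ∀ ω, |N⁻¹ * ∑ i, W i ω - c| ≤
      |T ω| + N⁻¹ * ∑ i, |W i ω - clip M (W i ω)| + τ := fun ω => by
    have e1 : N⁻¹ * ∑ i, W i ω - c = T ω + N⁻¹ * ∑ i, (W i ω - clip M (W i ω)) +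
        N⁻¹ * ∑ i, (∫ ω, clip M (W i ω) ∂μ - c) := by
      have : ∫ ω, S ω ∂μ = ∑ i, ∫ ω, clip M (W i ω) ∂μ := by
        simp only [hS, Finset.sum_apply]
        exact integral_finsetSum _ fun i _ => hclipi i
      have hSω : S ω = ∑ i, clip M (W i ω) := by simp only [hS, Finset.sum_apply]
      simp only [hT]
      rw [this, hSω]
      simp only [Finset.sum_sub_distrib, Finset.sum_const, Finset.card_univ, nsmul_eq_mul, ← hN]
      field_simp
      ring
    have h2 : |N⁻¹ * ∑ i, (W i ω - clip M (W i ω))| ≤ N⁻¹ * ∑ i, |W i ω - clip M (W i ω)| := by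
      rw [abs_mul, abs_of_pos (inv_pos.2 hN0)]
      gcongr
      exact Finset.abs_sum_le_sum_abs _ _
    have h3 : |N⁻¹ * ∑ i, (∫ ω, clip M (W i ω) ∂μ - c)| ≤ τ := by
      rw [abs_mul, abs_of_pos (inv_pos.2 hN0), inv_mul_le_iff₀ hN0]
      refine (Finset.abs_sum_le_sum_abs _ _).trans ?_
      have : ∀ i ∈ Finset.univ, |∫ ω, clip M (W i ω) ∂μ - c| ≤ τ := fun i _ => by
        rw [← hc i, ← integral_sub (hclipi i) (hW i)]
        refine abs_integral_le_integral_abs.trans ?_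
        simp_rw [abs_sub_comm]
        exact hrτ i
      exact (Finset.sum_le_card_nsmul _ _ _ this).trans (le_of_eq (by simp [hN]))
    rw [e1]
    refine (abs_add_le _ _).trans (add_le_add ((abs_add_le _ _).trans ?_) h3)
    gcongr
  have hsumi : Integrable (fun ω => N⁻¹ * ∑ i, |W i ω - clip M (W i ω)|) μ :=
    (integrable_finsetSum _ fun i _ => hri i).const_mul _
  calc _ ≤ ∫ ω, (|T ω| + N⁻¹ * ∑ i, |W i ω - clip M (W i ω)| + τ) ∂μ :=
        integral_mono_of_nonneg (ae_of_all _ fun ω => abs_nonneg _)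
          ((hTi.abs.add hsumi).add (integrable_const _)) (ae_of_all _ hpt)
    _ = ∫ ω, |T ω| ∂μ + N⁻¹ * ∑ i, ∫ ω, |W i ω - clip M (W i ω)| ∂μ + τ := by
        have j1 : Integrable (fun ω => |T ω| + N⁻¹ * ∑ i, |W i ω - clip M (W i ω)|) μ :=
          hTi.abs.add hsumi
        rw [integral_add j1 (integrable_const _), integral_add hTi.abs hsumi,
          integral_const_mul, integral_finsetSum _ fun i _ => hri i]
        simp
    _ ≤ M ^ 2 / (N * s) + s + τ + τ := by
        gcongr
        rw [inv_mul_le_iff₀ hN0]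
        exact (Finset.sum_le_card_nsmul _ _ _ fun i _ => hrτ i).trans (le_of_eq (by simp [hN]))
    _ = _ := by ring

/-- The weak law of large numbers for arrays of pairwise independent, uniformly integrable random
variables. -/
lemma tendsto_avg_probFilter {ι : ℕ → Type*} [∀ k, Fintype (ι k)]
    (hι : Tendsto (fun k => Fintype.card (ι k)) atTop atTop) {W : ∀ k, ι k → Ω → ℝ} {c : ℝ}
    (hW : ∀ k i, Integrable (W k i) μ) (hc : ∀ k i, ∫ ω, W k i ω ∂μ = c)
    (hind : ∀ k, Pairwise fun i j => IndepFun (W k i) (W k j) μ)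
    (hui : ∀ τ > 0, ∃ M ≥ 0, ∀ k i, ∫ ω, max (|W k i ω| - M) 0 ∂μ ≤ τ) :
    Tendsto (fun a : ℕ × Ω => (Fintype.card (ι a.1) : ℝ)⁻¹ * ∑ i, W a.1 i a.2) (probFilter μ)
      (𝓝 c) := by
  rw [← tendsto_sub_nhds_zero_iff]
  have hint : ∀ k, Integrable (fun ω => (Fintype.card (ι k) : ℝ)⁻¹ * ∑ i, W k i ω - c) μ :=
    fun k => ((integrable_finsetSum _ fun i _ => hW k i).const_mul _).sub (integrable_const _)
  refine tendsto_probFilter_of_integral hint ?_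
  rw [Metric.tendsto_nhds]
  intro ε hε
  -- With `τ = ε / 8` and `s = ε / 4` the last two error terms are `ε / 4` each, and the first is
  -- below `ε / 4` for large arrays.
  obtain ⟨M, hM, hMτ⟩ := hui (ε / 8) (by positivity)
  have h1 : Tendsto (fun k => M ^ 2 / ((Fintype.card (ι k) : ℝ) * (ε / 4))) atTop (𝓝 0) :=
    tendsto_const_nhds.div_atTop
      ((tendsto_natCast_atTop_atTop.comp hι).atTop_mul_const (by positivity))
  filter_upwards [h1.eventually (gt_mem_nhds (show (0 : ℝ) < ε / 4 by positivity)),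
    hι.eventually_gt_atTop 0] with k h1 h2
  have : Nonempty (ι k) := Fintype.card_pos_iff.1 h2
  rw [dist_zero_right, Real.norm_of_nonneg (integral_nonneg fun ω => abs_nonneg _)]
  have := integral_abs_avg_sub_le (hW k) (hc k) (hind k) hM (show 0 < ε / 4 by positivity) (hMτ k)
  linarith

end WeakLaw

/-! ### Third moments of sums of independent random variables -/

section ThirdMoment

variable {Ω : Type*} [MeasurableSpace Ω] {μ : Measure Ω}

/-- The linear term is kept exactly: it has mean zero when `x` is centred and independent of `s`,
which makes the third moments of sums grow like the power `3 / 2` of the number of terms. -/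
lemma abs_add_pow_three_le (s x : ℝ) :
    |s + x| ^ 3 ≤ |s| ^ 3 + 3 * ((s * |s|) * x) + 3 * (|s| * x ^ 2) + |x| ^ 3 := by
  rcases le_total 0 s with hs | hs <;> rcases le_total 0 x with hx | hx <;>
    rcases le_total 0 (s + x) with h | h <;>
    simp only [abs_of_nonneg, abs_of_nonpos, hs, hx, h] <;>
    nlinarith [mul_nonneg (sub_nonneg.2 hs) (sq_nonneg (s - 3 / 2 * x)),
      mul_nonneg (sub_nonneg.2 hs) (sq_nonneg (s + 3 / 2 * x)),
      mul_nonneg (sub_nonneg.2 hs) (sq_nonneg x), mul_nonneg (sub_nonneg.2 hs) (sq_nonneg s),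
      pow_nonneg (sub_nonneg.2 hx) 3, pow_nonneg (sub_nonneg.2 hs) 3,
      mul_nonneg (sub_nonneg.2 hx) (sq_nonneg x), mul_nonneg (sub_nonneg.2 hx) (sq_nonneg s)]

lemma integrable_abs_pow_three {f : Ω → ℝ} (hf : MemLp f 3 μ) :
    Integrable (fun ω => |f ω| ^ 3) μ := by
  have h : MemLp f ((3 : ℕ) : ℝ≥0∞) μ := by exact_mod_cast hf
  exact h.integrable_norm_pow three_ne_zero

/-- Add one variable at a time. The linear term of the expansion vanishes, and the quadratic one is
at most `3 σ³ √(s.card)` because `E|S| ≤ σ √(s.card)`. -/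
lemma integral_abs_sum_pow_three_le [IsProbabilityMeasure μ] {ι : Type*} {ζ : ι → Ω → ℝ} (hind : iIndepFun ζ μ)
    (hζ : ∀ i, MemLp (ζ i) 3 μ) (h0 : ∀ i, ∫ ω, ζ i ω ∂μ = 0) {σ β : ℝ} (hσ : 0 ≤ σ)
    (h2 : ∀ i, ∫ ω, ζ i ω ^ 2 ∂μ = σ ^ 2) (h3 : ∀ i, ∫ ω, |ζ i ω| ^ 3 ∂μ ≤ β) (s : Finset ι) :
    ∫ ω, |∑ i ∈ s, ζ i ω| ^ 3 ∂μ ≤ (3 * σ ^ 3 + β) * √(s.card : ℝ) ^ 3 := by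
  classical
  induction s using Finset.induction_on with
  | empty => simp
  | insert a s ha ih =>
    have hζ2 : ∀ i, MemLp (ζ i) 2 μ := fun i => (hζ i).mono_exponent (by norm_num)
    have hβ : 0 ≤ β := (integral_nonneg fun ω => by positivity).trans (h3 a)
    set S : Ω → ℝ := ∑ i ∈ s, ζ i with hS
    have hS3 : MemLp S 3 μ := memLp_finsetSum' _ fun i _ => hζ i
    have hS2 : MemLp S 2 μ := hS3.mono_exponent (by norm_num)
    have hS0 : ∫ ω, S ω ∂μ = 0 := by
      simp only [hS, Finset.sum_apply]
      rw [integral_finsetSum _ fun i _ => (hζ2 i).integrable one_le_two]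
      simp [h0]
    have hSvar : ∫ ω, S ω ^ 2 ∂μ = s.card * σ ^ 2 := by
      rw [← variance_of_integral_eq_zero hS2.aemeasurable hS0, hS,
        IndepFun.variance_sum (fun i _ => hζ2 i) (fun i _ j _ hij => hind.indepFun hij)]
      rw [Finset.sum_congr rfl fun i _ => by
        rw [variance_of_integral_eq_zero (hζ2 i).aemeasurable (h0 i), h2]]
      simp
    have hSabs : ∫ ω, |S ω| ∂μ ≤ √(s.card : ℝ) * σ := by
      refine abs_le_of_sq_le_sq' ?_ (by positivity) |>.2
      rw [mul_pow, Real.sq_sqrt (Nat.cast_nonneg _), ← hSvar]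
      exact sq_integral_abs_le hS2
    have hindS : IndepFun S (ζ a) μ :=
      hind.indepFun_finsetSum_of_notMem₀ (fun i => (hζ i).aemeasurable) ha
    have i1 : Integrable (fun ω => (S ω * |S ω|) * ζ a ω) μ :=
      (hindS.comp (φ := fun t => t * |t|) (ψ := id) (by fun_prop) measurable_id).integrable_mul
        (hS2.integrable_mul hS2.abs) ((hζ2 a).integrable one_le_two)
    have e1 : ∫ ω, (S ω * |S ω|) * ζ a ω ∂μ = 0 := by
      have := (hindS.comp (φ := fun t => t * |t|) (ψ := id) (by fun_prop)
        measurable_id).integral_fun_mul_eq_mul_integral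
        (hS2.integrable_mul hS2.abs).aestronglyMeasurable (hζ a).aestronglyMeasurable
      simp only [Function.comp_apply, id] at this
      rw [this, h0, mul_zero]
    have hind2 := hindS.comp (φ := fun t => |t|) (ψ := fun t => t ^ 2) (by fun_prop) (by fun_prop)
    have i2 : Integrable (fun ω => |S ω| * ζ a ω ^ 2) μ :=
      hind2.integrable_mul (hS2.integrable one_le_two).abs (hζ2 a).integrable_sq
    have e2 : ∫ ω, |S ω| * ζ a ω ^ 2 ∂μ = (∫ ω, |S ω| ∂μ) * σ ^ 2 := by
      have := hind2.integral_fun_mul_eq_mul_integral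
        (hS2.integrable one_le_two).abs.aestronglyMeasurable (hζ2 a).integrable_sq.aestronglyMeasurable
      simp only [Function.comp_apply] at this
      rw [this, h2]
    have i3 := integrable_abs_pow_three hS3
    have i4 := integrable_abs_pow_three (hζ a)
    have key : ∫ ω, |∑ i ∈ insert a s, ζ i ω| ^ 3 ∂μ ≤
        ∫ ω, |S ω| ^ 3 ∂μ + 3 * ((∫ ω, |S ω| ∂μ) * σ ^ 2) + ∫ ω, |ζ a ω| ^ 3 ∂μ := by
      have : ∫ ω, |∑ i ∈ insert a s, ζ i ω| ^ 3 ∂μ ≤ ∫ ω, (|S ω| ^ 3 + 3 * ((S ω * |S ω|) * ζ a ω) +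
          3 * (|S ω| * ζ a ω ^ 2) + |ζ a ω| ^ 3) ∂μ := by
        refine integral_mono_of_nonneg (ae_of_all _ fun ω => by positivity)
          (((i3.add (i1.const_mul 3)).add (i2.const_mul 3)).add i4) (ae_of_all _ fun ω => ?_)
        simp only
        rw [Finset.sum_insert ha, add_comm]
        have := abs_add_pow_three_le (S ω) (ζ a ω)
        simpa [hS] using this
      have j1 : Integrable (fun ω => |S ω| ^ 3 + 3 * ((S ω * |S ω|) * ζ a ω)) μ :=
        i3.add (i1.const_mul 3)
      have j2 : Integrable (fun ω => |S ω| ^ 3 + 3 * ((S ω * |S ω|) * ζ a ω) +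
          3 * (|S ω| * ζ a ω ^ 2)) μ := j1.add (i2.const_mul 3)
      rw [integral_add j2 i4, integral_add j1 (i2.const_mul 3),
        integral_add i3 (i1.const_mul 3), integral_const_mul, integral_const_mul, e1, e2] at this
      linarith
    have ih' : ∫ ω, |S ω| ^ 3 ∂μ ≤ (3 * σ ^ 3 + β) * √(s.card : ℝ) ^ 3 := by
      simpa [hS] using ih
    rw [Finset.card_insert_of_notMem ha]
    push_cast
    set r := √(s.card : ℝ) with hr
    set r' := √((s.card : ℝ) + 1) with hr'
    have hr0 : 0 ≤ r := Real.sqrt_nonneg _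
    have hrr' : r ≤ r' := Real.sqrt_le_sqrt (by linarith)
    have hr1 : 1 ≤ r' := Real.one_le_sqrt.2 (by linarith [(Nat.cast_nonneg s.card : (0 : ℝ) ≤ _)])
    have hsq : r' ^ 2 = r ^ 2 + 1 := by
      rw [hr, hr', Real.sq_sqrt (by positivity), Real.sq_sqrt (by positivity)]
    have h5 : 3 * ((∫ ω, |S ω| ∂μ) * σ ^ 2) ≤ 3 * (r * σ * σ ^ 2) := by gcongr
    -- Since `r'² = r² + 1`, one has `r'³ = r' r² + r'`; this is exactly the room needed for the
    -- induction step.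
    have h6 : r ^ 3 + r' ≤ r' ^ 3 := by nlinarith [sq_nonneg r]
    have h7 : 0 ≤ σ ^ 3 := by positivity
    have h8 : (3 * σ ^ 3 + β) * (r ^ 3 + r') ≤ (3 * σ ^ 3 + β) * r' ^ 3 := by gcongr
    have h9 : σ ^ 3 * r ≤ σ ^ 3 * r' := by gcongr
    have h10 : β * 1 ≤ β * r' := by gcongr
    nlinarith [h3 a]

end ThirdMoment

/-! ### Arrays of independent observations -/

section IIDArray

open scoped RealInnerProductSpace

variable {Ω D : Type*} [MeasurableSpace Ω] [MeasurableSpace D]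

/-- For every `k`, the observations `X k i j` are independent with law `P`. -/
structure IsIIDArray (μ : Measure Ω) (P : Measure D) (n m : ℕ → ℕ)
    (X : (k : ℕ) → Fin (n k) → Fin (m k) → Ω → D) : Prop where
  law : ∀ k i j, HasLaw (X k i j) P μ
  indep : ∀ k, iIndepFun (fun a : Fin (n k) × Fin (m k) => X k a.1 a.2) μ

variable {μ : Measure Ω} {P : Measure D} {n m : ℕ → ℕ}
  {X : (k : ℕ) → Fin (n k) → Fin (m k) → Ω → D}

lemma integral_sum_sq_eq [IsProbabilityMeasure μ] {ι : Type*} {ζ : ι → Ω → ℝ}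
    (hind : iIndepFun ζ μ) (hζ : ∀ i, MemLp (ζ i) 2 μ) (h0 : ∀ i, ∫ ω, ζ i ω ∂μ = 0) {s : ℝ}
    (h2 : ∀ i, ∫ ω, ζ i ω ^ 2 ∂μ = s) (t : Finset ι) :
    ∫ ω, (∑ i ∈ t, ζ i ω) ^ 2 ∂μ = t.card * s := by
  have hS2 : MemLp (∑ i ∈ t, ζ i) 2 μ := memLp_finsetSum' _ fun i _ => hζ i
  have hS0 : ∫ ω, (∑ i ∈ t, ζ i) ω ∂μ = 0 := by
    simp only [Finset.sum_apply]
    rw [integral_finsetSum _ fun i _ => (hζ i).integrable one_le_two]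
    simp [h0]
  have h1 := variance_of_integral_eq_zero hS2.aemeasurable hS0
  rw [IndepFun.variance_sum (fun i _ => hζ i) (fun i _ j _ hij => hind.indepFun hij),
    Finset.sum_congr rfl fun i _ => by
      rw [variance_of_integral_eq_zero (hζ i).aemeasurable (h0 i), h2]] at h1
  simp only [Finset.sum_apply, Finset.sum_const, nsmul_eq_mul] at h1
  exact h1.symm

lemma HasLaw.integral_fun_comp {F : Type*} [NormedAddCommGroup F] [NormedSpace ℝ F] {Z : Ω → D}
    (hZ : HasLaw Z P μ) {f : D → F} (hf : AEStronglyMeasurable f P) :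
    ∫ ω, f (Z ω) ∂μ = ∫ y, f y ∂P :=
  hZ.integral_comp hf

lemma HasLaw.memLp_comp {F : Type*} [NormedAddCommGroup F] {Z : Ω → D}
    (hZ : HasLaw Z P μ) {f : D → F} {q : ℝ≥0∞} (hf : MemLp f q P) : MemLp (fun ω => f (Z ω)) q μ := by
  rw [← hZ.map_eq] at hf
  exact hf.comp_of_map hZ.aemeasurable

lemma HasLaw.integrable_comp {F : Type*} [NormedAddCommGroup F] {Z : Ω → D}
    (hZ : HasLaw Z P μ) {f : D → F} (hf : Integrable f P) : Integrable (fun ω => f (Z ω)) μ :=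
  memLp_one_iff_integrable.1 (HasLaw.memLp_comp hZ (memLp_one_iff_integrable.2 hf))

namespace IsIIDArray

lemma iIndepFun_comp (h : IsIIDArray μ P n m X) {f : D → ℝ} (hf : AEMeasurable f P) (k : ℕ) :
    iIndepFun (fun (a : Fin (n k) × Fin (m k)) ω => f (X k a.1 a.2 ω)) μ :=
  (h.indep k).comp₀ (fun _ => f) (fun a => (h.law k a.1 a.2).aemeasurable)
    (fun a => by rw [(h.law k a.1 a.2).map_eq]; exact hf)

lemma empiricalLaw [IsProbabilityMeasure μ] (h : IsIIDArray μ P n m X)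
    (hn : Tendsto n atTop atTop) (hm : ∀ k, 1 ≤ m k) :
    EmpiricalLaw (probFilter μ) P (fun a => n a.1) (fun a => m a.1)
      (fun a i j => X a.1 i j a.2) where
  n_tendsto := hn.comp tendsto_fst_probFilter
  m_pos a := hm a.1
  ae q hq := by
    refine eventually_probFilter_of_ae fun k => ?_
    refine ae_all_iff.2 fun (i : Fin (n k)) => ae_all_iff.2 fun (j : Fin (m k)) => ?_
    have h1 := h.law k i j
    rw [← h1.map_eq] at hq
    exact ae_of_ae_map h1.aemeasurable hq
  lln f hf := by
    have hcard : Tendsto (fun k => Fintype.card (Fin (n k) × Fin (m k))) atTop atTop := by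
      simp only [Fintype.card_prod, Fintype.card_fin]
      exact tendsto_atTop_mono (fun k => Nat.le_mul_of_pos_right _ (hm k)) hn
    have h1 := tendsto_avg_probFilter (μ := μ) hcard
      (W := fun k a ω => f (X k a.1 a.2 ω)) (c := ∫ y, f y ∂P)
      (fun k a => HasLaw.integrable_comp (h.law k a.1 a.2) hf)
      (fun k a => HasLaw.integral_fun_comp (h.law k a.1 a.2) hf.aestronglyMeasurable)
      (fun k a b hab => (h.iIndepFun_comp hf.aemeasurable k).indepFun hab)
      (fun τ hτ => by
        obtain ⟨M, hM⟩ := ((integral_trunc_tendsto hf).eventually (gt_mem_nhds hτ)).exists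
        refine ⟨M, Nat.cast_nonneg _, fun k a => ?_⟩
        rw [HasLaw.integral_fun_comp (h.law k a.1 a.2) (f := fun y => max (|f y| - M) 0)
          (integrable_trunc hf (Nat.cast_nonneg M)).aestronglyMeasurable]
        exact hM.le)
    refine h1.congr fun a => ?_
    simp [groupAvg, Fintype.sum_prod_type, Fintype.card_prod]

variable {f : D → ℝ}

lemma integral_groupSum_sq [IsProbabilityMeasure μ] (h : IsIIDArray μ P n m X) (hm : ∀ k, 1 ≤ m k)
    (hf : MemLp f 2 P) (h0 : ∫ y, f y ∂P = 0) (k : ℕ) (i : Fin (n k)) :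
    ∫ ω, (groupSum (fun i j => X k i j ω) f i) ^ 2 ∂μ = ∫ y, f y ^ 2 ∂P := by
  have hind : iIndepFun (fun (j : Fin (m k)) ω => f (X k i j ω)) μ :=
    (h.iIndepFun_comp hf.aemeasurable k).precomp (g := fun j => (i, j))
      (fun j j' hj => (Prod.ext_iff.1 hj).2)
  have h1 := integral_sum_sq_eq hind (fun j => HasLaw.memLp_comp (h.law k i j) hf)
    (fun j => (HasLaw.integral_fun_comp (h.law k i j) hf.aestronglyMeasurable).trans h0)
    (fun j => HasLaw.integral_fun_comp (h.law k i j) (f := fun y => f y ^ 2)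
      hf.integrable_sq.aestronglyMeasurable) Finset.univ
  simp only [groupSum, smul_eq_mul, mul_pow, integral_const_mul, h1, inv_pow,
    Real.sq_sqrt (Nat.cast_nonneg (m k)), Finset.card_univ, Fintype.card_fin]
  have : (m k : ℝ) ≠ 0 := Nat.cast_ne_zero.2 (Nat.one_le_iff_ne_zero.1 (hm k))
  field_simp

lemma memLp_groupSum (h : IsIIDArray μ P n m X) {q : ℝ≥0∞} (hf : MemLp f q P)
    (k : ℕ) (i : Fin (n k)) : MemLp (fun ω => groupSum (fun i j => X k i j ω) f i) q μ := by
  simp only [groupSum, smul_eq_mul]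
  have h1 : ∀ j ∈ (Finset.univ : Finset (Fin (m k))), MemLp (fun ω => f (X k i j ω)) q μ :=
    fun j _ => HasLaw.memLp_comp (h.law k i j) hf
  exact (memLp_finsetSum _ h1).const_mul _

/-- The normalization `m^{-1/2}` cancels the growth of the third moment, so `C` does not depend on
the group size. This uniformity is what permits `m` to vary arbitrarily. -/
lemma integral_abs_groupSum_pow_three_le [IsProbabilityMeasure μ] [IsProbabilityMeasure P]
    (h : IsIIDArray μ P n m X)
    (hm : ∀ k, 1 ≤ m k) (hf : MemLp f 3 P) (h0 : ∫ y, f y ∂P = 0) :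
    ∃ C : ℝ, 0 ≤ C ∧ ∀ k i, ∫ ω, |groupSum (fun i j => X k i j ω) f i| ^ 3 ∂μ ≤ C := by
  have hf2 : MemLp f 2 P := hf.mono_exponent (by norm_num)
  refine ⟨3 * √(∫ y, f y ^ 2 ∂P) ^ 3 + ∫ y, |f y| ^ 3 ∂P, ?_, fun k i => ?_⟩
  · have : 0 ≤ ∫ y, |f y| ^ 3 ∂P := integral_nonneg fun y => by positivity
    positivity
  have hind : iIndepFun (fun (j : Fin (m k)) ω => f (X k i j ω)) μ :=
    (h.iIndepFun_comp hf.aemeasurable k).precomp (g := fun j => (i, j))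
      (fun j j' hj => (Prod.ext_iff.1 hj).2)
  have h1 := integral_abs_sum_pow_three_le hind (fun j => HasLaw.memLp_comp (h.law k i j) hf)
    (fun j => (HasLaw.integral_fun_comp (h.law k i j) hf.aestronglyMeasurable).trans h0)
    (Real.sqrt_nonneg (∫ y, f y ^ 2 ∂P))
    (fun j => (HasLaw.integral_fun_comp (h.law k i j) (f := fun y => f y ^ 2)
      hf2.integrable_sq.aestronglyMeasurable).trans
        (Real.sq_sqrt (integral_nonneg fun y => sq_nonneg _)).symm)
    (fun j => (HasLaw.integral_fun_comp (h.law k i j) (f := fun y => |f y| ^ 3)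
      (integrable_abs_pow_three hf).aestronglyMeasurable).le) Finset.univ
  have hmk : 0 < √(m k : ℝ) := Real.sqrt_pos.2 (Nat.cast_pos.2 (hm k))
  simp only [groupSum, smul_eq_mul, abs_mul, mul_pow, integral_const_mul, abs_inv, abs_of_pos hmk,
    inv_pow]
  rw [inv_mul_le_iff₀ (by positivity), mul_comm]
  simpa using h1

lemma indepFun_groupSum (h : IsIIDArray μ P n m X) (hf : AEMeasurable f P) (k : ℕ) :
    Pairwise fun i i' => IndepFun (fun ω => groupSum (fun i j => X k i j ω) f i)
      (fun ω => groupSum (fun i j => X k i j ω) f i') μ := by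
  classical
  intro i i' hi
  -- Group sums of distinct groups are functions of disjoint blocks of an independent family.
  set B : Fin (n k) → Finset (Fin (n k) × Fin (m k)) := fun i =>
    Finset.univ.map ⟨fun j => (i, j), fun j j' hj => (Prod.ext_iff.1 hj).2⟩ with hB
  have hdisj : Disjoint (B i) (B i') := by
    rw [Finset.disjoint_left]
    intro a ha ha'
    simp only [hB, Finset.mem_map, Finset.mem_univ, true_and] at ha ha'
    obtain ⟨j, rfl⟩ := ha
    obtain ⟨j', hj'⟩ := ha'
    exact hi (Prod.ext_iff.1 hj').1.symm
  have h1 := (h.iIndepFun_comp hf k).indepFun_finset₀ (B i) (B i') hdisj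
    (fun a => by
      have h2 := h.law k a.1 a.2
      rw [← h2.map_eq] at hf
      exact hf.comp_aemeasurable h2.aemeasurable)
  have h2 := h1.comp (φ := fun v : B i → ℝ => (√(m k : ℝ))⁻¹ * ∑ a, v a)
    (ψ := fun v : B i' → ℝ => (√(m k : ℝ))⁻¹ * ∑ a, v a) (by fun_prop) (by fun_prop)
  have e : ∀ i, (fun ω => groupSum (fun i j => X k i j ω) f i) =
      (fun v : B i → ℝ => (√(m k : ℝ))⁻¹ * ∑ a, v a) ∘
        (fun ω (a : B i) => f (X k a.1.1 a.1.2 ω)) := fun i => by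
    ext ω
    simp only [groupSum, smul_eq_mul, Function.comp_apply]
    rw [Finset.sum_coe_sort (B i) (fun a => f (X k a.1 a.2 ω))]
    simp only [hB, Finset.sum_map]
    rfl
  rw [e i, e i']
  exact h2

/-- The left side is nonzero only where `|y| > √M`, and there `y² ≤ |y|³ / √M`. Bounded third
moments thus make the squared group sums uniformly integrable. -/
lemma max_sq_sub_le {y M : ℝ} (hM : 0 < M) : max (|y ^ 2| - M) 0 ≤ |y| ^ 3 / √M := by
  have hs := Real.sqrt_pos.2 hM
  refine max_le ?_ (by positivity)
  rw [abs_of_nonneg (sq_nonneg y), le_div_iff₀ hs]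
  rcases le_total |y| √M with h | h
  · have : y ^ 2 ≤ M := by
      rw [← sq_abs, ← Real.sq_sqrt hM.le]
      exact pow_le_pow_left₀ (abs_nonneg _) h 2
    nlinarith [pow_nonneg (abs_nonneg y) 3]
  · have : y ^ 2 * √M ≤ |y| ^ 3 := by
      rw [← sq_abs, pow_succ |y| 2]
      gcongr
    nlinarith

lemma tendsto_avg_groupSum_sq [IsProbabilityMeasure μ] [IsProbabilityMeasure P]
    (h : IsIIDArray μ P n m X)
    (hn : Tendsto n atTop atTop) (hm : ∀ k, 1 ≤ m k) (hf : MemLp f 3 P) (h0 : ∫ y, f y ∂P = 0) :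
    Tendsto (fun a : ℕ × Ω => (n a.1 : ℝ)⁻¹ *
      ∑ i, (groupSum (fun i j => X a.1 i j a.2) f i) ^ 2) (probFilter μ) (𝓝 (∫ y, f y ^ 2 ∂P)) := by
  have hf2 : MemLp f 2 P := hf.mono_exponent (by norm_num)
  obtain ⟨C, hC0, hC⟩ := h.integral_abs_groupSum_pow_three_le hm hf h0
  have h1 := tendsto_avg_probFilter (μ := μ) (ι := fun k => Fin (n k)) (by simpa using hn)
    (W := fun k i ω => (groupSum (fun i j => X k i j ω) f i) ^ 2)
    (fun k i => (h.memLp_groupSum hf2 k i).integrable_sq)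
    (fun k i => h.integral_groupSum_sq hm hf2 h0 k i)
    (fun k i i' hi => (h.indepFun_groupSum hf.aemeasurable k hi).comp
      (φ := fun t => t ^ 2) (ψ := fun t => t ^ 2) (by fun_prop) (by fun_prop))
    (fun τ hτ => by
      have hM : 0 < ((C + 1) / τ) ^ 2 := by positivity
      -- With this truncation level the tail is at most `C τ / (C + 1) ≤ τ`.
      refine ⟨((C + 1) / τ) ^ 2, hM.le, fun k i => ?_⟩
      have h3 := integrable_abs_pow_three (h.memLp_groupSum hf k i)
      refine (integral_mono_of_nonneg (ae_of_all _ fun ω => le_max_right _ _)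
        (h3.div_const _) (ae_of_all _ fun ω => max_sq_sub_le hM)).trans ?_
      rw [integral_div, Real.sqrt_sq (by positivity), div_le_iff₀ (by positivity)]
      refine (hC k i).trans ?_
      field_simp
      linarith)
  simpa using h1

/-- The cube of the maximum is at most the sum of the cubes, and `n^{-3/2}` times that sum has
expectation at most `C / √n`. -/
lemma groupSum_le [IsProbabilityMeasure μ] [IsProbabilityMeasure P] (h : IsIIDArray μ P n m X)
    (hn : Tendsto n atTop atTop) (hm : ∀ k, 1 ≤ m k) (hf : MemLp f 3 P) (h0 : ∫ y, f y ∂P = 0)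
    {δ : ℝ} (hδ : 0 < δ) :
    ∀ᶠ a in probFilter μ, ∀ i, |groupSum (fun i j => X a.1 i j a.2) f i| ≤ δ * √(n a.1 : ℝ) := by
  obtain ⟨C, hC0, hC⟩ := h.integral_abs_groupSum_pow_three_le hm hf h0
  set G : ℕ → Ω → ℝ := fun k ω => (√(n k : ℝ) ^ 3)⁻¹ *
    ∑ i, |groupSum (fun i j => X k i j ω) f i| ^ 3 with hG
  set F : ℕ × Ω → ℝ := fun a => G a.1 a.2 with hF
  have hint : ∀ k i, Integrable (fun ω => |groupSum (fun i j => X k i j ω) f i| ^ 3) μ :=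
    fun k i => integrable_abs_pow_three (h.memLp_groupSum hf k i)
  have hFi : ∀ k, Integrable (G k) μ := fun k => by
    simp only [hG]
    exact (integrable_finsetSum _ fun i _ => hint k i).const_mul _
  have hF0 : Tendsto F (probFilter μ) (𝓝 0) := by
    refine tendsto_probFilter_of_integral hFi ?_
    have h1 : Tendsto (fun k => C / √(n k : ℝ)) atTop (𝓝 0) :=
      tendsto_const_nhds.div_atTop (Real.tendsto_sqrt_atTop.comp
        (tendsto_natCast_atTop_atTop.comp hn))
    refine squeeze_zero' (Eventually.of_forall fun k => integral_nonneg fun ω => abs_nonneg _) ?_ h1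
    filter_upwards [hn.eventually_gt_atTop 0] with k hk
    have hs : 0 < √(n k : ℝ) := Real.sqrt_pos.2 (Nat.cast_pos.2 hk)
    have e1 : ∀ ω, |F (k, ω)| = G k ω := fun ω => abs_of_nonneg (by
      simp only [hF, hG]; positivity)
    simp_rw [e1, hG]
    rw [integral_const_mul, integral_finsetSum _ fun i _ => hint k i, inv_mul_le_iff₀ (by positivity)]
    refine (Finset.sum_le_card_nsmul _ _ _ fun i _ => hC k i).trans (le_of_eq ?_)
    simp only [Finset.card_univ, Fintype.card_fin, nsmul_eq_mul]
    have h2 : (n k : ℝ) = √(n k : ℝ) ^ 2 := (Real.sq_sqrt (Nat.cast_nonneg _)).symm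
    rw [pow_succ, ← h2]
    field_simp
  filter_upwards [hF0.eventually (gt_mem_nhds (show (0 : ℝ) < δ ^ 3 by positivity)),
    tendsto_fst_probFilter.eventually (hn.eventually_gt_atTop 0)] with a h1 h2 i
  have hs : 0 < √(n a.1 : ℝ) := Real.sqrt_pos.2 (Nat.cast_pos.2 h2)
  simp only [hF, hG] at h1
  rw [inv_mul_lt_iff₀ (by positivity)] at h1
  have h3 : |groupSum (fun i j => X a.1 i j a.2) f i| ^ 3 ≤ (δ * √(n a.1 : ℝ)) ^ 3 := by
    refine (Finset.single_le_sum (f := fun i => |groupSum (fun i j => X a.1 i j a.2) f i| ^ 3)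
      (fun _ _ => by positivity) (Finset.mem_univ i)).trans (h1.le.trans (le_of_eq (by ring)))
  exact le_of_pow_le_pow_left₀ three_ne_zero (by positivity) h3

end IsIIDArray

lemma inner_groupSum {E : Type*} {p N M : ℕ} (x : Fin N → Fin M → E) (ξ : E → Vec p) (u : Vec p)
    (i : Fin N) :
    ⟪u, groupSum x ξ i⟫ = groupSum x (fun y => ⟪u, ξ y⟫) i := by
  simp only [groupSum, inner_smul_right, inner_sum, smul_eq_mul]

lemma norm_le_sum_abs_inner {p : ℕ} (v : Vec p) :
    ‖v‖ ≤ ∑ j, |⟪EuclideanSpace.basisFun (Fin p) ℝ j, v⟫| := by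
  set b := EuclideanSpace.basisFun (Fin p) ℝ
  conv_lhs => rw [← b.sum_repr' v]
  refine (norm_sum_le _ _).trans (le_of_eq (Finset.sum_congr rfl fun j _ => ?_))
  rw [norm_smul, b.norm_eq_one, mul_one, Real.norm_eq_abs]

/-- Symmetric operators converge if their quadratic forms do. -/
lemma tendsto_of_tendsto_quadratic {α : Type*} {l : Filter α} {p : ℕ} {T : α → Vec p →L[ℝ] Vec p}
    {V : Vec p →L[ℝ] Vec p} (hT : ∀ a u v, ⟪T a u, v⟫ = ⟪u, T a v⟫)
    (hV : ∀ u v, ⟪V u, v⟫ = ⟪u, V v⟫)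
    (h : ∀ u, Tendsto (fun a => ⟪T a u, u⟫) l (𝓝 ⟪V u, u⟫)) : Tendsto T l (𝓝 V) := by
  set b := EuclideanSpace.basisFun (Fin p) ℝ
  -- Polarization passes from quadratic forms to matrix entries, and in finite dimension the entries
  -- control the operator norm.
  have hpol : ∀ (S : Vec p →L[ℝ] Vec p), (∀ u v, ⟪S u, v⟫ = ⟪u, S v⟫) → ∀ u v,
      ⟪S u, v⟫ = (⟪S (u + v), u + v⟫ - ⟪S u, u⟫ - ⟪S v, v⟫) / 2 := fun S hS u v => by
    have : ⟪S v, u⟫ = ⟪S u, v⟫ := by rw [hS, real_inner_comm]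
    simp only [map_add, inner_add_left, inner_add_right, this]
    ring
  have h1 : ∀ i j, Tendsto (fun a => |⟪b j, (T a - V) (b i)⟫|) l (𝓝 0) := fun i j => by
    have h2 : Tendsto (fun a => ⟪T a (b i), b j⟫) l (𝓝 ⟪V (b i), b j⟫) := by
      rw [hpol V hV]
      simp_rw [fun a => hpol (T a) (hT a) (b i) (b j)]
      exact (((h _).sub (h _)).sub (h _)).div_const 2
    have h3 := (h2.sub_const ⟪V (b i), b j⟫).abs
    simp only [sub_self, abs_zero] at h3
    refine h3.congr fun a => ?_
    rw [sub_apply, inner_sub_right, real_inner_comm (T a (b i)), real_inner_comm (V (b i))]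
  rw [tendsto_iff_norm_sub_tendsto_zero]
  have h2 : Tendsto (fun a => ∑ i, ∑ j, |⟪b j, (T a - V) (b i)⟫|) l (𝓝 0) := by
    have := tendsto_finsetSum (Finset.univ : Finset (Fin p)) fun i _ =>
      tendsto_finsetSum (Finset.univ : Finset (Fin p)) fun j _ => h1 i j
    simpa using this
  refine squeeze_zero (fun a => norm_nonneg _) (fun a => ?_) h2
  refine ContinuousLinearMap.opNorm_le_bound _
    (Finset.sum_nonneg fun i _ => Finset.sum_nonneg fun j _ => abs_nonneg _) fun v => ?_
  conv_lhs => rw [← b.sum_repr' v, map_sum]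
  rw [Finset.sum_mul]
  refine (norm_sum_le _ _).trans (Finset.sum_le_sum fun i _ => ?_)
  rw [map_smul, norm_smul, mul_comm]
  gcongr
  · exact norm_le_sum_abs_inner _
  · refine (norm_inner_le_norm _ _).trans ?_
    rw [b.norm_eq_one, one_mul]

lemma inner_secondMoment_comm {p N : ℕ} (z : Fin N → Vec p) (u v : Vec p) :
    ⟪secondMoment z u, v⟫ = ⟪u, secondMoment z v⟫ := by
  simp only [secondMoment, smul_apply, sum_apply, InnerProductSpace.rankOne_apply, inner_smul_left,
    inner_smul_right, sum_inner, inner_sum, RCLike.conj_to_real]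
  congr 1
  refine Finset.sum_congr rfl fun i _ => ?_
  rw [real_inner_comm u (z i)]
  ring

section MomentOp

variable {d p : ℕ} {PX : Measure (Vec d)} {g : Vec d → Vec p → Vec p} {θ : Vec p}

lemma integrable_rankOne (h : MemLp (fun y => g y θ) 2 PX) :
    Integrable (fun y => InnerProductSpace.rankOne ℝ (g y θ) (g y θ)) PX := by
  have hc : Continuous fun v : Vec p => InnerProductSpace.rankOne ℝ v v := by
    exact (InnerProductSpace.rankOne ℝ).continuous.clm_apply continuous_id
  refine (h.integrable_norm_pow two_ne_zero).mono'
    (hc.comp_aestronglyMeasurable h.aestronglyMeasurable) (ae_of_all _ fun y => ?_)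
  rw [InnerProductSpace.norm_rankOne, ← sq]

lemma inner_momentOp (h : MemLp (fun y => g y θ) 2 PX) (u v : Vec p) :
    ⟪momentOp g PX θ u, v⟫ = ∫ y, ⟪u, g y θ⟫ * ⟪v, g y θ⟫ ∂PX := by
  rw [momentOp, ContinuousLinearMap.integral_apply (integrable_rankOne h), real_inner_comm,
    ← integral_inner ((integrable_rankOne h).apply_continuousLinearMap u)]
  refine integral_congr_ae (ae_of_all _ fun y => ?_)
  simp only [InnerProductSpace.rankOne_apply, inner_smul_right]
  rw [real_inner_comm]

lemma inner_momentOp_comm (h : MemLp (fun y => g y θ) 2 PX) (u v : Vec p) :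
    ⟪momentOp g PX θ u, v⟫ = ⟪u, momentOp g PX θ v⟫ := by
  rw [real_inner_comm (momentOp g PX θ v) u, inner_momentOp h, inner_momentOp h]
  simp_rw [mul_comm]

end MomentOp

lemma IsIIDArray.regularGroups [IsProbabilityMeasure μ] {d p : ℕ} {PX : Measure (Vec d)}
    [IsProbabilityMeasure PX] {X : (k : ℕ) → Fin (n k) → Fin (m k) → Ω → Vec d}
    (h : IsIIDArray μ PX n m X) {g : Vec d → Vec p → Vec p} {θ : Vec p}
    (hn : Tendsto n atTop atTop) (hm : ∀ k, 1 ≤ m k) (hg : MemLp (fun y => g y θ) 3 PX)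
    (h0 : ∫ y, g y θ ∂PX = 0) :
    RegularGroups (probFilter μ) PX (fun y => g y θ) (fun a => n a.1) (fun a => m a.1)
      (fun a i j => X a.1 i j a.2) := by
  have hg2 : MemLp (fun y => g y θ) 2 PX := hg.mono_exponent (by norm_num)
  have hu : ∀ u, MemLp (fun y => ⟪u, g y θ⟫) 3 PX := fun u => hg.const_inner u
  have hu0 : ∀ u : Vec p, ∫ y, ⟪u, g y θ⟫ ∂PX = 0 := fun u => by
    rw [integral_inner (hg2.integrable one_le_two), h0, inner_zero_right]
  constructor
  · refine tendsto_of_tendsto_quadratic (fun a u v => inner_secondMoment_comm _ u v)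
      (inner_momentOp_comm hg2) fun u => ?_
    simp_rw [inner_secondMoment_self, inner_groupSum]
    change Tendsto _ _ (𝓝 ⟪momentOp g PX θ u, u⟫)
    rw [inner_momentOp hg2]
    simp_rw [← sq]
    exact h.tendsto_avg_groupSum_sq hn hm (hu u) (hu0 u)
  · intro δ hδ
    have h1 : ∀ᶠ a in probFilter μ, ∀ j : Fin p, ∀ i,
        |groupSum (fun i j => X a.1 i j a.2)
          (fun y => ⟪EuclideanSpace.basisFun (Fin p) ℝ j, g y θ⟫) i| ≤
            δ / (p + 1) * √(n a.1 : ℝ) := by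
      rw [eventually_all]
      exact fun j => h.groupSum_le hn hm (hu _) (hu0 _) (by positivity)
    filter_upwards [h1] with a ha i
    refine (norm_le_sum_abs_inner _).trans ?_
    simp_rw [inner_groupSum]
    refine (Finset.sum_le_card_nsmul _ _ _ fun j _ => ha j i).trans ?_
    simp only [Finset.card_univ, Fintype.card_fin, nsmul_eq_mul]
    have : (p : ℝ) * (δ / (p + 1)) ≤ δ := by
      rw [mul_div_assoc', div_le_iff₀ (by positivity)]
      nlinarith
    rw [← mul_assoc]
    gcongr

end IIDArray

/-! ### The chi-square law -/

section ChiSquare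

instance isProbabilityMeasure_chiSquare (p : ℕ) : IsProbabilityMeasure (chiSquare p) :=
  Measure.isProbabilityMeasure_map (Measurable.aemeasurable (by fun_prop))

/-- Given the other coordinates, the first one is confined to at most two values, and a Gaussian law
has no atoms; Fubini concludes. -/
lemma chiSquare_singleton {p : ℕ} (hp : 1 ≤ p) (t : ℝ) : chiSquare p {t} = 0 := by
  obtain ⟨q, rfl⟩ : ∃ q, p = q + 1 := ⟨p - 1, by omega⟩
  have hf : Measurable fun z : Fin (q + 1) → ℝ => ∑ i, z i ^ 2 := by fun_prop
  rw [chiSquare, Measure.map_apply hf (measurableSet_singleton t)]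
  have hmp := measurePreserving_piFinSuccAbove (fun _ : Fin (q + 1) => gaussianReal 0 1) 0
  set S : Set (ℝ × (Fin q → ℝ)) := {z | z.1 ^ 2 + ∑ i, z.2 i ^ 2 = t} with hS
  have hSm : MeasurableSet S := measurableSet_eq_fun (by fun_prop) measurable_const
  have e : (fun z : Fin (q + 1) → ℝ => ∑ i, z i ^ 2) ⁻¹' {t} =
      (MeasurableEquiv.piFinSuccAbove (fun _ : Fin (q + 1) => ℝ) 0) ⁻¹' S := by
    ext z
    simp [hS, Fin.sum_univ_succ, MeasurableEquiv.piFinSuccAbove, Fin.tail]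
  rw [e, hmp.measure_preimage hSm.nullMeasurableSet, Measure.prod_apply_symm hSm]
  refine (lintegral_eq_zero_iff (measurable_measure_prodMk_right hSm)).2 (ae_of_all _ fun y => ?_)
  have : NullSingletonClass (gaussianReal 0 1) := nullSingletonClass_gaussianReal one_ne_zero
  refine Set.Finite.measure_zero (Set.Finite.subset
    (Set.toFinite {√(t - ∑ i, y i ^ 2), -√(t - ∑ i, y i ^ 2)}) fun x hx => ?_) _
  have hx' : x ^ 2 + ∑ i, y i ^ 2 = t := hx
  have h1 : x ^ 2 = t - ∑ i, y i ^ 2 := by linarith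
  have h2 : |x| = √(t - ∑ i, y i ^ 2) := by rw [← h1, Real.sqrt_sq_eq_abs]
  exact (abs_eq (Real.sqrt_nonneg _)).1 h2

lemma stdGaussian_norm_sq_preimage {p : ℕ} {s : Set ℝ} (hs : MeasurableSet s) :
    stdGaussian (Vec p) ((fun v => ‖v‖ ^ 2) ⁻¹' s) = chiSquare p s := by
  have h1 : Measurable (WithLp.toLp 2 : (Fin p → ℝ) → Vec p) := by fun_prop
  rw [chiSquare, ← map_pi_eq_stdGaussian, Measure.map_apply h1 (hs.preimage (by fun_prop)),
    Measure.map_apply (by fun_prop) hs]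
  congr 1
  ext z
  simp [EuclideanSpace.norm_sq_eq]

lemma tendsto_chiSquare_Iic {p : ℕ} (hp : 1 ≤ p) (t : ℝ) :
    Tendsto (fun s => chiSquare p (Set.Iic s)) (𝓝 t) (𝓝 (chiSquare p (Set.Iic t))) := by
  refine tendsto_measure_of_ae_tendsto_indicator_of_isFiniteMeasure _ measurableSet_Iic
    (fun s => measurableSet_Iic) ?_
  have h : ∀ᵐ x ∂chiSquare p, x ≠ t := by
    rw [ae_iff]; simpa using chiSquare_singleton hp t
  filter_upwards [h] with x hx
  rcases lt_or_gt_of_ne hx with h | h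
  · filter_upwards [lt_mem_nhds h] with s hs
    simp [h.le, (show x < s from hs).le]
  · filter_upwards [gt_mem_nhds h] with s hs
    exact iff_of_false (not_le.2 hs) (not_le.2 h)

lemma tendsto_chiSquare_Ioi {p : ℕ} (hp : 1 ≤ p) (t : ℝ) :
    Tendsto (fun s => chiSquare p (Set.Ioi s)) (𝓝 t) (𝓝 (chiSquare p (Set.Ioi t))) := by
  have h : ∀ s : ℝ, chiSquare p (Set.Ioi s) = 1 - chiSquare p (Set.Iic s) := fun s => by
    rw [← Set.compl_Iic, prob_compl_eq_one_sub measurableSet_Iic]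
  simp_rw [h]
  exact ENNReal.Tendsto.sub tendsto_const_nhds (tendsto_chiSquare_Iic hp t) (Or.inl ENNReal.one_ne_top)

end ChiSquare

/-! ### The central limit theorem for normalized sums -/

section CentralLimit

open scoped RealInnerProductSpace
open Complex (I)

variable {Ω D : Type*} [MeasurableSpace Ω] [MeasurableSpace D] {μ : Measure Ω}

lemma tendsto_charFun_map_pow {P : Measure D} [IsProbabilityMeasure P] {f : D → ℝ}
    (hf : MemLp f 2 P) (h0 : ∫ y, f y ∂P = 0) :
    Tendsto (fun N : ℕ => charFun (P.map f) (√(N : ℝ))⁻¹ ^ N) atTop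
      (𝓝 (Complex.exp (-((∫ y, f y ^ 2 ∂P : ℝ) : ℂ) / 2))) := by
  set s := ∫ y, f y ^ 2 ∂P with hs
  have hs0 : 0 ≤ s := integral_nonneg fun y => sq_nonneg _
  -- Zero variance, which occurs for a zero direction, cannot be standardized; there `f` vanishes
  -- almost everywhere.
  rcases hs0.eq_or_lt with h | h
  · have h1 : f =ᵐ[P] 0 := by
      have h2 := (integral_eq_zero_iff_of_nonneg (fun y => sq_nonneg (f y)) hf.integrable_sq).1
        (hs.symm.trans h.symm)
      filter_upwards [h2] with y hy
      simpa using hy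
    rw [Measure.map_congr h1, ← h]
    have h3 : P.map (0 : D → ℝ) = Measure.dirac 0 := by
      have h4 := Measure.map_const P (0 : ℝ)
      rwa [measure_univ, one_smul] at h4
    simp [h3]
  · have hq : √s ≠ 0 := (Real.sqrt_pos.2 h).ne'
    have h1 := tendsto_charFun_inv_sqrt_mul_pow (P := P) (X := fun y => (√s)⁻¹ * f y)
      (hf.aemeasurable.const_mul _) (by rw [integral_const_mul, h0, mul_zero])
      (by
        simp only [Pi.pow_apply, mul_pow, inv_pow, Real.sq_sqrt hs0, integral_const_mul]
        rw [← hs, inv_mul_cancel₀ h.ne']) √s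
    have e : ∀ N : ℕ, charFun (P.map fun y => (√s)⁻¹ * f y) ((√(N : ℝ))⁻¹ * √s) =
        charFun (P.map f) (√(N : ℝ))⁻¹ := fun N => by
      rw [charFun_map_mul_comp hf.aemeasurable]
      congr 1
      field_simp
    simp_rw [e] at h1
    rw [← Complex.ofReal_pow, Real.sq_sqrt hs0] at h1
    exact h1

lemma charFun_map_sum_add_sum [IsProbabilityMeasure μ] {P Q : Measure D} {ι κ : Type*} [Fintype ι]
    [Fintype κ] {X : ι → Ω → D} {Y : κ → Ω → D} (hX : ∀ a, HasLaw (X a) P μ)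
    (hY : ∀ b, HasLaw (Y b) Q μ) (hind : iIndepFun (Sum.elim X Y) μ) {f h : D → ℝ}
    (hf : Measurable f) (hh : Measurable h) (r s : ℝ) :
    charFun (μ.map fun ω => r * ∑ a, f (X a ω) + s * ∑ b, h (Y b ω)) 1 =
      charFun (P.map f) r ^ Fintype.card ι * charFun (Q.map h) s ^ Fintype.card κ := by
  -- Treating both samples as one independent family makes the characteristic function factor, even
  -- though the samples have different sizes and scalings.
  set Z : ι ⊕ κ → Ω → ℝ := Sum.elim (fun a ω => r * f (X a ω)) (fun b ω => s * h (Y b ω)) with hZ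
  have h1 : iIndepFun Z μ := by
    have h2 := hind.comp (Sum.elim (fun _ y => r * f y) (fun _ y => s * h y))
      (by rintro (a | b) <;> simp only [Sum.elim_inl, Sum.elim_inr] <;> fun_prop)
    convert! h2 using 1
    ext c ω
    rcases c with a | b <;> rfl
  have hXm := fun a => (hX a).aemeasurable
  have hYm := fun b => (hY b).aemeasurable
  have hZm : ∀ c, AEMeasurable (Z c) μ := by
    rintro (a | b) <;> simp only [hZ, Sum.elim_inl, Sum.elim_inr]
    · exact (hf.comp_aemeasurable (hXm a)).const_mul r
    · exact (hh.comp_aemeasurable (hYm b)).const_mul s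
  have h2 := congrFun (h1.charFun_map_fun_sum_eq_prod hZm) 1
  have e : (fun ω => ∑ c, Z c ω) = fun ω => r * ∑ a, f (X a ω) + s * ∑ b, h (Y b ω) := by
    ext ω
    simp [hZ, Fintype.sum_sum_type, Finset.mul_sum]
  have eX : ∀ a, charFun (μ.map fun ω => r * f (X a ω)) 1 = charFun (P.map f) r := fun a => by
    have h3 : AEMeasurable (fun ω => f (X a ω)) μ := hf.comp_aemeasurable (hXm a)
    rw [charFun_map_mul_comp h3, mul_one, ← (hX a).map_eq,
      AEMeasurable.map_map_of_aemeasurable hf.aemeasurable (hXm a)]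
    rfl
  have eY : ∀ b, charFun (μ.map fun ω => s * h (Y b ω)) 1 = charFun (Q.map h) s := fun b => by
    have h3 : AEMeasurable (fun ω => h (Y b ω)) μ := hh.comp_aemeasurable (hYm b)
    rw [charFun_map_mul_comp h3, mul_one, ← (hY b).map_eq,
      AEMeasurable.map_map_of_aemeasurable hh.aemeasurable (hYm b)]
    rfl
  rw [← e, h2]
  simp [Finset.prod_apply, Fintype.prod_sum_type, hZ, eX, eY]

lemma charFun_map_eq_charFun_inner {p : ℕ} {Z : Ω → Vec p} (hZ : AEMeasurable Z μ) (t : Vec p) :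
    charFun (μ.map Z) t = charFun (μ.map fun ω => ⟪t, Z ω⟫) 1 := by
  have h1 : AEMeasurable (fun ω => ⟪t, Z ω⟫) μ := by fun_prop
  rw [charFun_apply, charFun_apply, integral_map hZ (by fun_prop), integral_map h1 (by fun_prop)]
  refine integral_congr_ae (ae_of_all _ fun ω => ?_)
  simp [real_inner_comm]

lemma inner_normSum {d p n m : ℕ} (g : Vec d → Vec p → Vec p) (θ u : Vec p)
    (x : Fin n → Fin m → Vec d) :
    ⟪u, normSum g θ x⟫ = (√((n * m : ℕ) : ℝ))⁻¹ * ∑ a : Fin n × Fin m, ⟪u, g (x a.1 a.2) θ⟫ := by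
  rw [normSum_eq, inner_smul_right, inner_sum]
  simp only [groupSum, inner_smul_right, inner_sum, ← Finset.mul_sum, Fintype.sum_prod_type]
  rw [Nat.cast_mul, Real.sqrt_mul (Nat.cast_nonneg n), mul_inv, mul_assoc]

lemma aemeasurable_normSum {d p n m : ℕ} {g : Vec d → Vec p → Vec p} {θ : Vec p}
    (hg : Measurable fun y => g y θ) {X : Fin n → Fin m → Ω → Vec d}
    (hX : ∀ i k, AEMeasurable (X i k) μ) :
    AEMeasurable (fun ω => normSum g θ fun i k => X i k ω) μ := by
  have h : ∀ i k, AEMeasurable (fun ω => g (X i k ω) θ) μ := fun i k =>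
    hg.comp_aemeasurable (hX i k)
  simp only [normSum_eq, groupSum]
  fun_prop

variable {d p : ℕ} {n₁ n₂ m : ℕ → ℕ} {PX PY : Measure (Vec d)}
  {X : (k : ℕ) → Fin (n₁ k) → Fin (m k) → Ω → Vec d}
  {Y : (k : ℕ) → Fin (n₂ k) → Fin (m k) → Ω → Vec d} {g : Vec d → Vec p → Vec p} {θx θy : Vec p}

/-- Joint asymptotic normality of the normalized sums of the two samples. -/
lemma tendsto_charFun_normSum_add [IsProbabilityMeasure μ] [IsProbabilityMeasure PX]
    [IsProbabilityMeasure PY] (hXY : ∀ k, IsTwoSample μ PX PY (X k) (Y k)) (hm : ∀ k, 1 ≤ m k)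
    (hn₁ : Tendsto n₁ atTop atTop) (hn₂ : Tendsto n₂ atTop atTop)
    (hg : ∀ θ, Measurable fun y => g y θ)
    (hgX : MemLp (fun y => g y θx) 2 PX) (hgY : MemLp (fun y => g y θy) 2 PY)
    (hX0 : ∫ y, g y θx ∂PX = 0) (hY0 : ∫ y, g y θy ∂PY = 0) (u v : Vec p) :
    Tendsto (fun k => charFun (μ.map fun ω => ⟪u, normSum g θx fun i j => X k i j ω⟫ +
      ⟪v, normSum g θy fun i j => Y k i j ω⟫) 1) atTop
      (𝓝 (Complex.exp (-((⟪momentOp g PX θx u, u⟫ + ⟪momentOp g PY θy v, v⟫ : ℝ) : ℂ) / 2))) := by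
  have hN : ∀ {n : ℕ → ℕ}, Tendsto n atTop atTop → Tendsto (fun k => n k * m k) atTop atTop :=
    fun hn => tendsto_atTop_mono (fun k => Nat.le_mul_of_pos_right _ (hm k)) hn
  have h1 := (tendsto_charFun_map_pow (hgX.const_inner u)
    (by rw [integral_inner (hgX.integrable one_le_two), hX0, inner_zero_right])).comp (hN hn₁)
  have h2 := (tendsto_charFun_map_pow (hgY.const_inner v)
    (by rw [integral_inner (hgY.integrable one_le_two), hY0, inner_zero_right])).comp (hN hn₂)
  have h3 := h1.mul h2
  rw [← Complex.exp_add] at h3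
  rw [inner_momentOp hgX, inner_momentOp hgY]
  convert! h3 using 2 with k
  · have h4 := charFun_map_sum_add_sum (fun a : Fin (n₁ k) × Fin (m k) => (hXY k).law_X a.1 a.2)
      (fun a : Fin (n₂ k) × Fin (m k) => (hXY k).law_Y a.1 a.2) (hXY k).indep
      (f := fun y => ⟪u, g y θx⟫) (h := fun y => ⟪v, g y θy⟫)
      (measurable_const.inner (hg θx)) (measurable_const.inner (hg θy))
      (√((n₁ k * m k : ℕ) : ℝ))⁻¹ (√((n₂ k * m k : ℕ) : ℝ))⁻¹
    simp only [inner_normSum]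
    simpa only [Fintype.card_prod, Fintype.card_fin, Function.comp_apply] using h4
  · simp only [← sq]
    push_cast
    ring_nf

/-- `M` is injective, hence onto, so `t = M v`; then the left side is `⟪v, M' M v⟫ = ‖M v‖²`. The
whitened contrast therefore has identity limiting covariance. -/
lemma inner_whitening {T M : Vec p →L[ℝ] Vec p} (hM : ∀ v, T (M.adjoint (M v)) = v) (t : Vec p) :
    ⟪T (M.adjoint t), M.adjoint t⟫ = ‖t‖ ^ 2 := by
  have hinj : Function.Injective M.toLinearMap := fun u v h => by
    rw [← hM u, ← hM v]
    exact congrArg (fun w => T (M.adjoint w)) h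
  obtain ⟨v, rfl⟩ := (LinearMap.injective_iff_surjective.1 hinj) t
  have h1 : M.toLinearMap v = M v := rfl
  rw [h1, hM, ContinuousLinearMap.adjoint_inner_right, real_inner_self_eq_norm_sq]

lemma aemeasurable_contrast {N₁ N₂ K : ℕ} (hg : ∀ θ, Measurable fun y => g y θ)
    {X : Fin N₁ → Fin K → Ω → Vec d} {Y : Fin N₂ → Fin K → Ω → Vec d}
    (h : IsTwoSample μ PX PY X Y) (A : Vec p →L[ℝ] Vec p) :
    AEMeasurable (fun ω => contrast g θx θy A (fun i j => X i j ω) (fun i j => Y i j ω)) μ :=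
  (aemeasurable_normSum (hg θx) fun i j => (h.law_X i j).aemeasurable).sub
    (A.continuous.measurable.comp_aemeasurable
      (aemeasurable_normSum (hg θy) fun i j => (h.law_Y i j).aemeasurable))

/-- Central limit theorem for the whitened contrast. -/
lemma tendsto_measure_norm_contrast_le [IsProbabilityMeasure μ] [IsProbabilityMeasure PX]
    [IsProbabilityMeasure PY] (hXY : ∀ k, IsTwoSample μ PX PY (X k) (Y k)) (hm : ∀ k, 1 ≤ m k)
    (hn₁ : Tendsto n₁ atTop atTop) (hn₂ : Tendsto n₂ atTop atTop)
    (hg : ∀ θ, Measurable fun y => g y θ)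
    (hgX : MemLp (fun y => g y θx) 2 PX) (hgY : MemLp (fun y => g y θy) 2 PY)
    (hX0 : ∫ y, g y θx ∂PX = 0) (hY0 : ∫ y, g y θy ∂PY = 0) {A M : Vec p →L[ℝ] Vec p}
    (hM : ∀ v, momentOp g PX θx (M.adjoint (M v)) +
      A (momentOp g PY θy (A.adjoint (M.adjoint (M v)))) = v) (hp : 1 ≤ p) (t : ℝ) :
    Tendsto (fun k => μ {ω | ‖M (contrast g θx θy A (fun i j => X k i j ω)
      (fun i j => Y k i j ω))‖ ^ 2 ≤ t}) atTop (𝓝 (chiSquare p (Set.Iic t))) := by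
  set Z : ℕ → Ω → Vec p := fun k ω =>
    M (contrast g θx θy A (fun i j => X k i j ω) (fun i j => Y k i j ω)) with hZ
  have hZm : ∀ k, AEMeasurable (Z k) μ := fun k =>
    M.continuous.measurable.comp_aemeasurable (aemeasurable_contrast hg (hXY k) A)
  set ν : ℕ → ProbabilityMeasure (Vec p) := fun k =>
    ⟨μ.map (Z k), Measure.isProbabilityMeasure_map (hZm k)⟩ with hν
  have hlim : Tendsto ν atTop (𝓝 ⟨stdGaussian (Vec p), inferInstance⟩) := by
    refine ProbabilityMeasure.tendsto_of_tendsto_charFun fun v => ?_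
    -- The inner product of `v` with `M D` is the pairing of the two normalized sums with `M' v` and
    -- `-A' M' v`.
    have h1 := tendsto_charFun_normSum_add hXY hm hn₁ hn₂ hg hgX hgY hX0 hY0 (M.adjoint v)
      (-A.adjoint (M.adjoint v))
    have h2 := inner_whitening (T := momentOp g PX θx + A ∘L momentOp g PY θy ∘L A.adjoint) hM v
    have h3 : ⟪momentOp g PX θx (M.adjoint v), M.adjoint v⟫ +
        ⟪momentOp g PY θy (-A.adjoint (M.adjoint v)), -A.adjoint (M.adjoint v)⟫ = ‖v‖ ^ 2 := by
      rw [← h2, map_neg, inner_neg_neg, ContinuousLinearMap.adjoint_inner_right A, ← inner_add_left]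
      rfl
    rw [h3] at h1
    change Tendsto (fun k => charFun (μ.map (Z k)) v) atTop (𝓝 (charFun (stdGaussian (Vec p)) v))
    rw [charFun_stdGaussian]
    convert! h1 using 3 with k
    · rw [charFun_map_eq_charFun_inner (hZm k)]
      congr 2
      ext ω
      simp only [hZ, contrast, map_sub, inner_sub_right, inner_neg_left,
        ContinuousLinearMap.adjoint_inner_left]
      ring
    · push_cast
      rfl
  -- The frontier lies in a sphere, which is null because the chi-square law has no atoms.
  have hfr : stdGaussian (Vec p) (frontier {v | ‖v‖ ^ 2 ≤ t}) = 0 := by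
    refine measure_mono_null (frontier_le_subset_eq (by fun_prop) continuous_const) ?_
    have h1 := stdGaussian_norm_sq_preimage (p := p) (measurableSet_singleton t)
    rw [chiSquare_singleton hp] at h1
    exact h1
  have h4 := ProbabilityMeasure.tendsto_measure_of_null_frontier_of_tendsto' hlim hfr
  have h5 : stdGaussian (Vec p) {v | ‖v‖ ^ 2 ≤ t} = chiSquare p (Set.Iic t) :=
    stdGaussian_norm_sq_preimage measurableSet_Iic
  change Tendsto _ _ (𝓝 (stdGaussian (Vec p) {v | ‖v‖ ^ 2 ≤ t})) at h4
  rw [h5] at h4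
  refine h4.congr fun k => ?_
  exact Measure.map_apply_of_aemeasurable (hZm k)
    (measurableSet_le (by fun_prop) measurable_const)

end CentralLimit

/-! ### Tightness of the normalized sums -/

section Tightness

open scoped RealInnerProductSpace

variable {Ω : Type*} [MeasurableSpace Ω] {μ : Measure Ω} {d p : ℕ}
  {n m : ℕ → ℕ} {P : Measure (Vec d)} {X : (k : ℕ) → Fin (n k) → Fin (m k) → Ω → Vec d}
  {g : Vec d → Vec p → Vec p} {θ : Vec p}

/-- Boundedness in probability is not eventual boundedness along `probFilter`. It suffices to argue
on events whose complements have probability at most `η`, for each `η`. -/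
lemma eventually_probFilter_of_forall_exists {q : ℕ × Ω → Prop}
    (h : ∀ η : ℝ≥0∞, 0 < η → ∃ s : Set (ℕ × Ω), (∀ᶠ k in atTop, μ {ω | (k, ω) ∉ s} ≤ η) ∧
      ∀ᶠ a in probFilter μ ⊓ 𝓟 s, q a) : ∀ᶠ a in probFilter μ, q a := by
  rw [eventually_probFilter, ENNReal.tendsto_nhds_zero]
  intro η hη
  obtain ⟨s, hs, hq⟩ := h (η / 2) (ENNReal.half_pos hη.ne')
  have h1 := eventually_probFilter.1 (eventually_inf_principal.1 hq)
  rw [ENNReal.tendsto_nhds_zero] at h1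
  filter_upwards [h1 (η / 2) (ENNReal.half_pos hη.ne'), hs] with k h2 h3
  calc μ {ω | ¬ q (k, ω)} ≤ μ ({ω | ¬ ((k, ω) ∈ s → q (k, ω))} ∪ {ω | (k, ω) ∉ s}) :=
        measure_mono fun ω hω => by
          by_cases h4 : (k, ω) ∈ s
          · exact Or.inl fun h5 => hω (h5 h4)
          · exact Or.inr h4
    _ ≤ η / 2 + η / 2 := (measure_union_le _ _).trans (add_le_add h2 h3)
    _ = η := ENNReal.add_halves η

variable [IsProbabilityMeasure μ]

lemma IsIIDArray.integral_inner_normSum_sq_le (h : IsIIDArray μ P n m X) [IsProbabilityMeasure P]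
    (hg : MemLp (fun y => g y θ) 2 P) (h0 : ∫ y, g y θ ∂P = 0) (u : Vec p) (k : ℕ) :
    MemLp (fun ω => ⟪u, normSum g θ fun i j => X k i j ω⟫) 2 μ ∧
    ∫ ω, ⟪u, normSum g θ fun i j => X k i j ω⟫ ^ 2 ∂μ ≤ ∫ y, ⟪u, g y θ⟫ ^ 2 ∂P := by
  have hf : MemLp (fun y => ⟪u, g y θ⟫) 2 P := hg.const_inner u
  have hf0 : ∫ y, ⟪u, g y θ⟫ ∂P = 0 := by
    rw [integral_inner (hg.integrable one_le_two), h0, inner_zero_right]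
  have hfX : ∀ a : Fin (n k) × Fin (m k), MemLp (fun ω => ⟪u, g (X k a.1 a.2 ω) θ⟫) 2 μ :=
    fun a => HasLaw.memLp_comp (h.law k a.1 a.2) hf
  have h1 := integral_sum_sq_eq (h.iIndepFun_comp hf.aemeasurable k) hfX
    (fun a => (HasLaw.integral_fun_comp (h.law k a.1 a.2) hf.aestronglyMeasurable).trans hf0)
    (fun a => HasLaw.integral_fun_comp (h.law k a.1 a.2) (f := fun y => ⟪u, g y θ⟫ ^ 2)
      hf.integrable_sq.aestronglyMeasurable) Finset.univ
  simp only [inner_normSum]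
  refine ⟨(memLp_finsetSum _ fun a _ => hfX a).const_mul _, ?_⟩
  simp only [mul_pow, inv_pow, integral_const_mul, h1]
  rw [Real.sq_sqrt (Nat.cast_nonneg _)]
  simp only [Finset.card_univ, Fintype.card_prod, Fintype.card_fin]
  have h2 : 0 ≤ ∫ y, ⟪u, g y θ⟫ ^ 2 ∂P := integral_nonneg fun y => sq_nonneg _
  rw [← mul_assoc]
  exact mul_le_of_le_one_left h2 inv_mul_le_one

lemma IsIIDArray.exists_measure_normSum_le (h : IsIIDArray μ P n m X) [IsProbabilityMeasure P]
    (hg : MemLp (fun y => g y θ) 2 P) (h0 : ∫ y, g y θ ∂P = 0) {η : ℝ≥0∞} (hη : 0 < η) :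
    ∃ R : ℝ, ∀ k, μ {ω | ¬ ‖normSum g θ fun i j => X k i j ω‖ ≤ R} ≤ η := by
  rcases eq_or_ne η ⊤ with rfl | hη'
  · exact ⟨0, fun k => le_top⟩
  have hr : 0 < η.toReal := ENNReal.toReal_pos hη.ne' hη'
  set b := EuclideanSpace.basisFun (Fin p) ℝ
  set C := ∑ j, ∫ y, ⟪b j, g y θ⟫ ^ 2 ∂P with hC
  have hC0 : 0 ≤ C := Finset.sum_nonneg fun j _ => integral_nonneg fun y => sq_nonneg _
  -- `C` bounds the second moment of the normalized sum, so Markov's inequality gives probability at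
  -- most `C / ε ≤ η`.
  set ε := (C + 1) / η.toReal with hε
  have hε0 : 0 < ε := by positivity
  refine ⟨√ε, fun k => ?_⟩
  have e : ∀ ω, ‖normSum g θ fun i j => X k i j ω‖ ^ 2 =
      ∑ j, ⟪b j, normSum g θ fun i j => X k i j ω⟫ ^ 2 := fun ω => by
    rw [← b.sum_sq_norm_inner_right]
    simp only [Real.norm_eq_abs, sq_abs]
  have hint : ∀ j ∈ (Finset.univ : Finset (Fin p)),
      Integrable (fun ω => ⟪b j, normSum g θ fun i j => X k i j ω⟫ ^ 2) μ := fun j _ =>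
    (h.integral_inner_normSum_sq_le hg h0 (b j) k).1.integrable_sq
  have h1 := mul_meas_ge_le_integral_of_nonneg (μ := μ)
    (f := fun ω => ‖normSum g θ fun i j => X k i j ω‖ ^ 2) (ae_of_all μ fun ω => sq_nonneg _)
    (by simp only [e]; exact integrable_finsetSum _ hint) ε
  have h2 : ∫ ω, ‖normSum g θ fun i j => X k i j ω‖ ^ 2 ∂μ ≤ C := by
    simp only [e]
    rw [integral_finsetSum _ hint]
    exact Finset.sum_le_sum fun j _ => (h.integral_inner_normSum_sq_le hg h0 (b j) k).2
  have h3 : μ.real {ω | ε ≤ ‖normSum g θ fun i j => X k i j ω‖ ^ 2} ≤ η.toReal := by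
    refine le_of_mul_le_mul_left ((h1.trans h2).trans ?_) hε0
    rw [hε, div_mul_cancel₀ _ hr.ne']
    linarith
  refine (measure_mono fun ω (hω : ¬ _) => ?_).trans
    ((ENNReal.toReal_le_toReal (measure_ne_top _ _) hη').1 h3)
  exact Real.sqrt_le_left (norm_nonneg _) |>.1 (not_le.1 hω).le

end Tightness

/-! ### The regularity conditions -/

section Conditions

open scoped RealInnerProductSpace Matrix

variable {d p : ℕ} {g : Vec d → Vec p → Vec p} {P : Measure (Vec d)} {θ : Vec p} {U : Set (Vec p)}

lemma MomentAndCramer.memLp (h : MomentAndCramer g P θ) (hg : Measurable fun y => g y θ) :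
    MemLp (fun y => g y θ) 3 P := by
  rw [← integrable_norm_rpow_iff hg.aestronglyMeasurable (by norm_num) (by norm_num)]
  have h1 := h.moment
  simpa using h1

/-- The integral of a non-integrable function is zero by convention, and the zero map does not have
rank `p ≥ 1`. -/
lemma FullRankJacobian.integrable_fderiv (h : FullRankJacobian g P θ) (hp : 1 ≤ p) :
    Integrable (fun y => fderiv ℝ (g y) θ) P := by
  by_contra hn
  have h0 : meanJacobian g P θ = 0 := integral_undef hn
  have h1 : LinearMap.range (0 : Vec p →L[ℝ] Vec p).toLinearMap = ⊥ := LinearMap.range_zero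
  rw [FullRankJacobian, h0, h1, finrank_bot] at h
  omega

lemma FullRankJacobian.injective (h : FullRankJacobian g P θ) :
    Function.Injective (meanJacobian g P θ) := by
  have h1 : LinearMap.range (meanJacobian g P θ).toLinearMap = ⊤ :=
    Submodule.eq_top_of_finrank_eq (by rw [finrank_euclideanSpace_fin]; exact h)
  exact LinearMap.injective_iff_surjective.2 (LinearMap.range_eq_top.1 h1)

variable [IsProbabilityMeasure P]

lemma varMatrix_apply_eq (hg : MemLp (fun y => g y θ) 2 P) (h0 : ∫ y, g y θ ∂P = 0) (i j : Fin p) :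
    varMatrix g P θ i j = ⟪momentOp g P θ (EuclideanSpace.basisFun (Fin p) ℝ i),
      EuclideanSpace.basisFun (Fin p) ℝ j⟫ := by
  have h1 : ∀ k, ∫ y, g y θ k ∂P = 0 := fun k => by
    have h2 := integral_inner (𝕜 := ℝ) (hg.integrable one_le_two) (EuclideanSpace.basisFun (Fin p) ℝ k)
    rw [h0, inner_zero_right] at h2
    simpa [EuclideanSpace.inner_single_left] using h2
  rw [inner_momentOp hg]
  simp [varMatrix, covariance, h1, EuclideanSpace.inner_single_left]

lemma inner_momentOp_pos (hV : (varMatrix g P θ).PosDef) (hg : MemLp (fun y => g y θ) 2 P)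
    (h0 : ∫ y, g y θ ∂P = 0) {v : Vec p} (hv : v ≠ 0) : 0 < ⟪momentOp g P θ v, v⟫ := by
  have h1 := hV.dotProduct_mulVec_pos (x := fun i => v i)
    (fun h => hv (by ext i; exact congrFun h i))
  convert! h1 using 1
  set b := EuclideanSpace.basisFun (Fin p) ℝ
  have hv : v = ∑ i, v i • b i := by
    conv_lhs => rw [← b.sum_repr v]
    rfl
  conv_lhs => rw [hv]
  simp only [map_sum, map_smul, sum_inner, inner_sum, inner_smul_left, inner_smul_right,
    RCLike.conj_to_real, dotProduct, Matrix.mulVec, varMatrix_apply_eq hg h0, Finset.mul_sum,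
    Pi.star_apply, star_trivial]
  refine Finset.sum_congr rfl fun i _ => Finset.sum_congr rfl fun j _ => ?_
  rw [inner_momentOp_comm hg, real_inner_comm]
  ring

lemma injective_of_inner_pos {T : Vec p →L[ℝ] Vec p} (h : ∀ v, v ≠ 0 → 0 < ⟪T v, v⟫) :
    Function.Injective T := by
  rw [injective_iff_map_eq_zero]
  intro v hv
  by_contra h0
  have := h v h0
  rw [hv, inner_zero_left] at this
  exact this.false

lemma regularModel_of_posDef (hp : 1 ≤ p) (hg : ∀ θ, Measurable fun x => g x θ)
    (hθ : IsParameter g P θ) (hV : (varMatrix g P θ).PosDef) (hU : IsOpen U) (hθU : θ ∈ U)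
    (hR : RegularOn g P U) (hM : MemLp (fun y => g y θ) 2 P) (hJ : FullRankJacobian g P θ) :
    RegularModel g P U θ where
  isOpen := hU
  mem := hθU
  measurable := hg
  isParameter := hθ
  regularOn := hR
  integrable_fderiv := hJ.integrable_fderiv hp
  injective_jacobian := hJ.injective
  injective_momentOp := injective_of_inner_pos fun _ hv => inner_momentOp_pos hV hM hθ.eq_zero hv

/-- `A = ρ⁻¹ S J⁻¹`, used to eliminate the local parameter from the contrast. -/
lemma exists_smul_comp_eq {ρ : ℝ} (hρ : ρ ≠ 0) (S : Vec p →L[ℝ] Vec p) {J : Vec p →L[ℝ] Vec p}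
    (hJ : Function.Injective J) : ∃ A : Vec p →L[ℝ] Vec p, ∀ v, ρ • A (J v) = S v := by
  set e := LinearEquiv.ofInjectiveEndo J.toLinearMap hJ with he
  refine ⟨ρ⁻¹ • (S ∘L e.symm.toLinearMap.toContinuousLinearMap), fun v => ?_⟩
  have h1 : e.symm (J v) = v := by
    rw [LinearEquiv.symm_apply_eq]
    rfl
  simp [h1, smul_smul, hρ]

end Conditions

/-! ### Samples -/

section Samples

variable {Ω : Type*} [MeasurableSpace Ω] {μ : Measure Ω} {d p : ℕ}

lemma isIIDArray_left {n₁ n₂ m : ℕ → ℕ} {PX PY : Measure (Vec d)}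
    {X : (k : ℕ) → Fin (n₁ k) → Fin (m k) → Ω → Vec d}
    {Y : (k : ℕ) → Fin (n₂ k) → Fin (m k) → Ω → Vec d}
    (h : ∀ k, IsTwoSample μ PX PY (X k) (Y k)) : IsIIDArray μ PX n₁ m X where
  law k := (h k).law_X
  indep k := (h k).indep.precomp Sum.inl_injective

lemma isIIDArray_right {n₁ n₂ m : ℕ → ℕ} {PX PY : Measure (Vec d)}
    {X : (k : ℕ) → Fin (n₁ k) → Fin (m k) → Ω → Vec d}
    {Y : (k : ℕ) → Fin (n₂ k) → Fin (m k) → Ω → Vec d}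
    (h : ∀ k, IsTwoSample μ PX PY (X k) (Y k)) : IsIIDArray μ PY n₂ m Y where
  law k := (h k).law_Y
  indep k := (h k).indep.precomp Sum.inr_injective

lemma IsIIDArray.goodSample [IsProbabilityMeasure μ] {n m : ℕ → ℕ} {P : Measure (Vec d)} [IsProbabilityMeasure P]
    {X : (k : ℕ) → Fin (n k) → Fin (m k) → Ω → Vec d} {g : Vec d → Vec p → Vec p} {θ : Vec p}
    (h : IsIIDArray μ P n m X) (hn : Tendsto n atTop atTop) (hm : ∀ k, 1 ≤ m k)
    (hg : MemLp (fun y => g y θ) 3 P) (h0 : ∫ y, g y θ ∂P = 0) {l : Filter (ℕ × Ω)}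
    (hl : l ≤ probFilter μ) {R : ℝ}
    (hR : ∀ᶠ a in l, ‖normSum g θ fun i j => X a.1 i j a.2‖ ≤ R) :
    GoodSample l g P θ (fun a => n a.1) (fun a => m a.1) (fun a i j => X a.1 i j a.2) where
  law := (h.empiricalLaw hn hm).comp hl
  groups := (h.regularGroups hn hm hg h0).comp hl
  bounded := Asymptotics.IsBigO.of_bound R (by simpa using hR)

/-- Up to events of vanishing probability, `{T ≤ t}` lies between `{Q ≤ t - ε}` and `{Q ≤ t + ε}`;
the continuity of the limiting distribution function lets `ε` tend to zero. -/
lemma tendstoChiSquare_of_eventually [IsProbabilityMeasure μ] (hp : 1 ≤ p) {T : ℕ → Ω → EReal} {Q : ℕ → Ω → ℝ}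
    (hQm : ∀ k, AEMeasurable (Q k) μ)
    (hQ : ∀ t, Tendsto (fun k => μ {ω | Q k ω ≤ t}) atTop (𝓝 (chiSquare p (Set.Iic t))))
    (h₁ : ∀ t : ℝ, ∀ ε > 0, ∀ᶠ a in probFilter μ, Q a.1 a.2 ≤ t - ε → T a.1 a.2 ≤ (t : EReal))
    (h₂ : ∀ t : ℝ, ∀ ε > 0, ∀ᶠ a in probFilter μ, T a.1 a.2 ≤ (t : EReal) → Q a.1 a.2 ≤ t + ε) :
    TendstoChiSquare μ T p := by
  have hQ' : ∀ t, Tendsto (fun k => μ {ω | t < Q k ω}) atTop (𝓝 (chiSquare p (Set.Ioi t))) :=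
    fun t => by
      rw [← Set.compl_Iic, prob_compl_eq_one_sub measurableSet_Iic]
      refine (ENNReal.Tendsto.sub tendsto_const_nhds (hQ t) (Or.inl ENNReal.one_ne_top)).congr
        fun k => ?_
      rw [← prob_compl_eq_one_sub₀ (nullMeasurableSet_le (hQm k) aemeasurable_const)]
      congr 1
      ext ω
      simp
  have key : ∀ {ψ : ℝ → ℝ≥0∞} {t : ℝ} {a : ℕ → ℝ≥0∞} {lo up : ℝ → ℕ → ℝ≥0∞} {r s : ℝ → ℝ},
      Tendsto ψ (𝓝 t) (𝓝 (ψ t)) → Tendsto r (𝓝[>] 0) (𝓝 t) → Tendsto s (𝓝[>] 0) (𝓝 t) →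
      (∀ ε > 0, Tendsto (lo ε) atTop (𝓝 (ψ (r ε)))) →
      (∀ ε > 0, Tendsto (up ε) atTop (𝓝 (ψ (s ε)))) →
      (∀ ε > 0, ∃ b : ℕ → ℝ≥0∞, Tendsto b atTop (𝓝 0) ∧ ∀ k, lo ε k ≤ a k + b k) →
      (∀ ε > 0, ∃ b : ℕ → ℝ≥0∞, Tendsto b atTop (𝓝 0) ∧ ∀ k, a k ≤ up ε k + b k) →
      Tendsto a atTop (𝓝 (ψ t)) := by
    intro ψ t a lo up r s hψ hr hs hlo hup hla hua
    refine tendsto_order.2 ⟨fun c hc => ?_, fun c hc => ?_⟩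
    · obtain ⟨ε, hε, hε0⟩ := (((hψ.comp hr).eventually (lt_mem_nhds hc)).and
        self_mem_nhdsWithin).exists
      obtain ⟨b, hb, hle⟩ := hla ε hε0
      have h3 := ENNReal.Tendsto.sub (hlo ε hε0) hb (Or.inr ENNReal.zero_ne_top)
      rw [tsub_zero] at h3
      filter_upwards [h3.eventually (lt_mem_nhds hε)] with k hk
      exact hk.trans_le (tsub_le_iff_right.2 (hle k))
    · obtain ⟨ε, hε, hε0⟩ := (((hψ.comp hs).eventually (gt_mem_nhds hc)).and
        self_mem_nhdsWithin).exists
      obtain ⟨b, hb, hle⟩ := hua ε hε0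
      have h3 := (hup ε hε0).add hb
      rw [add_zero] at h3
      filter_upwards [h3.eventually (gt_mem_nhds hε)] with k hk
      exact (hle k).trans_lt hk
  have hsub : ∀ t : ℝ, Tendsto (fun ε => t - ε) (𝓝[>] 0) (𝓝 t) := fun t => by
    have : Tendsto (fun ε => t - ε) (𝓝 0) (𝓝 (t - 0)) := tendsto_const_nhds.sub tendsto_id
    rw [sub_zero] at this
    exact this.mono_left nhdsWithin_le_nhds
  have hadd : ∀ t : ℝ, Tendsto (fun ε => t + ε) (𝓝[>] 0) (𝓝 t) := fun t => by
    have : Tendsto (fun ε => t + ε) (𝓝 0) (𝓝 (t + 0)) := tendsto_const_nhds.add tendsto_id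
    rw [add_zero] at this
    exact this.mono_left nhdsWithin_le_nhds
  -- Only monotonicity and subadditivity are used, so the comparison holds for outer measures and
  -- `T` need not be measurable.
  have hmeas : ∀ {r s : Ω → Prop}, μ {ω | r ω} ≤ μ {ω | s ω} + μ {ω | ¬ (r ω → s ω)} := by
    intro r s
    refine (measure_mono fun ω (hω : r ω) => ?_).trans (measure_union_le _ _)
    by_cases h : s ω
    · exact Or.inl h
    · exact Or.inr fun h' => h (h' hω)
  refine fun t => ⟨?_, ?_⟩
  · refine key (tendsto_chiSquare_Iic hp t) (hsub t) (hadd t) (fun ε _ => hQ (t - ε))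
      (fun ε _ => hQ (t + ε)) (fun ε hε => ⟨_, eventually_probFilter.1 (h₁ t ε hε), fun k => hmeas⟩)
      (fun ε hε => ⟨_, eventually_probFilter.1 (h₂ t ε hε), fun k => hmeas⟩)
  · have h₁' : ∀ ε > 0, ∀ᶠ a in probFilter μ, (t : EReal) < T a.1 a.2 → t - ε < Q a.1 a.2 :=
      fun ε hε => (h₁ t ε hε).mono fun a ha h => not_le.1 fun h' => (ha h').not_gt h
    have h₂' : ∀ ε > 0, ∀ᶠ a in probFilter μ, t + ε < Q a.1 a.2 → (t : EReal) < T a.1 a.2 :=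
      fun ε hε => (h₂ t ε hε).mono fun a ha h => not_le.1 fun h' => (ha h').not_gt h
    refine key (tendsto_chiSquare_Ioi hp t) (hadd t) (hsub t) (fun ε _ => hQ' (t + ε))
      (fun ε _ => hQ' (t - ε)) (fun ε hε => ⟨_, eventually_probFilter.1 (h₂' ε hε), fun k => hmeas⟩)
      (fun ε hε => ⟨_, eventually_probFilter.1 (h₁' ε hε), fun k => hmeas⟩)

end Samples

/-! ### Assembly of the limit theorem. -/

section Main

open scoped RealInnerProductSpace

variable {Ω : Type*} [MeasurableSpace Ω] {μ : Measure Ω} [IsProbabilityMeasure μ] {d p : ℕ}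
  {n₁ n₂ m : ℕ → ℕ} {PX PY : Measure (Vec d)} [IsProbabilityMeasure PX] [IsProbabilityMeasure PY]
  {X : (k : ℕ) → Fin (n₁ k) → Fin (m k) → Ω → Vec d}
  {Y : (k : ℕ) → Fin (n₂ k) → Fin (m k) → Ω → Vec d} {g : Vec d → Vec p → Vec p}
  {θx θy : Vec p} {Ux Uy Θx Θy : Set (Vec p)}

/-- The grouped empirical log-likelihood ratio is asymptotically chi-square if the solutions of the
weighted estimating equation of the first sample are consistent. -/
theorem tendstoChiSquare_gelLogRatio (hp : 1 ≤ p) (hXY : ∀ k, IsTwoSample μ PX PY (X k) (Y k))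
    (hm : ∀ k, 1 ≤ m k) (hn₁ : Tendsto n₁ atTop atTop) (hn₂ : Tendsto n₂ atTop atTop) {c : ℝ}
    (hc : 0 < c) (hratio : Tendsto (fun k => (n₁ k : ℝ) / (n₂ k : ℝ)) atTop (𝓝 c))
    (hx : RegularModel g PX Ux θx) (hy : RegularModel g PY Uy θy)
    (hVX : (varMatrix g PX θx).PosDef) (hgX : MemLp (fun y => g y θx) 3 PX)
    (hgY : MemLp (fun y => g y θy) 3 PY) (hΘx : Θx ∈ 𝓝 θx) (hΘy : Θy ∈ 𝓝 θy)
    (hcons : ∀ l ≤ probFilter μ, GoodSample l g PX θx (fun a => n₁ a.1) (fun a => m a.1)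
        (fun a i j => X a.1 i j a.2) →
      Consistent l g θx Θx (fun a => n₁ a.1) (fun a => m a.1) (fun a i j => X a.1 i j a.2)) :
    TendstoChiSquare μ (fun k ω => gelLogRatio g Θx Θy (θy - θx)
      (fun i j => X k i j ω) (fun i j => Y k i j ω) / (m k : EReal)) p := by
  have hgX2 : MemLp (fun y => g y θx) 2 PX := hgX.mono_exponent (by norm_num)
  have hgY2 : MemLp (fun y => g y θy) 2 PY := hgY.mono_exponent (by norm_num)
  have hX0 := hx.isParameter.eq_zero
  have hY0 := hy.isParameter.eq_zero
  have hρ : Tendsto (fun k => √((n₂ k : ℝ) / n₁ k)) atTop (𝓝 √c⁻¹) := by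
    have h := (hratio.inv₀ hc.ne').sqrt
    simpa only [inv_div] using h
  have hρ0 : √c⁻¹ ≠ 0 := (Real.sqrt_pos.2 (inv_pos.2 hc)).ne'
  obtain ⟨A, hA⟩ := exists_smul_comp_eq hρ0 (meanJacobian g PX θx) hy.injective_jacobian
  -- `Vx + A Vy A'` is the limiting covariance of the contrast; it is positive definite because `Vx`
  -- is and the second term is nonnegative.
  obtain ⟨M, hM⟩ := exists_whitening
    (T := momentOp g PX θx + A ∘L momentOp g PY θy ∘L A.adjoint)
    (fun u v => by
      simp only [add_apply, ContinuousLinearMap.comp_apply, inner_add_left, inner_add_right,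
        inner_momentOp_comm hgX2 u v]
      rw [← ContinuousLinearMap.adjoint_inner_right, inner_momentOp_comm hgY2,
        ContinuousLinearMap.adjoint_inner_left])
    (fun v hv => by
      have h1 := inner_momentOp_pos hVX hgX2 hX0 hv
      have h2 : 0 ≤ ⟪momentOp g PY θy (A.adjoint v), A.adjoint v⟫ := by
        rw [inner_momentOp hgY2]
        exact integral_nonneg fun y => mul_self_nonneg _
      simp only [add_apply, ContinuousLinearMap.comp_apply, inner_add_left]
      rw [← ContinuousLinearMap.adjoint_inner_right A]
      linarith)
  have hlX := isIIDArray_left hXY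
  have hlY := isIIDArray_right hXY
  -- Restriction to the event that both normalized sums are bounded, by constants depending on `η`,
  -- makes the samples good along the restricted filter; tightness leaves an exceptional probability
  -- of at most `η`.
  have hgood : ∀ {q : ℕ × Ω → Prop}, (∀ l ≤ probFilter μ,
      GoodSample l g PX θx (fun a => n₁ a.1) (fun a => m a.1) (fun a i j => X a.1 i j a.2) →
      GoodSample l g PY θy (fun a => n₂ a.1) (fun a => m a.1) (fun a i j => Y a.1 i j a.2) →
      ∀ᶠ a in l, q a) → ∀ᶠ a in probFilter μ, q a := by
    intro q hq
    refine eventually_probFilter_of_forall_exists fun η hη => ?_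
    obtain ⟨R, hR⟩ := hlX.exists_measure_normSum_le hgX2 hX0 (ENNReal.half_pos hη.ne')
    obtain ⟨R', hR'⟩ := hlY.exists_measure_normSum_le hgY2 hY0 (ENNReal.half_pos hη.ne')
    refine ⟨{a | ‖normSum g θx fun i j => X a.1 i j a.2‖ ≤ R ∧
      ‖normSum g θy fun i j => Y a.1 i j a.2‖ ≤ R'}, Eventually.of_forall fun k => ?_, ?_⟩
    · refine (measure_mono fun ω (hω : ¬ (_ ∧ _)) => ?_).trans ((measure_union_le _ _).trans
        ((add_le_add (hR k) (hR' k)).trans (ENNReal.add_halves η).le))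
      exact not_and_or.1 hω
    · have hs := mem_inf_of_right (f := probFilter μ) (mem_principal_self
        {a : ℕ × Ω | ‖normSum g θx fun i j => X a.1 i j a.2‖ ≤ R ∧
          ‖normSum g θy fun i j => Y a.1 i j a.2‖ ≤ R'})
      exact hq _ inf_le_left
        (hlX.goodSample hn₁ hm hgX hX0 inf_le_left (mem_of_superset hs fun a ha => ha.1))
        (hlY.goodSample hn₂ hm hgY hY0 inf_le_left (mem_of_superset hs fun a ha => ha.2))
  have hρl : ∀ l ≤ probFilter μ,
      Tendsto (fun a : ℕ × Ω => √((n₂ a.1 : ℝ) / n₁ a.1)) l (𝓝 √c⁻¹) :=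
    fun l hl => hρ.comp (tendsto_fst_probFilter.mono_left hl)
  refine tendstoChiSquare_of_eventually hp
    (Q := fun k ω => ‖M (contrast g θx θy A (fun i j => X k i j ω) (fun i j => Y k i j ω))‖ ^ 2)
    (fun k => ?_)
    (tendsto_measure_norm_contrast_le hXY hm hn₁ hn₂ hx.measurable hgX2 hgY2 hX0 hY0 hM hp)
    (fun t ε hε => hgood fun l hl hlx hly =>
      gelLogRatio_div_le_of_good hlx hly hx hy (hρl l hl) hρ0 hA hM hΘx hΘy hε t)
    (fun t ε hε => hgood fun l hl hlx hly =>
      le_of_gelLogRatio_div_le hlx hly hx hy (hρl l hl) hA hM (hcons l hl hlx) hε t)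
  have h1 : Measurable fun v : Vec p => ‖M v‖ ^ 2 := by fun_prop
  exact h1.comp_aemeasurable (aemeasurable_contrast hx.measurable (hXY k) A)

end Main

end

theorem theorem3 {d p : ℕ} (hp : 1 ≤ p)
    (g : Vec d → Vec p → Vec p) (hg : ∀ θ, Measurable fun x => g x θ)
    -- the two populations, their parameters, and the null hypothesis
    (PX PY : Measure (Vec d)) [IsProbabilityMeasure PX] [IsProbabilityMeasure PY]
    (θx₀ θy₀ π₀ : Vec p)
    (hθx : IsParameter g PX θx₀) (hθy : IsParameter g PY θy₀)
    (hH₀ : θy₀ - θx₀ = π₀)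
    -- positive definite covariance matrices
    (hVX : (varMatrix g PX θx₀).PosDef) (hVY : (varMatrix g PY θy₀).PosDef)
    -- smoothness in neighbourhoods of the parameters, with integrable bounds
    (Ux Uy : Set (Vec p)) (hUx : IsOpen Ux) (hUy : IsOpen Uy)
    (hθUx : θx₀ ∈ Ux) (hθUy : θy₀ ∈ Uy)
    (hRX : RegularOn g PX Ux) (hRY : RegularOn g PY Uy)
    -- third moments and the condition on the characteristic functions
    (hMX : MomentAndCramer g PX θx₀) (hMY : MomentAndCramer g PY θy₀)
    -- the expected Jacobians have rank `p`
    (hJX : FullRankJacobian g PX θx₀) (hJY : FullRankJacobian g PY θy₀)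
    -- sample sizes: `n₁, n₂ → ∞`, `n₁ / n₂ → c ∈ (0, ∞)`, and arbitrary group sizes `m`
    (n₁ n₂ m : ℕ → ℕ) (c : ℝ) (hc : 0 < c) (hm : ∀ k, 1 ≤ m k)
    (hn₁ : Tendsto n₁ atTop atTop) (hn₂ : Tendsto n₂ atTop atTop)
    (hratio : Tendsto (fun k => (n₁ k : ℝ) / (n₂ k : ℝ)) atTop (𝓝 c))
    -- the grouped samples
    {Ω : Type*} [MeasurableSpace Ω] (μ : Measure Ω) [IsProbabilityMeasure μ]
    (X : (k : ℕ) → Fin (n₁ k) → Fin (m k) → Ω → Vec d)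
    (Y : (k : ℕ) → Fin (n₂ k) → Fin (m k) → Ω → Vec d)
    (hXY : ∀ k, IsTwoSample μ PX PY (X k) (Y k)) :
    -- if `θx(v)` and `θy(w)` are well defined with probability tending to one, then the statistic
    -- with unrestricted `θx`, `θy` converges
    (Tendsto (fun k => μ {ω | ¬ SolutionWellDefined g fun i j => X k i j ω}) atTop (𝓝 0) →
      Tendsto (fun k => μ {ω | ¬ SolutionWellDefined g fun i j => Y k i j ω}) atTop (𝓝 0) →
      TendstoChiSquare μ (fun k ω => gelLogRatio g Set.univ Set.univ π₀
        (fun i j => X k i j ω) (fun i j => Y k i j ω) / (m k : EReal)) p) ∧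
    -- in any case it converges if `θx`, `θy` range over compact convex neighbourhoods of the
    -- parameters on which the smoothness conditions hold
    (∀ Kx Ky : Set (Vec p), IsCompact Kx → IsCompact Ky → Convex ℝ Kx → Convex ℝ Ky →
      Kx ∈ 𝓝 θx₀ → Ky ∈ 𝓝 θy₀ → Kx ⊆ Ux → Ky ⊆ Uy →
      TendstoChiSquare μ (fun k ω => gelLogRatio g Kx Ky π₀
        (fun i j => X k i j ω) (fun i j => Y k i j ω) / (m k : EReal)) p) := by
  subst hH₀
  have hgX := hMX.memLp (hg θx₀)
  have hgY := hMY.memLp (hg θy₀)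
  have hx := regularModel_of_posDef hp hg hθx hVX hUx hθUx hRX (hgX.mono_exponent (by norm_num)) hJX
  have hy := regularModel_of_posDef hp hg hθy hVY hUy hθUy hRY (hgY.mono_exponent (by norm_num)) hJY
  refine ⟨fun hwd _ => ?_, fun Kx Ky hKx _ hKxc _ hKx₀ hKy₀ hKxU _ => ?_⟩
  · exact tendstoChiSquare_gelLogRatio hp hXY hm hn₁ hn₂ hc hratio hx hy hVX hgX hgY univ_mem
      univ_mem fun l hl h =>
        h.consistent_of_wellDefined hx (hl (eventually_probFilter.2 hwd)) Set.univ
  · exact tendstoChiSquare_gelLogRatio hp hXY hm hn₁ hn₂ hc hratio hx hy hVX hgX hgY hKx₀ hKy₀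
      fun l _ h => h.consistent_of_compact hx hKx hKxc hKxU hKx₀
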